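/- All manifolds are smooth ($C^\infty$), finite-dimensional and without boundary. Let a Lie group $G$ with Lie algebra $\mathfrak g$ act smoothly on the left on a manifold $Q$, so that $\pi : Q \to Q/G$ is a smooth principal $G$-bundle ($Q/G$ carrying its quotient topology and a smooth structure). Let $G$ act diagonally on $Q\times Q$, let $\tilde\pi : Q\times Q \to (Q\times Q)/G$ be the resulting principal $G$-bundle, and let $\tilde G := (Q\times G)/G$ be the conjugate bundle, $G$ acting on itself by conjugation. Let $\mathcal A_d : Q\times Q\to G$ be an affine discrete connection on $\pi$ with level $\gamma$: that is, $\gamma : Q \to G$ is smooth with $\gamma(g q)=g\gamma(q)g^{-1}$, and $\mathcal A_d$ is smooth with $\mathcal A_d(g_0q_0,g_1q_1)=g_1\mathcal A_d(q_0,q_1)g_0^{-1}$ and $\mathcal A_d(q,\gamma(q)q)=e$. Let $\tilde{\mathfrak A}$ be a principal connection on $\tilde\pi$: a smooth $\mathfrak g$-valued $1$-form on $Q\times Q$ with $\tilde{\mathfrak A}(\xi_{Q\times Q}(p))=\xi$ for $\xi\in\mathfrak g$, where $\xi_{Q\times Q}$ is the infinitesimal generator of $\xi$, and $\tilde{\mathfrak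 A}(g\cdot v)=\mathrm{Ad}_g\tilde{\mathfrak A}(v)$. Then the map $\Phi : (Q\times Q)/G\to\tilde G\times Q/G$, $\Phi([q_0,q_1])=([q_0,\mathcal A_d(q_0,q_1)],\pi(q_1))$, is a well-defined diffeomorphism. Put $\Psi:=\Phi^{-1}$ and $\Upsilon:=\Phi\circ\tilde\pi$. Let $\tilde{\mathfrak g}:=((Q\times Q)\times\mathfrak g)/G$ be the adjoint bundle over $(Q\times Q)/G$ ($G$ acting on $\mathfrak g$ by $\mathrm{Ad}$) and $\hat{\mathfrak g}:=\Psi^*\tilde{\mathfrak g}$. For $p\in Q\times Q$ and a tangent vector $w$ at $\tilde\pi(p)$ there is a unique $h^{p}(w)\in T_p(Q\times Q)$ with $T\tilde\pi(h^p(w))=w$ and $\tilde{\mathfrak A}(h^p(w))=0$ (the horizontal lift). (1) There is an isomorphism of smooth vector bundles over $\tilde G\times Q/G$ $$\mathcal X : \Psi^*\big(T(Q\times Q)/G\big)\longrightarrow T(\tilde G\times Q/G)\oplus\hat{\mathfrak g}$$ with inverse $\mathcal Y$ such that, for all $y\in\tilde G\times Q/G$, all $p=(q_0,q_1)$ with $\Psi(y)=[p]$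 (equivalently $y=\Upsilon(p)$), all $v\in T_p(Q\times Q)$, $u\in T_y(\tilde G\times Q/G)$ and $\xi\in\mathfrak g$, $$\mathcal X(y,[v])=T\Upsilon(v)\oplus\big(y,[p,\tilde{\mathfrak A}(v)]\big),\qquad \mathcal Y\big(u\oplus(y,[p,\xi])\big)=\big(y,[\,h^{p}(T\Psi(u))+\xi_{Q\times Q}(p)\,]\big).$$ (2) There is an isomorphism of smooth vector bundles over $\tilde G\times Q/G$ $$\mathcal X' : \Psi^*\big(T^*(Q\times Q)/G\big)\longrightarrow T^*(\tilde G\times Q/G)\oplus\hat{\mathfrak g}^*,$$ where $G$ acts on $T^*(Q\times Q)$ by the cotangent lift, which is dual to $\mathcal X$: for all $y$ and $p$ as in (1), $\alpha\in T^*_p(Q\times Q)$ and $v\in T_p(Q\times Q)$, $$\big\langle \mathcal X'(y,[\alpha]),\,\mathcal X(y,[v])\big\rangle=\alpha(v).$$ -/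

import Mathlib

open scoped Manifold ContDiff

noncomputable section GeneralManifold

open Set Topology

/-- Gluing: a space `X` covered by open sets that are identified with open subsets of a manifold
`M'`, indexed by `ι`. -/
@[reducible] def gluedChartedSpace {ι X M' H : Type*} [TopologicalSpace X] [TopologicalSpace M']
    [TopologicalSpace H] [ChartedSpace H M'] (t : ι → OpenPartialHomeomorph X M')
    (i : X → ι) (hi : ∀ x, x ∈ (t (i x)).source) : ChartedSpace H X where
  atlas := {e | ∃ j, ∃ c ∈ atlas H M', e = (t j).trans c}
  chartAt x := (t (i x)).trans (chartAt H (t (i x) x))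
  mem_chart_source x := by simp [hi x]
  chart_mem_atlas x := ⟨_, _, chart_mem_atlas H _, rfl⟩

theorem glued_isManifold {ι X M' H E : Type*} [TopologicalSpace X] [TopologicalSpace M']
    [TopologicalSpace H] [ChartedSpace H M'] [NormedAddCommGroup E] [NormedSpace ℝ E]
    (I : ModelWithCorners ℝ E H) [IsManifold I ∞ M'] (t : ι → OpenPartialHomeomorph X M')
    (i : X → ι) (hi : ∀ x, x ∈ (t (i x)).source)
    (ht : ∀ j k, ContMDiffOn I I ∞ ((t j).symm.trans (t k)) ((t j).symm.trans (t k)).source) :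
    @IsManifold ℝ _ E _ _ H _ I ∞ X _ (gluedChartedSpace t i hi) := by
  let := gluedChartedSpace (H := H) t i hi
  have key : ∀ e ∈ atlas H X, ∀ e' ∈ atlas H X,
      ContMDiffOn I I ∞ (e.symm.trans e') (e.symm.trans e').source := by
    rintro _ ⟨j, c, hc, rfl⟩ _ ⟨k, c', hc', rfl⟩
    have h1 := contMDiffOn_symm_of_mem_maximalAtlas (I := I) (n := ∞)
      (IsManifold.subset_maximalAtlas (I := I) (n := ∞) hc)
    have h2 := contMDiffOn_of_mem_maximalAtlas (I := I) (n := ∞)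
      (IsManifold.subset_maximalAtlas (I := I) (n := ∞) hc')
    refine ((h2.comp' (ht j k)).comp' h1).mono ?_
    intro x hx
    simp only [mfld_simps] at hx ⊢
    tauto
  refine @IsManifold.mk _ _ _ _ _ _ _ _ _ _ _ _ ⟨?_⟩
  intro e e' he he'
  have hm : e.symm.trans e' ∈ IsManifold.maximalAtlas I ∞ H := by
    apply OpenPartialHomeomorph.mem_maximalAtlas_of_contMDiffOn
    · exact key e he e' he'
    · refine (key e' he' e he).mono ?_
      intro x hx
      simp only [mfld_simps] at hx ⊢
      tauto
  have := (contDiffGroupoid ∞ I).compatible_of_mem_maximalAtlas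
    ((contDiffGroupoid ∞ I).id_mem_maximalAtlas (H := H)) hm
  simpa using this

theorem glued_contMDiffOn {ι X M' H E : Type*} [TopologicalSpace X] [TopologicalSpace M']
    [TopologicalSpace H] [ChartedSpace H M'] [NormedAddCommGroup E] [NormedSpace ℝ E]
    (I : ModelWithCorners ℝ E H) [IsManifold I ∞ M'] (t : ι → OpenPartialHomeomorph X M')
    (i : X → ι) (hi : ∀ x, x ∈ (t (i x)).source)
    (ht : ∀ j k, ContMDiffOn I I ∞ ((t j).symm.trans (t k)) ((t j).symm.trans (t k)).source)
    (j : ι) :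
    let := gluedChartedSpace (H := H) t i hi
    ContMDiffOn I I ∞ (t j) (t j).source ∧ ContMDiffOn I I ∞ (t j).symm (t j).target := by
  let := gluedChartedSpace (H := H) t i hi
  have := glued_isManifold I t i hi ht
  constructor
  · intro x hx
    have hc : (t j).trans (chartAt H (t j x)) ∈ IsManifold.maximalAtlas I ∞ X :=
      IsManifold.subset_maximalAtlas ⟨j, _, chart_mem_atlas H _, rfl⟩
    have h1 := contMDiffAt_of_mem_maximalAtlas hc (x := x) (by simp [hx])
    have h2 : ContMDiffAt I I ∞ (chartAt H (t j x)).symm (chartAt H (t j x) (t j x)) :=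
      contMDiffAt_symm_of_mem_maximalAtlas (IsManifold.chart_mem_maximalAtlas _) (by simp)
    have h3 := ContMDiffAt.comp x (g := (chartAt H (t j x)).symm) (by simpa using h2) h1
    refine (h3.congr_of_eventuallyEq ?_).contMDiffWithinAt
    have : ((t j).trans (chartAt H (t j x))).source ∈ 𝓝 x :=
      ((t j).trans (chartAt H (t j x))).open_source.mem_nhds (by simp [hx])
    filter_upwards [this] with y hy
    simp only [mfld_simps] at hy ⊢
    rw [(chartAt H (t j x)).left_inv hy.2]
  · intro y hy
    set c := chartAt H y
    have hc : (t j).trans c ∈ IsManifold.maximalAtlas I ∞ X :=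
      IsManifold.subset_maximalAtlas ⟨j, _, chart_mem_atlas H _, rfl⟩
    have h1 : ContMDiffAt I I ∞ ((t j).trans c).symm (c y) :=
      contMDiffAt_symm_of_mem_maximalAtlas hc (by simp [c, hy])
    have h2 : ContMDiffAt I I ∞ c y :=
      contMDiffAt_of_mem_maximalAtlas (IsManifold.chart_mem_maximalAtlas _) (by simp [c])
    refine ((h1.comp y h2).congr_of_eventuallyEq ?_).contMDiffWithinAt
    filter_upwards [c.open_source.mem_nhds (mem_chart_source H y)] with z hz
    simp only [mfld_simps]
    rw [c.left_inv hz]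

end GeneralManifold

noncomputable section PrincipalBundles

open Set Topology MulAction Bundle

variable {EG HG EM HM EB HB EN HN : Type*}
  [NormedAddCommGroup EG] [NormedSpace ℝ EG] [TopologicalSpace HG]
  [NormedAddCommGroup EM] [NormedSpace ℝ EM] [TopologicalSpace HM]
  [NormedAddCommGroup EB] [NormedSpace ℝ EB] [TopologicalSpace HB]
  [NormedAddCommGroup EN] [NormedSpace ℝ EN] [TopologicalSpace HN]

/-- `pr : M → B` is a (left, smooth) principal `G`-bundle: it is invariant under the (smooth)
action of `G` on `M`, and near each point of `B` there is a smooth local trivialization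
`pr⁻¹(U) ≃ U × G` that is equivariant for left translations of the factor `G`. -/
structure IsPrincipalBundle (IG : ModelWithCorners ℝ EG HG) (IM : ModelWithCorners ℝ EM HM)
    (IB : ModelWithCorners ℝ EB HB) (G : Type*) [TopologicalSpace G] [ChartedSpace HG G] [Group G]
    {M : Type*} [TopologicalSpace M] [ChartedSpace HM M] [MulAction G M]
    [ContMDiffSMul IG IM ∞ G M]
    {B : Type*} [TopologicalSpace B] [ChartedSpace HB B] (pr : M → B) : Prop where
  proj_smul : ∀ (g : G) (m : M), pr (g • m) = pr m
  exists_trivialization : ∀ b : B, ∃ e : Trivialization G pr, b ∈ e.baseSet ∧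
    ContMDiffOn IM (IB.prod IG) ∞ e e.source ∧
    ContMDiffOn (IB.prod IG) IM ∞ e.toOpenPartialHomeomorph.symm e.target ∧
    ∀ (g : G), ∀ m ∈ e.source, (e (g • m)).2 = g * (e m).2

variable {IG : ModelWithCorners ℝ EG HG} {IM : ModelWithCorners ℝ EM HM}
    {IB : ModelWithCorners ℝ EB HB} {IN : ModelWithCorners ℝ EN HN}
    {G : Type*} [TopologicalSpace G] [ChartedSpace HG G] [Group G]
    {M : Type*} [TopologicalSpace M] [ChartedSpace HM M] [MulAction G M]
    [ContMDiffSMul IG IM ∞ G M]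
    {B : Type*} [TopologicalSpace B] [ChartedSpace HB B] {pr : M → B}

/-- The diagonal action on a product of two manifolds is smooth. -/
instance diagonal_contMDiffSMul {N : Type*} [TopologicalSpace N] [ChartedSpace HN N]
    [MulAction G N] [ContMDiffSMul IG IN ∞ G N] :
    ContMDiffSMul IG (IM.prod IN) ∞ G (M × N) where
  contMDiff_smul := by
    have h1 : ContMDiff (IG.prod (IM.prod IN)) IM ∞ fun p : G × (M × N) => p.1 • p.2.1 :=
      contMDiff_fst.smul (contMDiff_fst.comp contMDiff_snd)
    have h2 : ContMDiff (IG.prod (IM.prod IN)) IN ∞ fun p : G × (M × N) => p.1 • p.2.2 :=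
      contMDiff_fst.smul (contMDiff_snd.comp contMDiff_snd)
    exact h1.prodMk h2

namespace IsPrincipalBundle

/-- A chosen equivariant local trivialization near `b`. -/
def triv (h : IsPrincipalBundle IG IM IB G pr) (b : B) : Trivialization G pr :=
  (h.exists_trivialization b).choose

theorem mem_base (h : IsPrincipalBundle IG IM IB G pr) (b : B) : b ∈ (h.triv b).baseSet :=
  (h.exists_trivialization b).choose_spec.1

theorem contMDiffOn_triv (h : IsPrincipalBundle IG IM IB G pr) (b : B) :
    ContMDiffOn IM (IB.prod IG) ∞ (h.triv b) (h.triv b).source :=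
  (h.exists_trivialization b).choose_spec.2.1

theorem contMDiffOn_triv_symm (h : IsPrincipalBundle IG IM IB G pr) (b : B) :
    ContMDiffOn (IB.prod IG) IM ∞ (h.triv b).toOpenPartialHomeomorph.symm (h.triv b).target :=
  (h.exists_trivialization b).choose_spec.2.2.1

/-- The local section `x ↦ e⁻¹(x, 1)` of the chosen trivialization `e` near `b`. -/
def sec (h : IsPrincipalBundle IG IM IB G pr) (b : B) (x : B) : M :=
  (h.triv b).toOpenPartialHomeomorph.symm (x, 1)

/-- The `G`-component of the chosen trivialization near `b`. -/
def coord (h : IsPrincipalBundle IG IM IB G pr) (b : B) (m : M) : G := (h.triv b m).2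

theorem coord_smul (h : IsPrincipalBundle IG IM IB G pr) {b : B} {m : M}
    (hm : pr m ∈ (h.triv b).baseSet) (g : G) : h.coord b (g • m) = g * h.coord b m :=
  (h.exists_trivialization b).choose_spec.2.2.2 g m ((h.triv b).mem_source.2 hm)

theorem proj_sec (h : IsPrincipalBundle IG IM IB G pr) {b x : B}
    (hx : x ∈ (h.triv b).baseSet) : pr (h.sec b x) = x :=
  (h.triv b).proj_symm_apply' hx

theorem coord_sec (h : IsPrincipalBundle IG IM IB G pr) {b x : B}
    (hx : x ∈ (h.triv b).baseSet) : h.coord b (h.sec b x) = 1 := by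
  unfold coord sec
  rw [(h.triv b).apply_symm_apply' hx]

theorem triv_eq (h : IsPrincipalBundle IG IM IB G pr) {b : B} {m : M}
    (hm : pr m ∈ (h.triv b).baseSet) : h.triv b m = (pr m, h.coord b m) :=
  Prod.ext ((h.triv b).coe_fst' hm) rfl

theorem ext_of_coord (h : IsPrincipalBundle IG IM IB G pr) {b : B} {m m' : M}
    (hm : pr m ∈ (h.triv b).baseSet) (hp : pr m = pr m') (hc : h.coord b m = h.coord b m') :
    m = m' := by
  refine (h.triv b).injOn ((h.triv b).mem_source.2 hm) ((h.triv b).mem_source.2 (by rwa [← hp])) ?_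
  have h1 := h.triv_eq hm
  rw [hp, hc] at h1
  exact h1.trans (h.triv_eq (by rwa [← hp])).symm

theorem coord_smul_sec (h : IsPrincipalBundle IG IM IB G pr) {b : B} {m : M}
    (hm : pr m ∈ (h.triv b).baseSet) : h.coord b m • h.sec b (pr m) = m := by
  have h1 : pr (h.sec b (pr m)) = pr m := h.proj_sec hm
  refine h.ext_of_coord (b := b) ?_ ?_ ?_
  · rwa [h.proj_smul, h1]
  · rw [h.proj_smul, h1]
  · rw [h.coord_smul (by rwa [h1]), h.coord_sec hm, mul_one]

theorem exists_smul_eq (h : IsPrincipalBundle IG IM IB G pr) {m m' : M} (hp : pr m = pr m') :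
    ∃ g : G, g • m = m' := by
  have hm := h.mem_base (pr m)
  refine ⟨h.coord (pr m) m' * (h.coord (pr m) m)⁻¹, h.ext_of_coord (b := pr m) ?_ ?_ ?_⟩
  · rwa [h.proj_smul]
  · rwa [h.proj_smul]
  · rw [h.coord_smul hm, inv_mul_cancel_right]

theorem smul_left_injective (h : IsPrincipalBundle IG IM IB G pr) {g g' : G} {m : M}
    (hg : g • m = g' • m) : g = g' := by
  have hm := h.mem_base (pr m)
  have h1 := congrArg (h.coord (pr m)) hg
  rw [h.coord_smul hm, h.coord_smul hm] at h1
  exact mul_right_cancel h1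

theorem surjective (h : IsPrincipalBundle IG IM IB G pr) : Function.Surjective pr :=
  fun b => ⟨h.sec b b, h.proj_sec (h.mem_base b)⟩

theorem contMDiffOn_sec (h : IsPrincipalBundle IG IM IB G pr) (b : B) :
    ContMDiffOn IB IM ∞ (h.sec b) (h.triv b).baseSet :=
  (h.contMDiffOn_triv_symm b).comp (contMDiff_id.prodMk contMDiff_const).contMDiffOn
    fun x hx => by simpa [(h.triv b).target_eq] using hx

theorem contMDiff_proj (h : IsPrincipalBundle IG IM IB G pr) : ContMDiff IM IB ∞ pr := by
  intro m
  have hs : m ∈ (h.triv (pr m)).source := (h.triv (pr m)).mem_source.2 (h.mem_base _)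
  have h1 := (h.contMDiffOn_triv (pr m)).contMDiffAt ((h.triv (pr m)).open_source.mem_nhds hs)
  refine (contMDiffAt_fst.comp m h1).congr_of_eventuallyEq ?_
  filter_upwards [(h.triv (pr m)).open_source.mem_nhds hs] with y hy
  exact ((h.triv (pr m)).coe_fst hy).symm

theorem contMDiffOn_coord (h : IsPrincipalBundle IG IM IB G pr) (b : B) :
    ContMDiffOn IM IG ∞ (h.coord b) (pr ⁻¹' (h.triv b).baseSet) := by
  rw [← (h.triv b).source_eq]
  exact contMDiff_snd.comp_contMDiffOn (h.contMDiffOn_triv b)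

/-! ### Associated bundles `(M × N) / G` -/

/-- The quotient `(M × N) / G` of the diagonal action, for a principal bundle `M → B` and a
manifold `N` with a smooth `G`-action. -/
def Assoc (_h : IsPrincipalBundle IG IM IB G pr)
    (_IN : ModelWithCorners ℝ EN HN) (N : Type*) [MulAction G N] : Type _ :=
  orbitRel.Quotient G (M × N)

section Assoc

variable {N : Type*} [MulAction G N]

/-- The quotient topology. -/
instance [TopologicalSpace N] (h : IsPrincipalBundle IG IM IB G pr) : TopologicalSpace (h.Assoc IN N) :=
  inferInstanceAs (TopologicalSpace (Quotient (orbitRel G (M × N))))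

/-- The quotient map `M × N → (M × N) / G`. -/
def assocMk (h : IsPrincipalBundle IG IM IB G pr) (IN : ModelWithCorners ℝ EN HN)
    (p : M × N) : h.Assoc IN N :=
  Quotient.mk (orbitRel G (M × N)) p

theorem assocMk_eq_mk (h : IsPrincipalBundle IG IM IB G pr) {p p' : M × N} :
    h.assocMk IN p = h.assocMk IN p' ↔ ∃ g : G, g • p' = p :=
  Quotient.eq (r := orbitRel G (M × N))

theorem assocMk_smul (h : IsPrincipalBundle IG IM IB G pr) (g : G) (p : M × N) :
    h.assocMk IN (g • p) = h.assocMk IN p := h.assocMk_eq_mk.2 ⟨g, rfl⟩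

theorem assocMk_surjective (h : IsPrincipalBundle IG IM IB G pr) :
    Function.Surjective (h.assocMk IN : M × N → h.Assoc IN N) := Quot.mk_surjective

/-- The projection `(M × N) / G → B`. -/
def assocProj (h : IsPrincipalBundle IG IM IB G pr) : h.Assoc IN N → B :=
  Quotient.lift (s := orbitRel G (M × N)) (fun p => pr p.1) (by
    rintro _ p' ⟨g, rfl⟩
    exact h.proj_smul g p'.1)

/-- The fibre coordinate `[(m, n)] ↦ c(m)⁻¹ • n`, where `c` is the `G`-component of the chosen
trivialization of `M` near `b`. -/
def assocCoord (h : IsPrincipalBundle IG IM IB G pr) (b : B) (x : h.Assoc IN N) : N :=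
  (h.coord b (Quotient.out x).1)⁻¹ • (Quotient.out x).2

theorem assocCoord_mk (h : IsPrincipalBundle IG IM IB G pr) {b : B} {p : M × N}
    (hp : pr p.1 ∈ (h.triv b).baseSet) : h.assocCoord b (h.assocMk IN p) = (h.coord b p.1)⁻¹ • p.2 := by
  have h1 : h.assocMk IN (Quotient.out (h.assocMk IN p)) = h.assocMk IN p := Quotient.out_eq _
  obtain ⟨g, hg⟩ := h.assocMk_eq_mk.1 h1
  unfold assocCoord
  rw [← hg]
  simp [h.coord_smul hp, mul_smul]

variable [TopologicalSpace N]

theorem continuous_assocProj (h : IsPrincipalBundle IG IM IB G pr) :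
    Continuous (h.assocProj : h.Assoc IN N → B) :=
  Continuous.quotient_lift (s := orbitRel G (M × N))
    (h.contMDiff_proj.continuous.comp continuous_fst) _

variable [ChartedSpace HN N]

theorem isOpenQuotientMap_assocMk [ContMDiffSMul IG IN ∞ G N]
    (h : IsPrincipalBundle IG IM IB G pr) :
    IsOpenQuotientMap (h.assocMk IN : M × N → h.Assoc IN N) := by
  have : ContinuousSMul G (M × N) :=
    ContMDiffSMul.continuousSMul (I := IG) (I' := IM.prod IN) ∞
  exact MulAction.isOpenQuotientMap_quotientMk

theorem contMDiffOn_assocCoord [LieGroup IG ∞ G] [ContMDiffSMul IG IN ∞ G N]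
    (h : IsPrincipalBundle IG IM IB G pr) (b : B) :
    ContMDiffOn (IM.prod IN) (IB.prod IN) ∞
      (fun p : M × N => (pr p.1, (h.coord b p.1)⁻¹ • p.2)) {p | pr p.1 ∈ (h.triv b).baseSet} := by
  have h1 : ContMDiffOn (IM.prod IN) IG ∞ (fun p : M × N => h.coord b p.1)
      {p | pr p.1 ∈ (h.triv b).baseSet} :=
    (h.contMDiffOn_coord b).comp contMDiffOn_fst fun p hp => hp
  exact (h.contMDiff_proj.comp_contMDiffOn contMDiffOn_fst).prodMk (h1.inv.smul contMDiffOn_snd)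

/-- The local trivialization `(M × N) / G ⊇ pr⁻¹(U) ≃ U × N`,
`[(m, n)] ↦ (pr m, c(m)⁻¹ • n)`, with inverse `(x, n) ↦ [(s(x), n)]`. -/
def assocTriv [LieGroup IG ∞ G] [ContMDiffSMul IG IN ∞ G N]
    (h : IsPrincipalBundle IG IM IB G pr) (b : B) :
    OpenPartialHomeomorph (h.Assoc IN N) (B × N) where
  toFun x := (h.assocProj x, h.assocCoord b x)
  invFun y := h.assocMk IN (h.sec b y.1, y.2)
  source := h.assocProj ⁻¹' (h.triv b).baseSet
  target := (h.triv b).baseSet ×ˢ univ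
  map_source' x hx := ⟨hx, mem_univ _⟩
  map_target' y hy := by
    change pr (h.sec b y.1) ∈ (h.triv b).baseSet
    rw [h.proj_sec hy.1]
    exact hy.1
  left_inv' x hx := by
    obtain ⟨p, rfl⟩ := h.assocMk_surjective x
    have hp : pr p.1 ∈ (h.triv b).baseSet := hx
    rw [h.assocCoord_mk hp, h.assocMk_eq_mk]
    refine ⟨(h.coord b p.1)⁻¹, ?_⟩
    refine Prod.ext ?_ rfl
    change (h.coord b p.1)⁻¹ • p.1 = h.sec b (pr p.1)
    rw [inv_smul_eq_iff, h.coord_smul_sec hp]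
  right_inv' y hy := by
    have h1 := h.proj_sec hy.1
    rw [h.assocCoord_mk (by simpa [h1] using hy.1)]
    refine Prod.ext h1 ?_
    simp [h.coord_sec hy.1]
  open_source := (h.triv b).open_baseSet.preimage h.continuous_assocProj
  open_target := (h.triv b).open_baseSet.prod isOpen_univ
  continuousOn_toFun := by
    intro x hx
    obtain ⟨p, rfl⟩ := h.assocMk_surjective x
    refine ContinuousAt.continuousWithinAt ?_
    rw [← h.isOpenQuotientMap_assocMk.continuousAt_comp_iff]
    have ho : {p : M × N | pr p.1 ∈ (h.triv b).baseSet} ∈ 𝓝 p :=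
      ((h.triv b).open_baseSet.preimage
        (h.contMDiff_proj.continuous.comp continuous_fst)).mem_nhds hx
    refine (((h.contMDiffOn_assocCoord (IN := IN) b).continuousOn).continuousAt ho).congr ?_
    filter_upwards [ho] with q hq
    exact Prod.ext rfl (h.assocCoord_mk hq).symm
  continuousOn_invFun :=
    h.isOpenQuotientMap_assocMk.continuous.comp_continuousOn
      (((h.contMDiffOn_sec b).continuousOn.comp continuousOn_fst fun y hy => hy.1).prodMk
        continuousOn_snd)

theorem assocTriv_compatible [LieGroup IG ∞ G] [ContMDiffSMul IG IN ∞ G N]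
    (h : IsPrincipalBundle IG IM IB G pr) (b b' : B) :
    ContMDiffOn (IB.prod IN) (IB.prod IN) ∞
      ((h.assocTriv (IN := IN) (N := N) b).symm.trans (h.assocTriv (IN := IN) b'))
      ((h.assocTriv (IN := IN) (N := N) b).symm.trans (h.assocTriv (IN := IN) b')).source := by
  have h1 : ContMDiffOn (IB.prod IN) (IM.prod IN) ∞ (fun y : B × N => (h.sec b y.1, y.2))
      ((h.triv b).baseSet ×ˢ univ) :=
    ((h.contMDiffOn_sec b).comp contMDiffOn_fst fun y hy => hy.1).prodMk contMDiffOn_snd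
  have hs : ∀ y ∈ ((h.assocTriv (IN := IN) (N := N) b).symm.trans
      (h.assocTriv (IN := IN) b')).source,
      y.1 ∈ (h.triv b).baseSet ∧ pr (h.sec b y.1) ∈ (h.triv b').baseSet := by
    intro y hy
    rw [OpenPartialHomeomorph.trans_source] at hy
    exact ⟨hy.1.1, hy.2⟩
  have h1' := h1.mono (t := ((h.assocTriv (IN := IN) (N := N) b).symm.trans
    (h.assocTriv (IN := IN) b')).source) fun y hy => ⟨(hs y hy).1, mem_univ _⟩
  have h2 := (h.contMDiffOn_assocCoord (IN := IN) (N := N) b').comp h1' fun y hy => (hs y hy).2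
  refine h2.congr ?_
  · intro y hy
    exact Prod.ext rfl (h.assocCoord_mk (IN := IN) (p := (h.sec b y.1, y.2)) (hs y hy).2)

/-- The manifold structure of `(M × N) / G`: the unique one for which the local trivializations
`pr⁻¹(U) ≃ U × N` are diffeomorphisms. -/
instance assocChartedSpace [LieGroup IG ∞ G] [ContMDiffSMul IG IN ∞ G N]
    (h : IsPrincipalBundle IG IM IB G pr) : ChartedSpace (ModelProd HB HN) (h.Assoc IN N) :=
  gluedChartedSpace (fun b => h.assocTriv (IN := IN) b) h.assocProj fun _ => h.mem_base _

instance assoc_isManifold [LieGroup IG ∞ G] [ContMDiffSMul IG IN ∞ G N] [IsManifold IB ∞ B]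
    [IsManifold IN ∞ N] (h : IsPrincipalBundle IG IM IB G pr) :
    IsManifold (IB.prod IN) ∞ (h.Assoc IN N) :=
  glued_isManifold (IB.prod IN) (fun b => h.assocTriv (IN := IN) (N := N) b) h.assocProj
    (fun _ => h.mem_base _) h.assocTriv_compatible

theorem contMDiffOn_assocTriv [LieGroup IG ∞ G] [ContMDiffSMul IG IN ∞ G N] [IsManifold IB ∞ B]
    [IsManifold IN ∞ N] (h : IsPrincipalBundle IG IM IB G pr) (b : B) :
    ContMDiffOn (IB.prod IN) (IB.prod IN) ∞ (h.assocTriv (IN := IN) (N := N) b)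
        (h.assocTriv (IN := IN) (N := N) b).source ∧
      ContMDiffOn (IB.prod IN) (IB.prod IN) ∞ (h.assocTriv (IN := IN) (N := N) b).symm
        (h.assocTriv (IN := IN) (N := N) b).target :=
  glued_contMDiffOn (IB.prod IN) (fun b => h.assocTriv (IN := IN) (N := N) b) h.assocProj
    (fun _ => h.mem_base _) h.assocTriv_compatible b

theorem contMDiff_assocMk [LieGroup IG ∞ G] [ContMDiffSMul IG IN ∞ G N] [IsManifold IB ∞ B]
    [IsManifold IN ∞ N] (h : IsPrincipalBundle IG IM IB G pr) :
    ContMDiff (IM.prod IN) (IB.prod IN) ∞ (h.assocMk IN : M × N → h.Assoc IN N) := by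
  intro p
  set b := pr p.1 with hb
  have ho : {q : M × N | pr q.1 ∈ (h.triv b).baseSet} ∈ 𝓝 p :=
    ((h.triv b).open_baseSet.preimage
      (h.contMDiff_proj.continuous.comp continuous_fst)).mem_nhds (h.mem_base b)
  have hmem : ∀ q ∈ {q : M × N | pr q.1 ∈ (h.triv b).baseSet},
      (pr q.1, (h.coord b q.1)⁻¹ • q.2) ∈ (h.assocTriv (IN := IN) (N := N) b).target :=
    fun q hq => ⟨hq, mem_univ _⟩
  have h1 := ((h.contMDiffOn_assocTriv (IN := IN) (N := N) b).2.comp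
    (h.contMDiffOn_assocCoord (IN := IN) (N := N) b) hmem).contMDiffAt ho
  refine h1.congr_of_eventuallyEq ?_
  filter_upwards [ho] with q hq
  have h2 : h.assocTriv (IN := IN) b (h.assocMk IN q) = (pr q.1, (h.coord b q.1)⁻¹ • q.2) :=
    Prod.ext rfl (h.assocCoord_mk hq)
  exact ((h.assocTriv (IN := IN) (N := N) b).left_inv
    (show h.assocMk IN q ∈ (h.assocTriv (IN := IN) b).source from hq)).symm.trans (by rw [h2]; rfl)

/-- The smooth local section `x ↦ (s(pr x), c(x))` of `M × N → (M × N) / G`. -/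
theorem contMDiffOn_assocSec [LieGroup IG ∞ G] [ContMDiffSMul IG IN ∞ G N] [IsManifold IB ∞ B]
    [IsManifold IN ∞ N] (h : IsPrincipalBundle IG IM IB G pr) (b : B) :
    ContMDiffOn (IB.prod IN) (IM.prod IN) ∞
      (fun x : h.Assoc IN N => (h.sec b (h.assocProj x), h.assocCoord b x))
      (h.assocProj ⁻¹' (h.triv b).baseSet) := by
  have h1 := (h.contMDiffOn_assocTriv (IN := IN) (N := N) b).1
  exact ((h.contMDiffOn_sec b).comp (contMDiff_fst.comp_contMDiffOn h1) fun x hx => hx).prodMk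
    (contMDiff_snd.comp_contMDiffOn h1)

/-- The equivariant local trivialization `p ↦ ([p], c(p.1))` of `M × N → (M × N) / G`. -/
def assocPrincipalTriv [LieGroup IG ∞ G] [ContMDiffSMul IG IN ∞ G N] [IsManifold IB ∞ B]
    [IsManifold IN ∞ N] (h : IsPrincipalBundle IG IM IB G pr) (b : B) :
    Trivialization G (h.assocMk IN : M × N → h.Assoc IN N) where
  toFun p := (h.assocMk IN p, h.coord b p.1)
  invFun y := y.2 • (h.sec b (h.assocProj y.1), h.assocCoord b y.1)
  source := {p | pr p.1 ∈ (h.triv b).baseSet}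
  target := (h.assocProj ⁻¹' (h.triv b).baseSet) ×ˢ univ
  map_source' p hp := ⟨hp, mem_univ _⟩
  map_target' y hy := by
    change pr (y.2 • h.sec b (h.assocProj y.1)) ∈ (h.triv b).baseSet
    rw [h.proj_smul, h.proj_sec hy.1]
    exact hy.1
  left_inv' p hp := by
    rw [h.assocCoord_mk hp]
    refine Prod.ext (h.coord_smul_sec hp) ?_
    simp
  right_inv' y hy := by
    have h1 := (h.assocTriv (IN := IN) (N := N) b).left_inv hy.1
    have h2 := h.proj_sec hy.1
    refine Prod.ext ?_ ?_
    · change h.assocMk IN (y.2 • _) = y.1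
      rw [h.assocMk_smul]
      exact h1
    · change h.coord b (y.2 • h.sec b (h.assocProj y.1)) = y.2
      rw [h.coord_smul (by rw [h2]; exact hy.1), h.coord_sec hy.1, mul_one]
  open_source := (h.triv b).open_baseSet.preimage
    (h.contMDiff_proj.continuous.comp continuous_fst)
  open_target := ((h.triv b).open_baseSet.preimage h.continuous_assocProj).prod isOpen_univ
  continuousOn_toFun := h.contMDiff_assocMk.continuous.continuousOn.prodMk
    ((h.contMDiffOn_coord b).continuousOn.comp continuousOn_fst fun _ hp => hp)
  continuousOn_invFun := by
    have : ContinuousSMul G (M × N) :=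
      ContMDiffSMul.continuousSMul (I := IG) (I' := IM.prod IN) ∞
    exact continuousOn_snd.smul ((h.contMDiffOn_assocSec b).continuousOn.comp continuousOn_fst
      fun _ hy => hy.1)
  baseSet := h.assocProj ⁻¹' (h.triv b).baseSet
  open_baseSet := (h.triv b).open_baseSet.preimage h.continuous_assocProj
  source_eq := rfl
  target_eq := rfl
  proj_toFun _ _ := rfl

/-- `M × N → (M × N) / G` is a principal `G`-bundle. -/
theorem assoc [LieGroup IG ∞ G] [ContMDiffSMul IG IN ∞ G N] [IsManifold IB ∞ B]
    [IsManifold IN ∞ N] (h : IsPrincipalBundle IG IM IB G pr) :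
    IsPrincipalBundle IG (IM.prod IN) (IB.prod IN) G (h.assocMk IN : M × N → h.Assoc IN N) where
  proj_smul g p := h.assocMk_smul g p
  exists_trivialization x := by
    refine ⟨h.assocPrincipalTriv (h.assocProj x), h.mem_base _, ?_, ?_, ?_⟩
    · exact h.contMDiff_assocMk.contMDiffOn.prodMk
        ((h.contMDiffOn_coord (h.assocProj x)).comp contMDiffOn_fst fun _ hp => hp)
    · exact contMDiffOn_snd.smul (I := IG)
        ((h.contMDiffOn_assocSec (h.assocProj x)).comp contMDiffOn_fst fun _ hy => hy.1)
    · exact fun g m hm => h.coord_smul hm g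

end Assoc
end IsPrincipalBundle
end PrincipalBundles

noncomputable section EquivariantBundles

set_option linter.unusedSectionVars false

open Set Topology MulAction Bundle

variable {EG HG EM HM EB HB : Type*}
  [NormedAddCommGroup EG] [NormedSpace ℝ EG] [TopologicalSpace HG]
  [NormedAddCommGroup EM] [NormedSpace ℝ EM] [TopologicalSpace HM]
  [NormedAddCommGroup EB] [NormedSpace ℝ EB] [TopologicalSpace HB]
  (IG : ModelWithCorners ℝ EG HG) (IM : ModelWithCorners ℝ EM HM)
  {IB : ModelWithCorners ℝ EB HB}
  (G : Type*) [TopologicalSpace G] [ChartedSpace HG G] [Group G]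
  {M : Type*} [TopologicalSpace M] [ChartedSpace HM M] [MulAction G M]
  [ContMDiffSMul IG IM ∞ G M]
  {B : Type*} [TopologicalSpace B] [ChartedSpace HB B] {pr : M → B}
  (F : Type*) [NormedAddCommGroup F] [NormedSpace ℝ F]
  (V : M → Type*) [∀ m, AddCommGroup (V m)] [∀ m, Module ℝ (V m)]
  [∀ m, TopologicalSpace (V m)] [TopologicalSpace (TotalSpace F V)] [FiberBundle F V]

/-- A smooth action of `G` on the vector bundle `V → M` by vector bundle isomorphisms covering the
action of `G` on `M`. -/
structure EquivariantStructure where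
  act : ∀ (g : G) (m : M), V m ≃L[ℝ] V (g • m)
  act_one : ∀ (m : M) (v : V m),
    (⟨(1 : G) • m, act 1 m v⟩ : TotalSpace F V) = ⟨m, v⟩
  act_mul : ∀ (g g' : G) (m : M) (v : V m),
    (⟨(g * g') • m, act (g * g') m v⟩ : TotalSpace F V) =
      ⟨g • g' • m, act g (g' • m) (act g' m v)⟩
  contMDiff_act : ContMDiff (IG.prod (IM.prod 𝓘(ℝ, F))) (IM.prod 𝓘(ℝ, F)) ∞
    fun p : G × TotalSpace F V => (⟨p.1 • p.2.1, act p.1 p.2.1 p.2.2⟩ : TotalSpace F V)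

variable {IG IM G F V}

/-- The induced action of `G` on the total space of `V`. -/
@[reducible] def EquivariantStructure.mulAction (A : EquivariantStructure IG IM G F V) :
    MulAction G (TotalSpace F V) where
  smul g e := ⟨g • e.1, A.act g e.1 e.2⟩
  one_smul e := A.act_one e.1 e.2
  mul_smul g g' e := A.act_mul g g' e.1 e.2

/-- The set `V / G` of orbits in the total space of `V`. -/
def EquivariantStructure.Orbits (A : EquivariantStructure IG IM G F V) : Type _ :=
  letI := A.mulAction
  orbitRel.Quotient G (TotalSpace F V)

/-- The class in `V / G` of a vector `v` over `m`. -/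
def EquivariantStructure.orbit (A : EquivariantStructure IG IM G F V) (m : M) (v : V m) :
    A.Orbits :=
  letI := A.mulAction
  Quotient.mk (orbitRel G (TotalSpace F V)) ⟨m, v⟩

theorem EquivariantStructure.orbit_eq_orbit (A : EquivariantStructure IG IM G F V) {m m' : M}
    {v : V m} {v' : V m'} : A.orbit m v = A.orbit m' v' ↔
      ∃ g : G, (⟨g • m', A.act g m' v'⟩ : TotalSpace F V) = ⟨m, v⟩ :=
  letI := A.mulAction
  Quotient.eq (r := orbitRel G (TotalSpace F V))

theorem EquivariantStructure.orbit_act (A : EquivariantStructure IG IM G F V) (g : G) (m : M)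
    (v : V m) : A.orbit (g • m) (A.act g m v) = A.orbit m v :=
  A.orbit_eq_orbit.2 ⟨g, rfl⟩

theorem EquivariantStructure.act_inv_act (A : EquivariantStructure IG IM G F V) (g : G) (m : M)
    (v : V m) : (⟨g⁻¹ • g • m, A.act g⁻¹ (g • m) (A.act g m v)⟩ : TotalSpace F V) = ⟨m, v⟩ := by
  rw [← A.act_mul, inv_mul_cancel, A.act_one]

namespace IsPrincipalBundle

/-- The projection `V / G → B` induced by `V → M → B`. -/
def orbitsProj (h : IsPrincipalBundle IG IM IB G pr) (A : EquivariantStructure IG IM G F V) :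
    A.Orbits → B :=
  letI := A.mulAction
  Quotient.lift (s := orbitRel G (TotalSpace F V)) (fun e => pr e.1) (by
    rintro _ e' ⟨g, rfl⟩
    exact h.proj_smul g e'.1)

/-- The fibre over `b : B` of the quotient bundle `V / G → B`. -/
def QuotBundle (h : IsPrincipalBundle IG IM IB G pr) (A : EquivariantStructure IG IM G F V)
    (b : B) : Type _ := {x : A.Orbits // h.orbitsProj A x = b}

/-- The class `[v]`, in the fibre of `V / G` over `b`, of a vector `v` over a point `m` over
`b`. -/
def cls (h : IsPrincipalBundle IG IM IB G pr) (A : EquivariantStructure IG IM G F V)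
    {b : B} (m : M) (hm : pr m = b) (v : V m) : h.QuotBundle A b := ⟨A.orbit m v, hm⟩

theorem cls_act (h : IsPrincipalBundle IG IM IB G pr) (A : EquivariantStructure IG IM G F V)
    {b : B} (g : G) (m : M) (hm : pr m = b) (hm' : pr (g • m) = b) (v : V m) :
    h.cls A (g • m) hm' (A.act g m v) = h.cls A m hm v :=
  Subtype.ext (A.orbit_act g m v)

theorem cls_bijective (h : IsPrincipalBundle IG IM IB G pr)
    (A : EquivariantStructure IG IM G F V) {b : B} (m : M) (hm : pr m = b) :
    Function.Bijective (h.cls A m hm) := by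
  constructor
  · intro v v' hv
    obtain ⟨g, hg⟩ := A.orbit_eq_orbit.1 (congrArg Subtype.val hv)
    have h1 : g • m = (1 : G) • m := by
      rw [one_smul]
      exact congrArg TotalSpace.proj hg
    obtain rfl := h.smul_left_injective h1
    rw [A.act_one] at hg
    exact (TotalSpace.mk_injective m hg).symm
  · rintro ⟨x, hx⟩
    let := A.mulAction
    obtain ⟨⟨m', v'⟩, rfl⟩ := Quotient.exists_rep (s := orbitRel G (TotalSpace F V)) x
    obtain ⟨g, rfl⟩ := h.exists_smul_eq (show pr m' = pr m from hx.trans hm.symm)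
    exact ⟨A.act g m' v', Subtype.ext (A.orbit_act g m' v')⟩

/-- The bijection `v ↦ [v]` between `V m` and the fibre of `V / G` over the image of `m`. -/
def clsEquiv (h : IsPrincipalBundle IG IM IB G pr) (A : EquivariantStructure IG IM G F V)
    {b : B} (m : M) (hm : pr m = b) : V m ≃ h.QuotBundle A b :=
  Equiv.ofBijective _ (h.cls_bijective A m hm)

/-- A point of `M` over `b`, chosen once and for all. -/
def rep (h : IsPrincipalBundle IG IM IB G pr) (b : B) : M := (h.surjective b).choose

theorem proj_rep (h : IsPrincipalBundle IG IM IB G pr) (b : B) : pr (h.rep b) = b :=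
  (h.surjective b).choose_spec

/-- The vector space structure of the fibres of `V / G`: the one for which all the maps `v ↦ [v]`
are linear (see `clsL` below). -/
instance (h : IsPrincipalBundle IG IM IB G pr) (A : EquivariantStructure IG IM G F V) (b : B) :
    AddCommGroup (h.QuotBundle A b) :=
  (h.clsEquiv A (h.rep b) (h.proj_rep b)).symm.addCommGroup

instance (h : IsPrincipalBundle IG IM IB G pr) (A : EquivariantStructure IG IM G F V) (b : B) :
    Module ℝ (h.QuotBundle A b) :=
  (h.clsEquiv A (h.rep b) (h.proj_rep b)).symm.module ℝ

instance (h : IsPrincipalBundle IG IM IB G pr) (A : EquivariantStructure IG IM G F V) (b : B) :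
    TopologicalSpace (h.QuotBundle A b) :=
  TopologicalSpace.induced (h.clsEquiv A (h.rep b) (h.proj_rep b)).symm inferInstance

/-- `v ↦ [v]`, for the chosen point over `b`, as a linear homeomorphism. -/
def clsRep (h : IsPrincipalBundle IG IM IB G pr) (A : EquivariantStructure IG IM G F V) (b : B) :
    V (h.rep b) ≃L[ℝ] h.QuotBundle A b :=
  let e := h.clsEquiv A (h.rep b) (h.proj_rep b)
  ContinuousLinearEquiv.symm
    { e.symm.linearEquiv ℝ with
      continuous_toFun := continuous_induced_dom
      continuous_invFun := by
        refine continuous_induced_rng.2 ?_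
        refine continuous_id.congr fun v => ?_
        exact (e.symm_apply_apply v).symm }

theorem clsRep_apply (h : IsPrincipalBundle IG IM IB G pr)
    (A : EquivariantStructure IG IM G F V) (b : B) (v : V (h.rep b)) :
    h.clsRep A b v = h.cls A (h.rep b) (h.proj_rep b) v := rfl

theorem exists_clsL (h : IsPrincipalBundle IG IM IB G pr)
    (A : EquivariantStructure IG IM G F V) {b : B} (m : M) (hm : pr m = b) :
    ∃ L : V m ≃L[ℝ] h.QuotBundle A b, ∀ v, L v = h.cls A m hm v := by
  obtain ⟨g, rfl⟩ := h.exists_smul_eq ((h.proj_rep b).trans hm.symm)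
  refine ⟨(A.act g (h.rep b)).symm.trans (h.clsRep A b), fun v => ?_⟩
  obtain ⟨w, rfl⟩ := (A.act g (h.rep b)).surjective v
  simp [clsRep_apply, h.cls_act A g (h.rep b) (h.proj_rep b)]

/-- `v ↦ [v]` as a linear homeomorphism from `V m` to the fibre of `V / G` over the image of
`m`. -/
def clsL (h : IsPrincipalBundle IG IM IB G pr) (A : EquivariantStructure IG IM G F V)
    {b : B} (m : M) (hm : pr m = b) : V m ≃L[ℝ] h.QuotBundle A b :=
  (h.exists_clsL A m hm).choose

theorem clsL_apply (h : IsPrincipalBundle IG IM IB G pr)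
    (A : EquivariantStructure IG IM G F V) {b : B} (m : M) (hm : pr m = b) (v : V m) :
    h.clsL A m hm v = h.cls A m hm v := (h.exists_clsL A m hm).choose_spec v

end IsPrincipalBundle

theorem contMDiffWithinAt_clm_of_apply {F' : Type*} [NormedAddCommGroup F'] [NormedSpace ℝ F']
    [FiniteDimensional ℝ F] {f : B → F →L[ℝ] F'} {s : Set B} {x : B}
    (hf : ∀ v, ContMDiffWithinAt IB 𝓘(ℝ, F') ∞ (fun x => f x v) s x) :
    ContMDiffWithinAt IB 𝓘(ℝ, F →L[ℝ] F') ∞ f s x := by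
  let b := Module.finBasis ℝ F
  have h1 : f = fun x => ∑ i, ContinuousLinearMap.smulRightL ℝ F F'
      (LinearMap.toContinuousLinearMap (b.coord i)) (f x (b i)) := by
    funext x
    ext v
    conv_lhs => rw [← b.sum_repr v, map_sum]
    simp
  rw [h1]
  refine contMDiffWithinAt_finsetSum fun i _ => ?_
  exact (ContinuousLinearMap.contMDiff _).contMDiffAt.comp_contMDiffWithinAt x (hf (b i))

namespace IsPrincipalBundle

/-- The vector over `m` that represents a given element of a fibre of `V / G` (and `0` if `m` does
not lie over the base point of that fibre). -/
def lift (h : IsPrincipalBundle IG IM IB G pr) (A : EquivariantStructure IG IM G F V)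
    (m : M) (z : TotalSpace F (h.QuotBundle A)) : V m :=
  open Classical in if hm : pr m = z.1 then (h.clsL A m hm).symm z.2 else 0

theorem lift_mk (h : IsPrincipalBundle IG IM IB G pr) (A : EquivariantStructure IG IM G F V)
    {b : B} (m : M) (hm : pr m = b) (z : h.QuotBundle A b) :
    h.lift A m ⟨b, z⟩ = (h.clsL A m hm).symm z := dif_pos hm

/-- The quotient map from the total space of `V` to the total space of `V / G`. -/
def quotMap (h : IsPrincipalBundle IG IM IB G pr) (A : EquivariantStructure IG IM G F V)
    (e : TotalSpace F V) : TotalSpace F (h.QuotBundle A) := ⟨pr e.1, h.cls A e.1 rfl e.2⟩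

theorem quotMap_mk (h : IsPrincipalBundle IG IM IB G pr) (A : EquivariantStructure IG IM G F V)
    {b : B} (m : M) (hm : pr m = b) (v : V m) :
    h.quotMap A ⟨m, v⟩ = ⟨b, h.cls A m hm v⟩ := by
  subst hm
  rfl

theorem lift_quotMap (h : IsPrincipalBundle IG IM IB G pr)
    (A : EquivariantStructure IG IM G F V) (m : M) (v : V m) :
    h.lift A m (h.quotMap A ⟨m, v⟩) = v := by
  unfold quotMap
  rw [h.lift_mk A m rfl, ← h.clsL_apply, ContinuousLinearEquiv.symm_apply_apply]

theorem quotMap_lift (h : IsPrincipalBundle IG IM IB G pr)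
    (A : EquivariantStructure IG IM G F V) (m : M) (z : TotalSpace F (h.QuotBundle A))
    (hm : pr m = z.1) : h.quotMap A ⟨m, h.lift A m z⟩ = z := by
  obtain ⟨b, z⟩ := z
  rw [h.lift_mk A m hm, h.quotMap_mk A m hm, ← h.clsL_apply,
    ContinuousLinearEquiv.apply_symm_apply]

theorem quotMap_act (h : IsPrincipalBundle IG IM IB G pr)
    (A : EquivariantStructure IG IM G F V) (g : G) (m : M) (v : V m) :
    h.quotMap A ⟨g • m, A.act g m v⟩ = h.quotMap A ⟨m, v⟩ := by
  rw [h.quotMap_mk A m rfl, h.quotMap_mk A (g • m) (h.proj_smul g m), h.cls_act]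

/-- The set over which the trivialization of `V / G` near `b` is defined. -/
def quotBase (h : IsPrincipalBundle IG IM IB G pr) (_A : EquivariantStructure IG IM G F V)
    (b : B) : Set B :=
  (h.triv b).baseSet ∩ h.sec b ⁻¹' (trivializationAt F V (h.sec b b)).baseSet

variable [VectorBundle ℝ F V]

/-- The local trivialization of `V / G` near `b`: represent a class over `x` by a vector over
`s(x)`, `s` being the chosen local section near `b`, and apply a trivialization of `V`. -/
def quotPretriv (h : IsPrincipalBundle IG IM IB G pr) (A : EquivariantStructure IG IM G F V)
    (b : B) : Pretrivialization F (TotalSpace.proj : TotalSpace F (h.QuotBundle A) → B) where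
  toFun z := (z.1, (trivializationAt F V (h.sec b b)).continuousLinearMapAt ℝ (h.sec b z.1)
    (h.lift A (h.sec b z.1) z))
  invFun y := h.quotMap A ⟨h.sec b y.1,
    (trivializationAt F V (h.sec b b)).symmL ℝ (h.sec b y.1) y.2⟩
  source := TotalSpace.proj ⁻¹' h.quotBase A b
  target := h.quotBase A b ×ˢ univ
  baseSet := h.quotBase A b
  open_baseSet := (h.contMDiffOn_sec b).continuousOn.isOpen_inter_preimage
    (h.triv b).open_baseSet (trivializationAt F V (h.sec b b)).open_baseSet
  open_target := ((h.contMDiffOn_sec b).continuousOn.isOpen_inter_preimage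
    (h.triv b).open_baseSet (trivializationAt F V (h.sec b b)).open_baseSet).prod isOpen_univ
  source_eq := rfl
  target_eq := rfl
  proj_toFun _ _ := rfl
  map_source' z hz := ⟨hz, mem_univ _⟩
  map_target' y hy := by
    change pr (h.sec b y.1) ∈ h.quotBase A b
    rw [h.proj_sec hy.1.1]
    exact hy.1
  left_inv' z hz := by
    dsimp only
    rw [Trivialization.symmL_continuousLinearMapAt _ hz.2,
      h.quotMap_lift A _ _ (h.proj_sec hz.1)]
  right_inv' y hy := by
    obtain ⟨x, w⟩ := y
    have hx : pr (h.sec b x) = x := h.proj_sec hy.1.1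
    dsimp only
    rw [h.quotMap_mk A _ hx, ← h.quotMap_mk A _ hx, h.quotMap_mk A _ hx, h.lift_mk A _ hx,
      ← h.clsL_apply, ContinuousLinearEquiv.symm_apply_apply,
      Trivialization.continuousLinearMapAt_symmL _ hy.1.2]

/-- The change of coordinates between two trivializations of `V / G`. -/
def quotCoordChange (h : IsPrincipalBundle IG IM IB G pr)
    (A : EquivariantStructure IG IM G F V) (b b' x : B) : F →L[ℝ] F :=
  ((trivializationAt F V (h.sec b' b')).continuousLinearMapAt ℝ
    (h.coord b (h.sec b' x) • h.sec b x)).comp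
  (((A.act (h.coord b (h.sec b' x)) (h.sec b x)) :
      V (h.sec b x) →L[ℝ] V (h.coord b (h.sec b' x) • h.sec b x)).comp
    ((trivializationAt F V (h.sec b b)).symmL ℝ (h.sec b x)))

theorem coord_smul_sec' (h : IsPrincipalBundle IG IM IB G pr) {b b' x : B}
    (hx : x ∈ (h.triv b).baseSet) (hx' : x ∈ (h.triv b').baseSet) :
    h.coord b (h.sec b' x) • h.sec b x = h.sec b' x := by
  have h1 := h.proj_sec hx'
  have h2 := h.coord_smul_sec (b := b) (m := h.sec b' x) (by rwa [h1])
  rwa [h1] at h2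

theorem quotPretriv_quotMap (h : IsPrincipalBundle IG IM IB G pr)
    (A : EquivariantStructure IG IM G F V) (b : B) (m : M) (v : V m)
    (hm : m ∈ (trivializationAt F V (h.sec b b)).baseSet) (hs : h.sec b (pr m) = m) :
    (h.quotPretriv A b (h.quotMap A ⟨m, v⟩)).2 = (trivializationAt F V (h.sec b b) ⟨m, v⟩).2 := by
  change (trivializationAt F V (h.sec b b)).continuousLinearMapAt ℝ (h.sec b (pr m))
    (h.lift A (h.sec b (pr m)) (h.quotMap A ⟨m, v⟩)) = _
  have h1 : ∀ m', m' = m →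
      (⟨m', h.lift A m' (h.quotMap A ⟨m, v⟩)⟩ : TotalSpace F V) = ⟨m, v⟩ := by
    rintro _ rfl
    rw [h.lift_quotMap]
  rw [Trivialization.continuousLinearMapAt_apply, Trivialization.linearMapAt_apply,
    if_pos (by rwa [hs]), h1 _ hs]

theorem quotCoordChange_eq (h : IsPrincipalBundle IG IM IB G pr)
    (A : EquivariantStructure IG IM G F V) (b b' x : B)
    (hx : x ∈ h.quotBase A b ∩ h.quotBase A b') (v : F) :
    h.quotCoordChange A b b' x v = (trivializationAt F V (h.sec b' b')
      ⟨h.coord b (h.sec b' x) • h.sec b x, A.act (h.coord b (h.sec b' x)) (h.sec b x)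
        ((trivializationAt F V (h.sec b b)).symmL ℝ (h.sec b x) v)⟩).2 := by
  have h2 := h.coord_smul_sec' hx.1.1 hx.2.1
  change (trivializationAt F V (h.sec b' b')).continuousLinearMapAt ℝ _ (A.act _ _ _) = _
  rw [Trivialization.continuousLinearMapAt_apply, Trivialization.linearMapAt_apply,
    if_pos (by rw [h2]; exact hx.2.2)]
  rfl

theorem quotCoordChange_apply (h : IsPrincipalBundle IG IM IB G pr)
    (A : EquivariantStructure IG IM G F V) (b b' x : B)
    (hx : x ∈ h.quotBase A b ∩ h.quotBase A b') (v : F) :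
    h.quotCoordChange A b b' x v =
      (h.quotPretriv A b' ⟨x, (h.quotPretriv A b).symm x v⟩).2 := by
  have h1 : (⟨x, (h.quotPretriv A b).symm x v⟩ : TotalSpace F (h.QuotBundle A)) =
      (h.quotPretriv A b).toPartialEquiv.symm (x, v) :=
    (h.quotPretriv A b).mk_symm hx.1 v
  have h2 := h.coord_smul_sec' hx.1.1 hx.2.1
  have h3 : (h.quotPretriv A b).toPartialEquiv.symm (x, v) =
      h.quotMap A ⟨_, A.act (h.coord b (h.sec b' x)) _
        ((trivializationAt F V (h.sec b b)).symmL ℝ (h.sec b x) v)⟩ :=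
    (h.quotMap_act A _ _ _).symm
  rw [h1, h3, h.quotCoordChange_eq A b b' x hx, h.quotPretriv_quotMap]
  · rw [h2]
    exact hx.2.2
  · rw [h.proj_smul, h.proj_sec hx.1.1, h2]

theorem contMDiffOn_quotCoordChange [FiniteDimensional ℝ F] [IsManifold IM ∞ M]
    [ContMDiffVectorBundle ∞ F V IM] (h : IsPrincipalBundle IG IM IB G pr)
    (A : EquivariantStructure IG IM G F V) (b b' : B) :
    ContMDiffOn IB 𝓘(ℝ, F →L[ℝ] F) ∞ (h.quotCoordChange A b b')
      (h.quotBase A b ∩ h.quotBase A b') := by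
  suffices H : ∀ v, ContMDiffOn IB 𝓘(ℝ, F) ∞ (fun x => h.quotCoordChange A b b' x v)
      (h.quotBase A b ∩ h.quotBase A b') from
    fun x hx => contMDiffWithinAt_clm_of_apply fun v => H v x hx
  intro v
  have hsec : ContMDiffOn IB IM ∞ (h.sec b) (h.quotBase A b ∩ h.quotBase A b') :=
    (h.contMDiffOn_sec b).mono fun x hx => hx.1.1
  have h0 : ContMDiffOn IB (IM.prod 𝓘(ℝ, F)) ∞
      (fun x => (⟨h.sec b x, (trivializationAt F V (h.sec b b)).symmL ℝ (h.sec b x) v⟩ :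
        TotalSpace F V)) (h.quotBase A b ∩ h.quotBase A b') := by
    refine (((trivializationAt F V (h.sec b b)).contMDiffOn_symm (n := ∞) (IB := IM)).comp
      (hsec.prodMk (contMDiffOn_const (c := v))) fun x hx => ?_).congr fun x hx => ?_
    · rw [(trivializationAt F V (h.sec b b)).target_eq]
      exact ⟨hx.1.2, mem_univ _⟩
    · rw [Trivialization.symmL_apply _ hx.1.2]
      exact (trivializationAt F V (h.sec b b)).mk_symm hx.1.2 v
  have hg : ContMDiffOn IB IG ∞ (fun x => h.coord b (h.sec b' x))
      (h.quotBase A b ∩ h.quotBase A b') := by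
    refine (h.contMDiffOn_coord b).comp
      ((h.contMDiffOn_sec b').mono fun x hx => hx.2.1) fun x hx => ?_
    change pr (h.sec b' x) ∈ (h.triv b).baseSet
    rw [h.proj_sec hx.2.1]
    exact hx.1.1
  have h1 := A.contMDiff_act.comp_contMDiffOn (hg.prodMk h0)
  have h2 := ((trivializationAt F V (h.sec b' b')).contMDiffOn (n := ∞) (IB := IM)).comp h1
    fun x hx => by
      rw [mem_preimage, Trivialization.mem_source]
      change h.coord b (h.sec b' x) • h.sec b x ∈ _
      rw [h.coord_smul_sec' hx.1.1 hx.2.1]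
      exact hx.2.2
  exact (contMDiff_snd.comp_contMDiffOn h2).congr fun x hx => h.quotCoordChange_eq A b b' x hx v

/-- The vector bundle structure of `V / G → B`. -/
def quotPrebundle [FiniteDimensional ℝ F] [IsManifold IM ∞ M]
    [ContMDiffVectorBundle ∞ F V IM] (h : IsPrincipalBundle IG IM IB G pr)
    (A : EquivariantStructure IG IM G F V) : VectorPrebundle ℝ F (h.QuotBundle A) where
  pretrivializationAtlas := range (h.quotPretriv A)
  pretrivialization_linear' := by
    rintro _ ⟨b, rfl⟩
    refine ⟨fun x hx => ?_⟩
    have h1 : ∀ z : h.QuotBundle A x, (h.quotPretriv A b ⟨x, z⟩).2 =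
        (trivializationAt F V (h.sec b b)).continuousLinearMapAt ℝ (h.sec b x)
          ((h.clsL A (h.sec b x) (h.proj_sec hx.1)).symm z) := fun z =>
      congrArg _ (h.lift_mk A (h.sec b x) (h.proj_sec hx.1) z)
    constructor
    · intro z z'
      rw [h1, h1, h1, map_add, map_add]
    · intro c z
      rw [h1, h1, map_smul, map_smul]
  pretrivializationAt b := h.quotPretriv A b
  mem_base_pretrivializationAt b :=
    ⟨h.mem_base b, mem_baseSet_trivializationAt F V (h.sec b b)⟩
  pretrivialization_mem_atlas b := mem_range_self b
  exists_coordChange := by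
    rintro _ ⟨b, rfl⟩ _ ⟨b', rfl⟩
    exact ⟨h.quotCoordChange A b b', (h.contMDiffOn_quotCoordChange A b b').continuousOn,
      fun x hx v => h.quotCoordChange_apply A b b' x hx v⟩
  totalSpaceMk_isInducing b := by
    have hm := mem_baseSet_trivializationAt F V (h.sec b b)
    let L : h.QuotBundle A b ≃L[ℝ] F := (h.clsL A (h.sec b b)
      (h.proj_sec (h.mem_base b))).symm.trans
      ((trivializationAt F V (h.sec b b)).continuousLinearEquivAt ℝ (h.sec b b) hm)
    have h1 : h.quotPretriv A b ∘ TotalSpace.mk b = fun z => (b, L z) := by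
      funext z
      refine Prod.ext rfl ?_
      change (trivializationAt F V (h.sec b b)).continuousLinearMapAt ℝ (h.sec b b)
        (h.lift A (h.sec b b) ⟨b, z⟩) = _
      rw [h.lift_mk A (h.sec b b) (h.proj_sec (h.mem_base b)),
        Trivialization.continuousLinearMapAt_apply, Trivialization.linearMapAt_apply, if_pos hm]
      rfl
    rw [h1]
    exact (isInducing_const_prod.2 .id).comp L.toHomeomorph.isInducing

section Instances

variable [FiniteDimensional ℝ F] [IsManifold IM ∞ M] [ContMDiffVectorBundle ∞ F V IM]

instance (h : IsPrincipalBundle IG IM IB G pr) (A : EquivariantStructure IG IM G F V) :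
    TopologicalSpace (TotalSpace F (h.QuotBundle A)) := (h.quotPrebundle A).totalSpaceTopology

instance (h : IsPrincipalBundle IG IM IB G pr) (A : EquivariantStructure IG IM G F V) :
    FiberBundle F (h.QuotBundle A) := (h.quotPrebundle A).toFiberBundle

instance (h : IsPrincipalBundle IG IM IB G pr) (A : EquivariantStructure IG IM G F V) :
    VectorBundle ℝ F (h.QuotBundle A) := (h.quotPrebundle A).toVectorBundle

instance (h : IsPrincipalBundle IG IM IB G pr) (A : EquivariantStructure IG IM G F V) :
    ContMDiffVectorBundle ∞ F (h.QuotBundle A) IB :=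
  have : (h.quotPrebundle A).IsContMDiff IB ∞ :=
    { exists_contMDiffCoordChange := by
        rintro _ ⟨b, rfl⟩ _ ⟨b', rfl⟩
        exact ⟨h.quotCoordChange A b b', h.contMDiffOn_quotCoordChange A b b',
          fun x hx v => h.quotCoordChange_apply A b b' x hx v⟩ }
  (h.quotPrebundle A).contMDiffVectorBundle IB

end Instances

end IsPrincipalBundle
end EquivariantBundles

noncomputable section Actions

set_option linter.unusedSectionVars false

open Set Topology MulAction Bundle

variable {EG HG EM HM : Type*}
  [NormedAddCommGroup EG] [NormedSpace ℝ EG] [TopologicalSpace HG]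
  [NormedAddCommGroup EM] [NormedSpace ℝ EM] [TopologicalSpace HM]
  (IG : ModelWithCorners ℝ EG HG) (IM : ModelWithCorners ℝ EM HM)
  (G : Type*) [TopologicalSpace G] [ChartedSpace HG G] [Group G]
  (M : Type*) [TopologicalSpace M] [ChartedSpace HM M] [MulAction G M]
  [ContMDiffSMul IG IM ∞ G M]

/-- The infinitesimal generator `ξ_M` at `m`: the derivative at the identity of `g ↦ g • m` in the
direction `ξ`, which is the derivative at `t = 0` of `exp (t ξ) • m`. (`TangentSpace IM (1 • m)` and
`TangentSpace IM m` are both the model space `EM` in the chart at `1 • m = m`.) -/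
def infGen {G M} [TopologicalSpace G] [ChartedSpace HG G] [Group G] [TopologicalSpace M]
    [ChartedSpace HM M] [MulAction G M] (ξ : GroupLieAlgebra IG G) (m : M) : TangentSpace IM m :=
  (mfderiv IG IM (fun g : G => g • m) 1 : EG →L[ℝ] EM) ξ

/-- The tangent lift of a smooth action, `g • v = T l_g (v)`. -/
def tangentAction [IsManifold IG ∞ G] [IsManifold IM ∞ M] :
    EquivariantStructure IG IM G EM (TangentSpace IM : M → Type _) where
  act g m := (Diffeomorph.smul IG IM ∞ g).mfderivToContinuousLinearEquiv (by simp) m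
  act_one m v := by
    change tangentMap IM IM (fun x : M => (1 : G) • x) ⟨m, v⟩ = _
    have : (fun x : M => (1 : G) • x) = id := by
      funext x
      simp
    rw [this, tangentMap_id]
    rfl
  act_mul g g' m v := by
    change tangentMap IM IM (fun x : M => (g * g') • x) ⟨m, v⟩ =
      tangentMap IM IM (fun x : M => g • x) (tangentMap IM IM (fun x : M => g' • x) ⟨m, v⟩)
    have h1 : ∀ g : G, MDifferentiable IM IM (fun x : M => g • x) := fun g =>
      (ContMDiffSMul.contMDiff_const_smul (I := IG) (n := ∞) g).mdifferentiable (by simp)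
    have h2 : (fun x : M => (g * g') • x) = (fun x : M => g • x) ∘ fun x : M => g' • x := by
      funext x
      simp [mul_smul]
    rw [h2, tangentMap_comp (h1 g) (h1 g')]
    rfl
  contMDiff_act := by
    have h1 : ContMDiff (IG.prod IM).tangent IM.tangent ∞
        (tangentMap (IG.prod IM) IM (fun p : G × M => p.1 • p.2)) :=
      (contMDiff_smul (I := IG) (I' := IM) (n := ∞)).contMDiff_tangentMap (by simp)
    have h2 : ContMDiff (IG.prod IM.tangent) (IG.prod IM).tangent ∞
        (fun p : G × TangentBundle IM M => (equivTangentBundleProd IG G IM M).symm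
          ((⟨p.1, 0⟩ : TangentBundle IG G), p.2)) :=
      contMDiff_equivTangentBundleProd_symm.comp
        (((contMDiff_zeroSection ℝ (TangentSpace IG : G → Type _)).comp contMDiff_fst).prodMk
          contMDiff_snd)
    refine (h1.comp h2).congr fun p => ?_
    obtain ⟨g, m, v⟩ := p
    have hd : MDifferentiableAt (IG.prod IM) IM (fun p : G × M => p.1 • p.2) (g, m) :=
      (contMDiff_smul (I := IG) (I' := IM) (n := ∞)).mdifferentiable (by simp) _
    refine TotalSpace.ext rfl (heq_of_eq ?_)
    refine Eq.symm ((mfderiv_prod_eq_add_apply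
      (v := (((0 : TangentSpace IG g), v) : TangentSpace (IG.prod IM) (g, m))) hd).trans ?_)
    change mfderiv IG IM (fun z : G => z • m) g 0 + mfderiv IM IM (fun x : M => g • x) m v = _
    rw [map_zero, zero_add]
    rfl

/-- The group `G`, as a manifold on which `G` acts by conjugation. -/
def ConjSpace (G : Type*) : Type _ := G

instance : TopologicalSpace (ConjSpace G) := inferInstanceAs (TopologicalSpace G)

instance : ChartedSpace HG (ConjSpace G) := inferInstanceAs (ChartedSpace HG G)

instance [IsManifold IG ∞ G] : IsManifold IG ∞ (ConjSpace G) :=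
  inferInstanceAs (IsManifold IG ∞ G)

instance : MulAction G (ConjSpace G) where
  smul g w := (id (α := G → G) fun x => g * x * g⁻¹) w
  one_smul := by
    have h : ∀ w : G, 1 * w * 1⁻¹ = w := fun w => by simp
    exact h
  mul_smul g g' := by
    have h : ∀ w : G, g * g' * w * (g * g')⁻¹ = g * (g' * w * g'⁻¹) * g⁻¹ := fun w => by group
    exact h

instance [LieGroup IG ∞ G] : ContMDiffSMul IG IG ∞ G (ConjSpace G) where
  contMDiff_smul := by
    have h : ContMDiff (IG.prod IG) IG ∞ fun p : G × G => p.1 * p.2 * p.1⁻¹ :=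
      (contMDiff_fst.mul contMDiff_snd).mul contMDiff_fst.inv
    exact h

/-- The adjoint action `Ad_g : 𝔤 → 𝔤`, the derivative at the identity of `x ↦ g x g⁻¹`.
(`TangentSpace IG (g * 1 * g⁻¹)` and `TangentSpace IG 1` are both `EG`.) -/
def Ad {G} [TopologicalSpace G] [ChartedSpace HG G] [Group G] (g : G) :
    GroupLieAlgebra IG G →L[ℝ] GroupLieAlgebra IG G :=
  (mfderiv IG IG (fun x : G => g * x * g⁻¹) 1 : EG →L[ℝ] EG)

variable {G}

theorem mk_Ad (g : G) (ξ : GroupLieAlgebra IG G) :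
    (⟨1, Ad IG g ξ⟩ : TangentBundle IG G) = tangentMap IG IG (fun x : G => g * x * g⁻¹) ⟨1, ξ⟩ := by
  have h1 : g * 1 * g⁻¹ = 1 := by group
  exact TotalSpace.ext h1.symm HEq.rfl

theorem Ad_one (ξ : GroupLieAlgebra IG G) : Ad IG (1 : G) ξ = ξ := by
  refine TotalSpace.mk_injective (F := EG) (1 : G) ?_
  rw [mk_Ad]
  have : (fun x : G => 1 * x * 1⁻¹) = id := by
    funext x
    simp
  rw [this, tangentMap_id]
  rfl

theorem Ad_mul [LieGroup IG ∞ G] (g g' : G) (ξ : GroupLieAlgebra IG G) :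
    Ad IG (g * g') ξ = Ad IG g (Ad IG g' ξ) := by
  refine TotalSpace.mk_injective (F := EG) (1 : G) ?_
  rw [mk_Ad, mk_Ad, mk_Ad]
  have h1 : ∀ g : G, MDifferentiable IG IG (fun x : G => g * x * g⁻¹) := fun g =>
    ContMDiff.mdifferentiable (n := ∞)
      ((contMDiff_const.mul contMDiff_id).mul contMDiff_const) (by simp)
  have h2 : (fun x : G => g * g' * x * (g * g')⁻¹) =
      (fun x : G => g * x * g⁻¹) ∘ fun x : G => g' * x * g'⁻¹ := by
    funext x
    simp only [Function.comp]
    group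
  rw [h2, tangentMap_comp (h1 g) (h1 g')]
  rfl

/-- `Ad_g` as a linear isomorphism. -/
def AdEquiv [LieGroup IG ∞ G] (g : G) : GroupLieAlgebra IG G ≃L[ℝ] GroupLieAlgebra IG G :=
  ContinuousLinearEquiv.equivOfInverse (Ad IG g) (Ad IG g⁻¹)
    (fun ξ => by rw [← Ad_mul, inv_mul_cancel, Ad_one])
    (fun ξ => by rw [← Ad_mul, mul_inv_cancel, Ad_one])

theorem contMDiff_Ad [LieGroup IG ∞ G] :
    ContMDiff (IG.prod 𝓘(ℝ, EG)) 𝓘(ℝ, EG) ∞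
      (fun p : G × EG => (mfderiv IG IG (fun x : G => p.1 * x * p.1⁻¹) 1 : EG →L[ℝ] EG) p.2) := by
  rintro ⟨g₀, ξ₀⟩
  have h := ContMDiffAt.mfderiv_apply (I := IG) (I' := IG) (J' := IG.prod 𝓘(ℝ, EG)) (J := IG)
    (m := ∞) (n := ∞) (x₀ := (g₀, ξ₀))
    (fun g x : G => g * x * g⁻¹) (fun _ => 1) (fun p : G × EG => p.1) (fun p => p.2)
    (((contMDiff_fst.mul contMDiff_snd).mul contMDiff_fst.inv).contMDiffAt)
    contMDiffAt_const contMDiffAt_fst contMDiffAt_snd (by simp)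
  refine h.congr_of_eventuallyEq (Filter.Eventually.of_forall ?_)
  rintro ⟨g, ξ⟩
  have h1 : ∀ g : G, g * 1 * g⁻¹ = 1 := fun g => by group
  have hcs : ∀ v : EG, (tangentBundleCore IG G).coordChange (achart HG 1) (achart HG 1) 1 v = v :=
    fun v => (tangentBundleCore IG G).coordChange_self (achart HG 1) 1 (mem_chart_source HG 1) v
  have h2 := inTangentCoordinates_eq (I := IG) (I' := IG) (fun _ : G => (1 : G))
    (fun g : G => g * 1 * g⁻¹) (fun g : G => mfderiv IG IG (fun x : G => g * x * g⁻¹) 1)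
    (x₀ := g₀) (x := g) (mem_chart_source HG 1) (by simp only [h1]; exact mem_chart_source HG 1)
  have h3 := DFunLike.congr_fun h2 ξ
  have hcs' : ∀ x y : G, x = 1 → y = 1 → ∀ v : EG,
      (tangentBundleCore IG G).coordChange (achart HG x) (achart HG y) x v = v := by
    rintro _ _ rfl rfl v
    exact hcs v
  exact Eq.symm (h3.trans ((hcs' _ _ (h1 g) (h1 g₀) _).trans
    (congrArg (mfderiv IG IG (fun x : G => g * x * g⁻¹) 1 : EG →L[ℝ] EG) (hcs ξ))))

/-- The action `g • (m, ξ) = (g • m, Ad_g ξ)` on the trivial bundle `M × 𝔤 → M`. -/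
def adjointAction [LieGroup IG ∞ G] [IsManifold IM ∞ M] :
    EquivariantStructure IG IM G EG (Bundle.Trivial M EG) where
  act g _ := AdEquiv IG g
  act_one m v := TotalSpace.ext (one_smul G m) (heq_of_eq (Ad_one IG v))
  act_mul g g' m v := TotalSpace.ext (mul_smul g g' m) (heq_of_eq (Ad_mul IG g g' v))
  contMDiff_act := by
    have h1 : ContMDiff (IM.prod 𝓘(ℝ, EG)) 𝓘(ℝ, EG) ∞
        (fun e : TotalSpace EG (Bundle.Trivial M EG) => (e.2 : EG)) := fun e =>
      ((contMDiffAt_totalSpace (F := EG) (E := Bundle.Trivial M EG)).1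
        (contMDiffAt_id (x := e))).2
    intro p
    refine (contMDiffAt_totalSpace (F := EG) (E := Bundle.Trivial M EG)).2 ⟨?_, ?_⟩
    · exact (contMDiff_fst.smul (I := IG) ((contMDiff_proj _).comp contMDiff_snd)) p
    · exact ((contMDiff_Ad IG).comp (contMDiff_fst.prodMk (h1.comp contMDiff_snd))) p

variable {IG IM M}
variable {F : Type*} [NormedAddCommGroup F] [NormedSpace ℝ F] [FiniteDimensional ℝ F]
  {V : M → Type*} [∀ m, AddCommGroup (V m)] [∀ m, Module ℝ (V m)]
  [∀ m, TopologicalSpace (V m)] [TopologicalSpace (TotalSpace F V)] [FiberBundle F V]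
  [VectorBundle ℝ F V] [ContMDiffVectorBundle ∞ F V IM]

/-- The dual of a linear isomorphism `V m ≃ V m'`, as a map from `V m`-covectors to
`V m'`-covectors. -/
def dualEquiv {m m' : M} (e : V m ≃L[ℝ] V m') :
    (V m →L[ℝ] Bundle.Trivial M ℝ m) ≃L[ℝ] (V m' →L[ℝ] Bundle.Trivial M ℝ m') :=
  e.arrowCongr (ContinuousLinearEquiv.refl ℝ ℝ)

theorem dualEquiv_apply {m m' : M} (e : V m ≃L[ℝ] V m') (α : V m →L[ℝ] Bundle.Trivial M ℝ m)
    (w : V m') : dualEquiv e α w = α (e.symm w) := rfl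

theorem dualEquiv_congr {m m' m'' : M} (e : V m ≃L[ℝ] V m') (e' : V m ≃L[ℝ] V m'')
    (hm : m' = m'') (h : ∀ v, (⟨m', e v⟩ : TotalSpace F V) = ⟨m'', e' v⟩)
    (α : V m →L[ℝ] Bundle.Trivial M ℝ m) :
    (⟨m', dualEquiv e α⟩ : TotalSpace (F →L[ℝ] ℝ) fun m => V m →L[ℝ] Bundle.Trivial M ℝ m) =
      ⟨m'', dualEquiv e' α⟩ := by
  subst hm
  have : e = e' := by
    ext v
    exact TotalSpace.mk_injective (F := F) m' (h v)
  rw [this]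

/-- The contragredient action on the dual bundle, `(g • α)(w) = α (g⁻¹ • w)`. -/
def EquivariantStructure.dual [LieGroup IG ∞ G] [IsManifold IM ∞ M]
    (A : EquivariantStructure IG IM G F V) :
    EquivariantStructure IG IM G (F →L[ℝ] ℝ) (fun m => V m →L[ℝ] Bundle.Trivial M ℝ m) where
  act g m := dualEquiv (A.act g m)
  act_one m α :=
    dualEquiv_congr (F := F) (A.act 1 m) (ContinuousLinearEquiv.refl ℝ (V m)) (one_smul G m)
      (fun v => A.act_one m v) α
  act_mul g g' m α :=
    dualEquiv_congr (F := F) (A.act (g * g') m) ((A.act g' m).trans (A.act g (g' • m)))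
      (mul_smul g g' m) (fun v => A.act_mul g g' m v) α
  contMDiff_act := by
    intro p₀
    have hb : ContMDiff (IG.prod (IM.prod 𝓘(ℝ, F →L[ℝ] ℝ))) IM ∞
        (fun p : G × TotalSpace (F →L[ℝ] ℝ) (fun m => V m →L[ℝ] Bundle.Trivial M ℝ m) =>
          p.1 • p.2.1) :=
      contMDiff_fst.smul (I := IG) ((contMDiff_proj _).comp contMDiff_snd)
    refine (contMDiffAt_hom_bundle _).2 ⟨hb p₀, ?_⟩
    rw [← contMDiffWithinAt_univ]
    refine contMDiffWithinAt_clm_of_apply fun v => ?_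
    rw [contMDiffWithinAt_univ]
    set e := trivializationAt F V (p₀.1 • p₀.2.1) with he
    have hs : ContMDiffAt (IG.prod (IM.prod 𝓘(ℝ, F →L[ℝ] ℝ))) (IM.prod 𝓘(ℝ, F)) ∞
        (fun p : G × TotalSpace (F →L[ℝ] ℝ) (fun m => V m →L[ℝ] Bundle.Trivial M ℝ m) =>
          (⟨p.1 • p.2.1, e.symmL ℝ (p.1 • p.2.1) v⟩ : TotalSpace F V)) p₀ := by
      have hmem : p₀.1 • p₀.2.1 ∈ e.baseSet := mem_baseSet_trivializationAt F V _
      have h1 : ContMDiffAt (IM.prod 𝓘(ℝ, F)) (IM.prod 𝓘(ℝ, F)) ∞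
          e.toOpenPartialHomeomorph.symm (p₀.1 • p₀.2.1, v) :=
        (e.contMDiffOn_symm (n := ∞) (IB := IM)).contMDiffAt
          (e.open_target.mem_nhds (by rw [e.target_eq]; exact ⟨hmem, mem_univ _⟩))
      have h2 := h1.comp p₀ (f := fun p : G × TotalSpace (F →L[ℝ] ℝ)
        (fun m => V m →L[ℝ] Bundle.Trivial M ℝ m) => (p.1 • p.2.1, v))
        ((hb p₀).prodMk contMDiffAt_const)
      refine h2.congr_of_eventuallyEq ?_
      filter_upwards [(hb p₀).continuousAt.preimage_mem_nhds (e.open_baseSet.mem_nhds hmem)]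
        with p hp
      rw [Trivialization.symmL_apply _ hp]
      exact e.mk_symm hp v
    have hw : ContMDiffAt (IG.prod (IM.prod 𝓘(ℝ, F →L[ℝ] ℝ))) (IM.prod 𝓘(ℝ, F)) ∞
        (fun p : G × TotalSpace (F →L[ℝ] ℝ) (fun m => V m →L[ℝ] Bundle.Trivial M ℝ m) =>
          (⟨p.2.1, (A.act p.1 p.2.1).symm (e.symmL ℝ (p.1 • p.2.1) v)⟩ : TotalSpace F V)) p₀ := by
      have h1 := (A.contMDiff_act _).comp p₀ ((contMDiff_fst.inv p₀).prodMk hs)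
      refine h1.congr_of_eventuallyEq (Filter.Eventually.of_forall fun p => ?_)
      have h2 := A.act_inv_act p.1 p.2.1 ((A.act p.1 p.2.1).symm (e.symmL ℝ (p.1 • p.2.1) v))
      rw [ContinuousLinearEquiv.apply_symm_apply] at h2
      exact h2.symm
    have hα : ContMDiffAt (IG.prod (IM.prod 𝓘(ℝ, F →L[ℝ] ℝ))) (IM.prod 𝓘(ℝ, F →L[ℝ] ℝ)) ∞
        (fun p : G × TotalSpace (F →L[ℝ] ℝ) (fun m => V m →L[ℝ] Bundle.Trivial M ℝ m) =>
          TotalSpace.mk' (F →L[ℝ] ℝ) (E := fun m => V m →L[ℝ] Bundle.Trivial M ℝ m)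
            p.2.1 p.2.2) p₀ := contMDiff_snd p₀
    have h3 := hα.clm_bundle_apply hw
    have h4 := ((contMDiffAt_totalSpace (F := ℝ) (E := Bundle.Trivial M ℝ)).1 h3).2
    refine h4.congr_of_eventuallyEq (Filter.Eventually.of_forall fun p => ?_)
    have h5 : (trivializationAt ℝ (Bundle.Trivial M ℝ) (p₀.1 • p₀.2.1)).continuousLinearMapAt ℝ
        (p.1 • p.2.1) = ContinuousLinearMap.id ℝ ℝ :=
      Bundle.Trivial.continuousLinearMapAt_trivialization ℝ M ℝ (p.1 • p.2.1)
    simp only [ContinuousLinearMap.inCoordinates, h5]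
    rfl

end Actions

noncomputable section Connections

open Set Topology MulAction Bundle

/-- An isomorphism of smooth vector bundles over `B` (covering the identity). -/
structure SmoothVectorBundleEquiv {EB HB : Type*} [NormedAddCommGroup EB] [NormedSpace ℝ EB]
    [TopologicalSpace HB] (IB : ModelWithCorners ℝ EB HB)
    {B : Type*} [TopologicalSpace B] [ChartedSpace HB B]
    (F₁ : Type*) [NormedAddCommGroup F₁] [NormedSpace ℝ F₁]
    (E₁ : B → Type*) [∀ x, AddCommMonoid (E₁ x)] [∀ x, Module ℝ (E₁ x)]
    [∀ x, TopologicalSpace (E₁ x)] [TopologicalSpace (TotalSpace F₁ E₁)] [FiberBundle F₁ E₁]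
    (F₂ : Type*) [NormedAddCommGroup F₂] [NormedSpace ℝ F₂]
    (E₂ : B → Type*) [∀ x, AddCommMonoid (E₂ x)] [∀ x, Module ℝ (E₂ x)]
    [∀ x, TopologicalSpace (E₂ x)] [TopologicalSpace (TotalSpace F₂ E₂)] [FiberBundle F₂ E₂] where
  equiv : ∀ x : B, E₁ x ≃L[ℝ] E₂ x
  contMDiff_equiv : ContMDiff (IB.prod 𝓘(ℝ, F₁)) (IB.prod 𝓘(ℝ, F₂)) ∞
    fun e : TotalSpace F₁ E₁ => (⟨e.1, equiv e.1 e.2⟩ : TotalSpace F₂ E₂)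
  contMDiff_symm : ContMDiff (IB.prod 𝓘(ℝ, F₂)) (IB.prod 𝓘(ℝ, F₁)) ∞
    fun e : TotalSpace F₂ E₂ => (⟨e.1, (equiv e.1).symm e.2⟩ : TotalSpace F₁ E₁)

section Principal

variable {EG HG EM HM EB HB : Type*}
  [NormedAddCommGroup EG] [NormedSpace ℝ EG] [TopologicalSpace HG]
  [NormedAddCommGroup EM] [NormedSpace ℝ EM] [TopologicalSpace HM]
  [NormedAddCommGroup EB] [NormedSpace ℝ EB] [TopologicalSpace HB]
  {IG : ModelWithCorners ℝ EG HG} {IM : ModelWithCorners ℝ EM HM}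
  {IB : ModelWithCorners ℝ EB HB}
  {G : Type*} [TopologicalSpace G] [ChartedSpace HG G] [Group G]
  {M : Type*} [TopologicalSpace M] [ChartedSpace HM M] [MulAction G M]
  [ContMDiffSMul IG IM ∞ G M]
  {B : Type*} [TopologicalSpace B] [ChartedSpace HB B] {pr : M → B}

namespace IsPrincipalBundle

section Pullback

variable {EB' HB' B' F : Type*} [NormedAddCommGroup EB'] [NormedSpace ℝ EB'] [TopologicalSpace HB']
  {IB' : ModelWithCorners ℝ EB' HB'} [TopologicalSpace B'] [ChartedSpace HB' B']
  [NormedAddCommGroup F] [NormedSpace ℝ F] [FiniteDimensional ℝ F]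
  {V : M → Type*} [∀ m, AddCommGroup (V m)] [∀ m, Module ℝ (V m)]
  [∀ m, TopologicalSpace (V m)] [TopologicalSpace (TotalSpace F V)] [FiberBundle F V]
  [VectorBundle ℝ F V] [ContMDiffVectorBundle ∞ F V IM] [LieGroup IG ∞ G] [IsManifold IM ∞ M]
  [IsManifold IB ∞ B]

/-- The pullback `f*(V / G)` of a quotient bundle along a smooth map `f`; its fibre over `y` is the
fibre of `V / G` over `f y`. -/
def PullbackQuot (h : IsPrincipalBundle IG IM IB G pr) (A : EquivariantStructure IG IM G F V)
    (f : C^∞⟮IB', B'; IB, B⟯) : B' → Type _ := f *ᵖ (h.QuotBundle A)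

instance (h : IsPrincipalBundle IG IM IB G pr) (A : EquivariantStructure IG IM G F V)
    (f : C^∞⟮IB', B'; IB, B⟯) (y : B') : AddCommGroup (h.PullbackQuot A f y) :=
  inferInstanceAs (AddCommGroup (h.QuotBundle A (f y)))

instance (h : IsPrincipalBundle IG IM IB G pr) (A : EquivariantStructure IG IM G F V)
    (f : C^∞⟮IB', B'; IB, B⟯) (y : B') : Module ℝ (h.PullbackQuot A f y) :=
  inferInstanceAs (Module ℝ (h.QuotBundle A (f y)))

instance (h : IsPrincipalBundle IG IM IB G pr) (A : EquivariantStructure IG IM G F V)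
    (f : C^∞⟮IB', B'; IB, B⟯) (y : B') : TopologicalSpace (h.PullbackQuot A f y) :=
  instTopologicalSpacePullback (h.QuotBundle A) f y

instance (h : IsPrincipalBundle IG IM IB G pr) (A : EquivariantStructure IG IM G F V)
    (f : C^∞⟮IB', B'; IB, B⟯) : TopologicalSpace (TotalSpace F (h.PullbackQuot A f)) :=
  Pullback.TotalSpace.topologicalSpace F (h.QuotBundle A) f

instance (h : IsPrincipalBundle IG IM IB G pr) (A : EquivariantStructure IG IM G F V)
    (f : C^∞⟮IB', B'; IB, B⟯) : FiberBundle F (h.PullbackQuot A f) :=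
  FiberBundle.pullback (F := F) (E := h.QuotBundle A) f

instance (h : IsPrincipalBundle IG IM IB G pr) (A : EquivariantStructure IG IM G F V)
    (f : C^∞⟮IB', B'; IB, B⟯) : VectorBundle ℝ F (h.PullbackQuot A f) :=
  VectorBundle.pullback ℝ (F := F) (E := h.QuotBundle A) f

instance (h : IsPrincipalBundle IG IM IB G pr) (A : EquivariantStructure IG IM G F V)
    (f : C^∞⟮IB', B'; IB, B⟯) : ContMDiffVectorBundle ∞ F (h.PullbackQuot A f) IB' :=
  ContMDiffVectorBundle.pullback F (h.QuotBundle A) IB' f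

/-- The vector bundle isomorphisms `f*(TM / G) ≃ TB' ⊕ f*𝔤̃` over `B'`, for a smooth map
`f : B' → B` and the adjoint bundle `𝔤̃ = (M × 𝔤) / G`. -/
abbrev TangentIso [FiniteDimensional ℝ EG] [FiniteDimensional ℝ EM] [IsManifold IB' ∞ B']
    (h : IsPrincipalBundle IG IM IB G pr) (f : C^∞⟮IB', B'; IB, B⟯) : Type _ :=
  SmoothVectorBundleEquiv IB'
    EM (h.PullbackQuot (tangentAction IG IM G M) f)
    (EB' × EG) ((TangentSpace IB' : B' → Type _) ×ᵇ h.PullbackQuot (adjointAction IG IM M) f)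

/-- The vector bundle isomorphisms `f*(T*M / G) ≃ T*B' ⊕ (f*𝔤̃)*` over `B'`, where `G` acts on
`T*M` by the cotangent lift. -/
abbrev CotangentIso [FiniteDimensional ℝ EG] [FiniteDimensional ℝ EM] [IsManifold IB' ∞ B']
    (h : IsPrincipalBundle IG IM IB G pr) (f : C^∞⟮IB', B'; IB, B⟯) : Type _ :=
  SmoothVectorBundleEquiv IB'
    (EM →L[ℝ] ℝ) (h.PullbackQuot (tangentAction IG IM G M).dual f)
    ((EB' →L[ℝ] ℝ) × (EG →L[ℝ] ℝ))
    ((fun y : B' => TangentSpace IB' y →L[ℝ] Bundle.Trivial B' ℝ y) ×ᵇ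
      fun y => h.PullbackQuot (adjointAction IG IM M) f y →L[ℝ] Bundle.Trivial B' ℝ y)

variable [FiniteDimensional ℝ EG] [FiniteDimensional ℝ EM]

/-- The class `[v]`, in the fibre of `f*(TM / G)` over `y`, of a tangent vector `v` at a point `m`
over `f y`. -/
def tangentCls (h : IsPrincipalBundle IG IM IB G pr) (f : C^∞⟮IB', B'; IB, B⟯) (y : B') (m : M)
    (hm : pr m = f y) (v : TangentSpace IM m) : h.PullbackQuot (tangentAction IG IM G M) f y :=
  h.cls (tangentAction IG IM G M) m hm v

/-- The class `[α]`, in the fibre of `f*(T*M / G)` over `y`, of a covector `α` at a point `m` over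
`f y`. -/
def cotangentCls (h : IsPrincipalBundle IG IM IB G pr) (f : C^∞⟮IB', B'; IB, B⟯) (y : B') (m : M)
    (hm : pr m = f y) (α : TangentSpace IM m →L[ℝ] ℝ) :
    h.PullbackQuot (tangentAction IG IM G M).dual f y :=
  h.cls (tangentAction IG IM G M).dual m hm α

/-- The class `[m, ξ]` in the fibre of `f*𝔤̃` over `y`, for a point `m` over `f y`. -/
def adjointCls (h : IsPrincipalBundle IG IM IB G pr) (f : C^∞⟮IB', B'; IB, B⟯) (y : B') (m : M)
    (hm : pr m = f y) (ξ : GroupLieAlgebra IG G) : h.PullbackQuot (adjointAction IG IM M) f y :=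
  h.cls (adjointAction IG IM M) m hm ξ

end Pullback

end IsPrincipalBundle

/-- A principal connection on the principal bundle `pr : M → B`, given by its connection form: a
smooth `𝔤`-valued `1`-form on `M` that reproduces the infinitesimal generators and is
`G`-equivariant. -/
structure PrincipalConnection [IsManifold IM ∞ M] (h : IsPrincipalBundle IG IM IB G pr) where
  form : ∀ m : M, TangentSpace IM m →L[ℝ] GroupLieAlgebra IG G
  contMDiff_form : ContMDiff (M' := EG) IM.tangent 𝓘(ℝ, EG) ∞
    fun e : TangentBundle IM M => form e.1 e.2
  form_infGen : ∀ (m : M) (ξ : GroupLieAlgebra IG G), form m (infGen IG IM ξ m) = ξ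
  form_smul : ∀ (g : G) (m : M) (v : TangentSpace IM m),
    form (g • m) (mfderiv IM IM (fun x : M => g • x) m v) = Ad IG g (form m v)

/-- `v`, a tangent vector at `m`, is horizontal and projects to `u`. -/
def PrincipalConnection.IsHorizontalLift [IsManifold IM ∞ M]
    {h : IsPrincipalBundle IG IM IB G pr}
    (𝔄 : PrincipalConnection h) (m : M) (u : TangentBundle IB B) (v : TangentSpace IM m) : Prop :=
  tangentMap IM IB pr ⟨m, v⟩ = u ∧ 𝔄.form m v = 0

/-- The horizontal lift `h^m(u)` at `m` of a tangent vector `u` at `pr m`. -/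
def PrincipalConnection.horizontalLift [IsManifold IM ∞ M]
    {h : IsPrincipalBundle IG IM IB G pr}
    (𝔄 : PrincipalConnection h) (m : M) (u : TangentBundle IB B) : TangentSpace IM m :=
  Classical.epsilon (𝔄.IsHorizontalLift m u)

end Principal

section Discrete

variable {EG HG EQ HQ EB HB : Type*}
  [NormedAddCommGroup EG] [NormedSpace ℝ EG] [TopologicalSpace HG]
  [NormedAddCommGroup EQ] [NormedSpace ℝ EQ] [TopologicalSpace HQ]
  [NormedAddCommGroup EB] [NormedSpace ℝ EB] [TopologicalSpace HB]

/-- An affine discrete connection on `Q → Q/G` (with domain all of `Q × Q`), with its level `γ`. -/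
structure AffineDiscreteConnection (IG : ModelWithCorners ℝ EG HG) (IQ : ModelWithCorners ℝ EQ HQ)
    (G : Type*) [TopologicalSpace G] [ChartedSpace HG G] [Group G]
    (Q : Type*) [TopologicalSpace Q] [ChartedSpace HQ Q] [MulAction G Q] where
  level : Q → G
  contMDiff_level : ContMDiff IQ IG ∞ level
  level_smul : ∀ (g : G) (q : Q), level (g • q) = g * level q * g⁻¹
  toFun : Q → Q → G
  contMDiff_toFun : ContMDiff (IQ.prod IQ) IG ∞ fun p : Q × Q => toFun p.1 p.2
  toFun_smul : ∀ (g₀ g₁ : G) (q₀ q₁ : Q),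
    toFun (g₀ • q₀) (g₁ • q₁) = g₁ * toFun q₀ q₁ * g₀⁻¹
  toFun_level : ∀ q : Q, toFun q (level q • q) = 1

variable {IG : ModelWithCorners ℝ EG HG} {IQ : ModelWithCorners ℝ EQ HQ}
  {IB : ModelWithCorners ℝ EB HB}
  {G : Type*} [TopologicalSpace G] [ChartedSpace HG G] [Group G]
  {Q : Type*} [TopologicalSpace Q] [ChartedSpace HQ Q] [MulAction G Q]
  [ContMDiffSMul IG IQ ∞ G Q] [ChartedSpace HB (orbitRel.Quotient G Q)]

namespace IsPrincipalBundle

/-- `(Q × Q) / G`, for the diagonal action. -/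
abbrev PairQuot
    (hQ : IsPrincipalBundle IG IQ IB G (Quotient.mk _ : Q → orbitRel.Quotient G Q)) : Type _ :=
  hQ.Assoc IQ Q

/-- The conjugate bundle `G̃ = (Q × G) / G`, where `G` acts on itself by conjugation. -/
abbrev ConjBundle
    (hQ : IsPrincipalBundle IG IQ IB G (Quotient.mk _ : Q → orbitRel.Quotient G Q)) : Type _ :=
  hQ.Assoc IG (ConjSpace G)

/-- `G̃ × Q/G`. -/
abbrev ReducedSpace
    (hQ : IsPrincipalBundle IG IQ IB G (Quotient.mk _ : Q → orbitRel.Quotient G Q)) : Type _ :=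
  hQ.ConjBundle × orbitRel.Quotient G Q

/-- The quotient map `Q × Q → (Q × Q) / G`. -/
abbrev pairMk (hQ : IsPrincipalBundle IG IQ IB G (Quotient.mk _ : Q → orbitRel.Quotient G Q)) :
    Q × Q → hQ.PairQuot :=
  hQ.assocMk IQ

/-- The quotient map `ρ : Q × G → G̃`. -/
def conjMk (hQ : IsPrincipalBundle IG IQ IB G (Quotient.mk _ : Q → orbitRel.Quotient G Q))
    (p : Q × G) : hQ.ConjBundle :=
  hQ.assocMk IG (N := ConjSpace G) p

end IsPrincipalBundle

namespace AffineDiscreteConnection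

/-- The map `Φ : (Q × Q) / G → G̃ × Q/G` induced by `(q₀, q₁) ↦ (q₀, 𝒜(q₀, q₁), π(q₁))`. -/
def Phi (𝒜 : AffineDiscreteConnection IG IQ G Q)
    (hQ : IsPrincipalBundle IG IQ IB G (Quotient.mk _ : Q → orbitRel.Quotient G Q)) :
    hQ.PairQuot → hQ.ReducedSpace :=
  Quotient.lift (s := orbitRel G (Q × Q))
    (fun p => (hQ.conjMk (p.1, 𝒜.toFun p.1 p.2), Quotient.mk _ p.2)) (by
      rintro _ p ⟨g, rfl⟩
      refine Prod.ext ?_ (hQ.proj_smul g p.2)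
      change hQ.conjMk (g • p.1, 𝒜.toFun (g • p.1) (g • p.2)) = hQ.conjMk (p.1, 𝒜.toFun p.1 p.2)
      rw [𝒜.toFun_smul]
      exact hQ.assocMk_smul (N := ConjSpace G) g (p.1, 𝒜.toFun p.1 p.2))

/-- `Υ : Q × Q → G̃ × Q/G`, the composition of `Q × Q → (Q × Q) / G` with `Φ`. -/
def Upsilon (𝒜 : AffineDiscreteConnection IG IQ G Q)
    (hQ : IsPrincipalBundle IG IQ IB G (Quotient.mk _ : Q → orbitRel.Quotient G Q)) (p : Q × Q) :
    hQ.ReducedSpace :=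
  𝒜.Phi hQ (hQ.pairMk p)

theorem Upsilon_apply (𝒜 : AffineDiscreteConnection IG IQ G Q)
    (hQ : IsPrincipalBundle IG IQ IB G (Quotient.mk _ : Q → orbitRel.Quotient G Q)) (q₀ q₁ : Q) :
    𝒜.Upsilon hQ (q₀, q₁) = (hQ.conjMk (q₀, 𝒜.toFun q₀ q₁), Quotient.mk _ q₁) := rfl

end AffineDiscreteConnection

end Discrete

end Connections

/-!
The map `Φ([q₀, q₁]) = ([q₀, 𝒜(q₀, q₁)], [q₁])` has the explicit inverse
`([q₀, w], [q₁]) ↦ [q₀, (w 𝒜(q₀, q₁)⁻¹) • q₁]`, because `𝒜(q₀, g • q₁) = g 𝒜(q₀, q₁)`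
(`AffineDiscreteConnection.Psi`). Both maps are induced by smooth equivariant maps upstairs, and
smoothness descends along principal bundles, which have smooth local sections.

The rest holds for every principal bundle `pr : M → B` with a principal connection `𝔄` and every
diffeomorphism `Φ : B ≃ B'` with inverse `Ψ`; the theorem is the case `M = Q × Q`. Vertical
vectors are exactly the values of infinitesimal generators
(`IsPrincipalBundle.mfderiv_proj_infGen`, `IsPrincipalBundle.exists_infGen_eq`), and `𝔄`
reproduces the generator. Hence horizontal lifts exist uniquely, and at each point `m` the map
`v ↦ (T(Φ ∘ pr) v, 𝔄(v))` is a linear isomorphism onto `T_y B' × 𝔤`, inverted by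
`(u, ξ) ↦ h(TΨ(u)) + ξ_M(m)` (`PrincipalConnection.splitMap_bijective`,
`PrincipalConnection.splitMap_horizontalLift_add`). It is compatible with the action of `G`, by
invariance of `Φ ∘ pr` and equivariance of `𝔄`, so that it induces isomorphisms
`𝒳` on the fibres of `Ψ*(TM / G)` (`PrincipalConnection.tangentIso`).

Smoothness of such fibrewise maps is checked on representatives: a map into `Ψ*(V / G)` is smooth
as soon as it is locally the class of a smooth map into `V`
(`IsPrincipalBundle.contMDiffAt_pullbackQuot_of_rep`), and conversely the representative over a
local section depends smoothly on the class (`IsPrincipalBundle.contMDiffAt_pullbackRep`).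

Finally `V* / G` is fibrewise dual to `V / G` (`IsPrincipalBundle.quotDualL`), and `𝒳'` is the
inverse transpose of `𝒳` under this duality (`IsPrincipalBundle.dualIso`); it is smooth because
families of covectors can be tested on smooth families of vectors.
-/

/-! ### Smooth maps into bundles -/

noncomputable section SmoothMapsIntoBundles

set_option linter.unusedSectionVars false

open Set Topology Bundle

section General

variable {EB HB EN HN : Type*}
  [NormedAddCommGroup EB] [NormedSpace ℝ EB] [TopologicalSpace HB]
  [NormedAddCommGroup EN] [NormedSpace ℝ EN] [TopologicalSpace HN]
  {IB : ModelWithCorners ℝ EB HB} {IN : ModelWithCorners ℝ EN HN}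
  {B : Type*} [TopologicalSpace B] [ChartedSpace HB B]
  {N : Type*} [TopologicalSpace N] [ChartedSpace HN N]
  {F₁ : Type*} [NormedAddCommGroup F₁] [NormedSpace ℝ F₁]
  {E₁ : B → Type*} [∀ x, AddCommGroup (E₁ x)] [∀ x, Module ℝ (E₁ x)]
  [∀ x, TopologicalSpace (E₁ x)] [TopologicalSpace (TotalSpace F₁ E₁)] [FiberBundle F₁ E₁]
  {F₂ : Type*} [NormedAddCommGroup F₂] [NormedSpace ℝ F₂]
  {E₂ : B → Type*} [∀ x, AddCommGroup (E₂ x)] [∀ x, Module ℝ (E₂ x)]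
  [∀ x, TopologicalSpace (E₂ x)] [TopologicalSpace (TotalSpace F₂ E₂)] [FiberBundle F₂ E₂]

/-- A map into a direct sum of bundles is smooth if and only if its two components are. -/
theorem contMDiffAt_prodBundle {f : N → TotalSpace (F₁ × F₂) (E₁ ×ᵇ E₂)} {x : N} :
    ContMDiffAt IN (IB.prod 𝓘(ℝ, F₁ × F₂)) ∞ f x ↔
      ContMDiffAt IN (IB.prod 𝓘(ℝ, F₁)) ∞ (fun y => (⟨(f y).1, (f y).2.1⟩ : TotalSpace F₁ E₁)) x ∧
      ContMDiffAt IN (IB.prod 𝓘(ℝ, F₂)) ∞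
        (fun y => (⟨(f y).1, (f y).2.2⟩ : TotalSpace F₂ E₂)) x := by
  rw [contMDiffAt_totalSpace, contMDiffAt_totalSpace, contMDiffAt_totalSpace]
  have key : (fun y => (trivializationAt (F₁ × F₂) (E₁ ×ᵇ E₂) (f x).proj (f y)).2) =
      fun y => ((trivializationAt F₁ E₁ (f x).proj ⟨(f y).1, (f y).2.1⟩).2,
        (trivializationAt F₂ E₂ (f x).proj ⟨(f y).1, (f y).2.2⟩).2) := rfl
  rw [key, contMDiffAt_prod_module_iff]
  tauto

variable [VectorBundle ℝ F₁ E₁] [ContMDiffVectorBundle ∞ F₁ E₁ IB] [FiniteDimensional ℝ F₁]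

/-- A family of covectors along a smooth map is smooth as soon as its values on the local frames
of the bundle are smooth. -/
theorem contMDiffAt_dualBundle {b : N → B} {α : ∀ y, E₁ (b y) →L[ℝ] Bundle.Trivial B ℝ (b y)}
    {x : N} (hb : ContMDiffAt IN IB ∞ b x)
    (hα : ∀ v : F₁, ContMDiffAt IN 𝓘(ℝ, ℝ) ∞
      (fun y => (α y ((trivializationAt F₁ E₁ (b x)).symmL ℝ (b y) v) : ℝ)) x) :
    ContMDiffAt IN (IB.prod 𝓘(ℝ, F₁ →L[ℝ] ℝ)) ∞
      (fun y => (⟨b y, α y⟩ :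
        TotalSpace (F₁ →L[ℝ] ℝ) fun x => E₁ x →L[ℝ] Bundle.Trivial B ℝ x)) x := by
  refine (contMDiffAt_hom_bundle _).2 ⟨hb, ?_⟩
  rw [← contMDiffWithinAt_univ]
  refine contMDiffWithinAt_clm_of_apply fun v => ?_
  rw [contMDiffWithinAt_univ]
  refine (hα v).congr_of_eventuallyEq (Filter.Eventually.of_forall fun y => ?_)
  have h5 : (trivializationAt ℝ (Bundle.Trivial B ℝ) (b x)).continuousLinearMapAt ℝ (b y) =
      ContinuousLinearMap.id ℝ ℝ :=
    Bundle.Trivial.continuousLinearMapAt_trivialization ℝ B ℝ (b y)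
  simp only [ContinuousLinearMap.inCoordinates, h5]
  rfl

/-- The local frame vectors `e⁻¹(b y, v)` depend smoothly on `y`. -/
theorem contMDiffAt_symmL {b : N → B} {x : N} (hb : ContMDiffAt IN IB ∞ b x)
    (e : Trivialization F₁ (TotalSpace.proj : TotalSpace F₁ E₁ → B)) [MemTrivializationAtlas e]
    (hx : b x ∈ e.baseSet) (v : F₁) :
    ContMDiffAt IN (IB.prod 𝓘(ℝ, F₁)) ∞
      (fun y => (⟨b y, e.symmL ℝ (b y) v⟩ : TotalSpace F₁ E₁)) x := by
  have h1 : ContMDiffAt (IB.prod 𝓘(ℝ, F₁)) (IB.prod 𝓘(ℝ, F₁)) ∞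
      e.toOpenPartialHomeomorph.symm (b x, v) :=
    (e.contMDiffOn_symm (n := ∞) (IB := IB)).contMDiffAt
      (e.open_target.mem_nhds (by rw [e.target_eq]; exact ⟨hx, mem_univ _⟩))
  have h2 := h1.comp x (f := fun y => (b y, v)) (hb.prodMk contMDiffAt_const)
  refine h2.congr_of_eventuallyEq ?_
  filter_upwards [hb.continuousAt.preimage_mem_nhds (e.open_baseSet.mem_nhds hx)] with y hy
  rw [Trivialization.symmL_apply _ hy]
  exact e.mk_symm hy v

/-- The pairing of a smooth family of covectors with a smooth family of vectors is smooth. -/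
theorem contMDiffAt_pairing {b : N → B} {α : ∀ y, E₁ (b y) →L[ℝ] Bundle.Trivial B ℝ (b y)}
    {v : ∀ y, E₁ (b y)} {x : N}
    (hα : ContMDiffAt IN (IB.prod 𝓘(ℝ, F₁ →L[ℝ] ℝ)) ∞
      (fun y => (⟨b y, α y⟩ :
        TotalSpace (F₁ →L[ℝ] ℝ) fun x => E₁ x →L[ℝ] Bundle.Trivial B ℝ x)) x)
    (hv : ContMDiffAt IN (IB.prod 𝓘(ℝ, F₁)) ∞ (fun y => (⟨b y, v y⟩ : TotalSpace F₁ E₁)) x) :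
    ContMDiffAt IN 𝓘(ℝ, ℝ) ∞ (fun y => (α y (v y) : ℝ)) x :=
  ((contMDiffAt_totalSpace (F := ℝ) (E := Bundle.Trivial B ℝ)).1 (hα.clm_bundle_apply hv)).2

end General

end SmoothMapsIntoBundles

/-! ### Smooth maps into quotient bundles and their pullbacks -/

noncomputable section QuotientBundles

set_option linter.unusedSectionVars false

open Set Topology MulAction Bundle

variable {EG HG EM HM EB HB EN HN : Type*}
  [NormedAddCommGroup EG] [NormedSpace ℝ EG] [TopologicalSpace HG]
  [NormedAddCommGroup EM] [NormedSpace ℝ EM] [TopologicalSpace HM]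
  [NormedAddCommGroup EB] [NormedSpace ℝ EB] [TopologicalSpace HB]
  [NormedAddCommGroup EN] [NormedSpace ℝ EN] [TopologicalSpace HN]
  {IG : ModelWithCorners ℝ EG HG} {IM : ModelWithCorners ℝ EM HM}
  {IB : ModelWithCorners ℝ EB HB} {IN : ModelWithCorners ℝ EN HN}
  {G : Type*} [TopologicalSpace G] [ChartedSpace HG G] [Group G]
  {M : Type*} [TopologicalSpace M] [ChartedSpace HM M] [MulAction G M]
  [ContMDiffSMul IG IM ∞ G M]
  {B : Type*} [TopologicalSpace B] [ChartedSpace HB B] {pr : M → B}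
  {N : Type*} [TopologicalSpace N] [ChartedSpace HN N]
  {F : Type*} [NormedAddCommGroup F] [NormedSpace ℝ F] [FiniteDimensional ℝ F]
  {V : M → Type*} [∀ m, AddCommGroup (V m)] [∀ m, Module ℝ (V m)]
  [∀ m, TopologicalSpace (V m)] [TopologicalSpace (TotalSpace F V)] [FiberBundle F V]
  [VectorBundle ℝ F V] [ContMDiffVectorBundle ∞ F V IM]

namespace IsPrincipalBundle

theorem contMDiffAt_sec (h : IsPrincipalBundle IG IM IB G pr) (b : B) :
    ContMDiffAt IB IM ∞ (h.sec b) b :=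
  (h.contMDiffOn_sec b).contMDiffAt ((h.triv b).open_baseSet.mem_nhds (h.mem_base b))

theorem eventually_proj_sec (h : IsPrincipalBundle IG IM IB G pr) (b : B) :
    ∀ᶠ x in 𝓝 b, pr (h.sec b x) = x := by
  filter_upwards [(h.triv b).open_baseSet.mem_nhds (h.mem_base b)] with x hx
  exact h.proj_sec hx

variable [LieGroup IG ∞ G] [IsManifold IM ∞ M] [IsManifold IB ∞ B]

/-- The projection from the total space of `V` to that of `V / G` is smooth: near a point it is
translation by the inverse of the group coordinate, which moves a vector to a point of the chosen
local section, followed by a trivialization of `V`. -/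
theorem contMDiff_quotMap (h : IsPrincipalBundle IG IM IB G pr)
    (A : EquivariantStructure IG IM G F V) :
    ContMDiff (IM.prod 𝓘(ℝ, F)) (IB.prod 𝓘(ℝ, F)) ∞ (h.quotMap A) := by
  intro e₀
  have hpr := h.contMDiff_proj.comp (Bundle.contMDiff_proj V (n := ∞) (IB := IM) (F := F))
  refine contMDiffAt_totalSpace.2 ⟨hpr e₀, ?_⟩
  set b := pr e₀.1
  have ho : ∀ᶠ e in 𝓝 e₀, pr e.1 ∈ h.quotBase A b := by
    refine hpr.continuous.continuousAt.preimage_mem_nhds ((IsOpen.mem_nhds ?_) ?_)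
    · exact (h.quotPretriv A b).open_baseSet
    · exact ⟨h.mem_base b, mem_baseSet_trivializationAt F V (h.sec b b)⟩
  have hg : ContMDiffAt (IM.prod 𝓘(ℝ, F)) IG ∞
      (fun e : TotalSpace F V => (h.coord b e.1)⁻¹) e₀ := by
    have h1 := (h.contMDiffOn_coord b).contMDiffAt (x := e₀.1)
      (((h.triv b).open_baseSet.preimage h.contMDiff_proj.continuous).mem_nhds (h.mem_base b))
    exact (h1.comp e₀ (Bundle.contMDiff_proj V (n := ∞) (IB := IM) (F := F)).contMDiffAt).inv
  have h2 := A.contMDiff_act.contMDiffAt.comp e₀ (hg.prodMk contMDiffAt_id)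
  have hs : ∀ e : TotalSpace F V, pr e.1 ∈ h.quotBase A b →
      (h.coord b e.1)⁻¹ • e.1 = h.sec b (pr e.1) := fun e he => by
    rw [inv_smul_eq_iff, h.coord_smul_sec he.1]
  have h3 := ((trivializationAt F V (h.sec b b)).contMDiffOn (n := ∞) (IB := IM)).contMDiffAt
    (x := ⟨(h.coord b e₀.1)⁻¹ • e₀.1, A.act (h.coord b e₀.1)⁻¹ e₀.1 e₀.2⟩) (by
      refine (trivializationAt F V (h.sec b b)).open_source.mem_nhds ?_
      rw [Trivialization.mem_source]
      change (h.coord b e₀.1)⁻¹ • e₀.1 ∈ _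
      rw [hs e₀ ho.self_of_nhds]
      exact ho.self_of_nhds.2)
  refine (contMDiffAt_snd.comp e₀ (h3.comp e₀ h2)).congr_of_eventuallyEq ?_
  filter_upwards [ho] with e he
  change (h.quotPretriv A b (h.quotMap A ⟨e.1, e.2⟩)).2 = _
  rw [← h.quotMap_act A (h.coord b e.1)⁻¹, h.quotPretriv_quotMap]
  · rfl
  · rw [hs e he]
    exact he.2
  · rw [h.proj_smul, hs e he]

/-- The local section `z ↦ (s(x), the representative of z over s(x))` of the quotient map, where
`x` is the base point of `z` and `s` the chosen local section near `b`. -/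
def liftSec (h : IsPrincipalBundle IG IM IB G pr) (A : EquivariantStructure IG IM G F V) (b : B)
    (z : TotalSpace F (h.QuotBundle A)) : TotalSpace F V :=
  ⟨h.sec b z.1, h.lift A (h.sec b z.1) z⟩

/-- In the trivialization of `V / G` built from a local section `s`, the coordinate of a class is by
construction that of its representative over `s`, so that taking this representative is smooth. -/
theorem contMDiffAt_liftSec (h : IsPrincipalBundle IG IM IB G pr)
    (A : EquivariantStructure IG IM G F V) (z₀ : TotalSpace F (h.QuotBundle A)) :
    ContMDiffAt (IB.prod 𝓘(ℝ, F)) (IM.prod 𝓘(ℝ, F)) ∞ (h.liftSec A z₀.1) z₀ := by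
  have hm : h.sec z₀.1 z₀.1 ∈ (trivializationAt F V (h.sec z₀.1 z₀.1)).baseSet :=
    mem_baseSet_trivializationAt F V _
  have hs : ContMDiffAt (IB.prod 𝓘(ℝ, F)) IM ∞
      (fun z : TotalSpace F (h.QuotBundle A) => h.sec z₀.1 z.1) z₀ :=
    (h.contMDiffAt_sec z₀.1).comp z₀
      (Bundle.contMDiff_proj (h.QuotBundle A)).contMDiffAt
  refine ((trivializationAt F V (h.sec z₀.1 z₀.1)).contMDiffAt_iff
    ((Trivialization.mem_source _).2 hm)).2 ⟨hs, ?_⟩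
  have h1 := (contMDiffAt_totalSpace.1 (contMDiffAt_id (I := IB.prod 𝓘(ℝ, F)) (n := ∞)
    (x := z₀))).2
  refine h1.congr_of_eventuallyEq ?_
  filter_upwards [hs.continuousAt.preimage_mem_nhds
    ((trivializationAt F V (h.sec z₀.1 z₀.1)).open_baseSet.mem_nhds hm)] with z hz
  change _ = (trivializationAt F V (h.sec z₀.1 z₀.1)).continuousLinearMapAt ℝ (h.sec z₀.1 z.1)
    (h.lift A (h.sec z₀.1 z.1) z)
  rw [Trivialization.continuousLinearMapAt_apply, Trivialization.linearMapAt_apply,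
    if_pos (mem_preimage.1 hz)]
  rfl

section Pullback

variable {EB' HB' B' : Type*} [NormedAddCommGroup EB'] [NormedSpace ℝ EB'] [TopologicalSpace HB']
  {IB' : ModelWithCorners ℝ EB' HB'} [TopologicalSpace B'] [ChartedSpace HB' B']

/-- The canonical map from the total space of `f*(V / G)` to that of `V / G`. -/
def pullbackLift (h : IsPrincipalBundle IG IM IB G pr) (A : EquivariantStructure IG IM G F V)
    (f : C^∞⟮IB', B'; IB, B⟯) (z : TotalSpace F (h.PullbackQuot A f)) :
    TotalSpace F (h.QuotBundle A) := ⟨f z.1, z.2⟩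

/-- `f*(V / G)` carries the smooth structure of the fibre product of `B'` and `V / G`. -/
theorem contMDiffAt_pullbackQuot (h : IsPrincipalBundle IG IM IB G pr)
    (A : EquivariantStructure IG IM G F V) (f : C^∞⟮IB', B'; IB, B⟯)
    {k : N → TotalSpace F (h.PullbackQuot A f)} {x : N} :
    ContMDiffAt IN (IB'.prod 𝓘(ℝ, F)) ∞ k x ↔
      ContMDiffAt IN IB' ∞ (fun y => (k y).1) x ∧
      ContMDiffAt IN (IB.prod 𝓘(ℝ, F)) ∞ (fun y => h.pullbackLift A f (k y)) x := by
  rw [contMDiffAt_totalSpace, contMDiffAt_totalSpace]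
  have key : (fun y => (trivializationAt F (h.PullbackQuot A f) (k x).proj (k y)).2) =
      fun y => (trivializationAt F (h.QuotBundle A) (h.pullbackLift A f (k x)).proj
        (h.pullbackLift A f (k y))).2 := rfl
  rw [key]
  refine and_congr_right fun h1 => ⟨fun h2 => ⟨?_, h2⟩, fun h2 => h2.2⟩
  exact f.contMDiff.contMDiffAt.comp x h1

theorem contMDiff_pullbackLift (h : IsPrincipalBundle IG IM IB G pr)
    (A : EquivariantStructure IG IM G F V) (f : C^∞⟮IB', B'; IB, B⟯) :
    ContMDiff (IB'.prod 𝓘(ℝ, F)) (IB.prod 𝓘(ℝ, F)) ∞ (h.pullbackLift A f) := fun _ =>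
  ((h.contMDiffAt_pullbackQuot A f).1 contMDiffAt_id).2

/-- The class, in the fibre of `f*(V / G)` over `y`, of a vector at a point `m` over `f y`,
as a linear homeomorphism. -/
def pullbackClsL (h : IsPrincipalBundle IG IM IB G pr) (A : EquivariantStructure IG IM G F V)
    (f : C^∞⟮IB', B'; IB, B⟯) (y : B') (m : M) (hm : pr m = f y) :
    V m ≃L[ℝ] h.PullbackQuot A f y := h.clsL A m hm

theorem pullbackClsL_apply (h : IsPrincipalBundle IG IM IB G pr)
    (A : EquivariantStructure IG IM G F V)
    (f : C^∞⟮IB', B'; IB, B⟯) (y : B') (m : M) (hm : pr m = f y) (v : V m) :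
    h.pullbackClsL A f y m hm v = h.cls A m hm v := h.clsL_apply A m hm v

/-- A map into `f*(V / G)` is smooth if it is represented by a smooth map into `V`. -/
theorem contMDiffAt_pullbackQuot_of_rep (h : IsPrincipalBundle IG IM IB G pr)
    (A : EquivariantStructure IG IM G F V) (f : C^∞⟮IB', B'; IB, B⟯)
    {k : N → TotalSpace F (h.PullbackQuot A f)} {r : N → TotalSpace F V} {x : N}
    (h1 : ContMDiffAt IN IB' ∞ (fun y => (k y).1) x)
    (h2 : ContMDiffAt IN (IM.prod 𝓘(ℝ, F)) ∞ r x)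
    (h3 : ∀ᶠ y in 𝓝 x, ∃ hm : pr (r y).1 = f (k y).1,
      h.pullbackClsL A f (k y).1 (r y).1 hm (r y).2 = (k y).2) :
    ContMDiffAt IN (IB'.prod 𝓘(ℝ, F)) ∞ k x := by
  refine (h.contMDiffAt_pullbackQuot A f).2 ⟨h1, ?_⟩
  refine ((h.contMDiff_quotMap A).contMDiffAt.comp x h2).congr_of_eventuallyEq ?_
  filter_upwards [h3] with y hy
  obtain ⟨hm, hy⟩ := hy
  have := h.quotMap_mk A (r y).1 hm (r y).2
  rw [← h.pullbackClsL_apply, hy] at this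
  exact this.symm

/-- The representative over `s(f y)` of an element of the fibre of `f*(V / G)` over `y`, where `s`
is the chosen local section near `f y₀`. -/
def pullbackRep (h : IsPrincipalBundle IG IM IB G pr) (A : EquivariantStructure IG IM G F V)
    (f : C^∞⟮IB', B'; IB, B⟯) (y₀ y : B') (z : h.PullbackQuot A f y) :
    V (h.sec (f y₀) (f y)) := h.lift A (h.sec (f y₀) (f y)) ⟨f y, z⟩

theorem contMDiffAt_pullbackRep (h : IsPrincipalBundle IG IM IB G pr)
    (A : EquivariantStructure IG IM G F V) (f : C^∞⟮IB', B'; IB, B⟯)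
    (z₀ : TotalSpace F (h.PullbackQuot A f)) :
    ContMDiffAt (IB'.prod 𝓘(ℝ, F)) (IM.prod 𝓘(ℝ, F)) ∞
      (fun z : TotalSpace F (h.PullbackQuot A f) =>
        (⟨h.sec (f z₀.1) (f z.1), h.pullbackRep A f z₀.1 z.1 z.2⟩ : TotalSpace F V)) z₀ :=
  (h.contMDiffAt_liftSec A (h.pullbackLift A f z₀)).comp z₀ (h.contMDiff_pullbackLift A f z₀)

theorem eventually_proj_sec_pullback (h : IsPrincipalBundle IG IM IB G pr) (f : C^∞⟮IB', B'; IB, B⟯)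
    (y₀ : B') : ∀ᶠ y in 𝓝 y₀, pr (h.sec (f y₀) (f y)) = f y :=
  f.contMDiff.continuous.continuousAt (h.eventually_proj_sec (f y₀))

theorem contMDiffAt_sec_pullback (h : IsPrincipalBundle IG IM IB G pr)
    (f : C^∞⟮IB', B'; IB, B⟯) {b : N → B'} {x : N} (hb : ContMDiffAt IN IB' ∞ b x) :
    ContMDiffAt IN IM ∞ (fun y => h.sec (f (b x)) (f (b y))) x :=
  ContMDiffAt.comp x (g := h.sec (f (b x))) (f := fun y => f (b y))
    (h.contMDiffAt_sec (f (b x)))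
    (f.contMDiff.contMDiffAt.comp x hb)

theorem pullbackClsL_pullbackRep (h : IsPrincipalBundle IG IM IB G pr)
    (A : EquivariantStructure IG IM G F V) (f : C^∞⟮IB', B'; IB, B⟯) (y₀ y : B')
    (hm : pr (h.sec (f y₀) (f y)) = f y) (z : h.PullbackQuot A f y) :
    h.pullbackClsL A f y _ hm (h.pullbackRep A f y₀ y z) = z :=
  (congrArg _ (h.lift_mk A _ hm z)).trans ((h.clsL A _ hm).apply_symm_apply z)

end Pullback

end IsPrincipalBundle

end QuotientBundles

/-! ### Vertical vectors and horizontal lifts -/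

noncomputable section HorizontalLifts

set_option linter.unusedSectionVars false

open Set Topology MulAction Bundle

variable {EG HG EM HM EB HB : Type*}
  [NormedAddCommGroup EG] [NormedSpace ℝ EG] [TopologicalSpace HG]
  [NormedAddCommGroup EM] [NormedSpace ℝ EM] [TopologicalSpace HM]
  [NormedAddCommGroup EB] [NormedSpace ℝ EB] [TopologicalSpace HB]
  {IG : ModelWithCorners ℝ EG HG} {IM : ModelWithCorners ℝ EM HM}
  {IB : ModelWithCorners ℝ EB HB}
  {G : Type*} [TopologicalSpace G] [ChartedSpace HG G] [Group G]
  {M : Type*} [TopologicalSpace M] [ChartedSpace HM M] [MulAction G M]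
  [ContMDiffSMul IG IM ∞ G M]
  {B : Type*} [TopologicalSpace B] [ChartedSpace HB B] {pr : M → B}

theorem mk_infGen (ξ : GroupLieAlgebra IG G) (m : M) :
    (⟨m, infGen IG IM ξ m⟩ : TangentBundle IM M) =
      tangentMap IG IM (fun g : G => g • m) ⟨1, ξ⟩ :=
  TotalSpace.ext (one_smul G m).symm HEq.rfl

/-- The derivative of the action map `G × M → M` at `(1, m)`. -/
theorem tangentMap_smul_one (ξ : GroupLieAlgebra IG G) (m : M) (v : TangentSpace IM m) :
    tangentMap (IG.prod IM) IM (fun p : G × M => p.1 • p.2) ⟨((1 : G), m), (ξ, v)⟩ =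
      (⟨m, infGen IG IM ξ m + v⟩ : TangentBundle IM M) := by
  have hd : MDifferentiableAt (IG.prod IM) IM (fun p : G × M => p.1 • p.2) ((1 : G), m) :=
    (contMDiff_smul (I := IG) (I' := IM) (n := ∞)).mdifferentiable (by simp) _
  have h1 := mfderiv_prod_eq_add_apply
      (v := ((ξ, v) : TangentSpace (IG.prod IM) ((1 : G), m))) hd
  have h3 : (mfderiv IM IM (fun x : M => (1 : G) • x) m : EM →L[ℝ] EM) v = v := by
    have : (fun x : M => (1 : G) • x) = id := by
      funext x
      simp
    rw [this, mfderiv_id]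
    rfl
  refine TotalSpace.ext (one_smul G m) (heq_of_eq (h1.trans ?_))
  exact congrArg (HAdd.hAdd (α := EM) (β := EM) (γ := EM) (infGen IG IM ξ m)) h3

namespace IsPrincipalBundle

/-- Infinitesimal generators are vertical. -/
theorem mfderiv_proj_infGen (h : IsPrincipalBundle IG IM IB G pr) (ξ : GroupLieAlgebra IG G)
    (m : M) : mfderiv IM IB pr m (infGen IG IM ξ m) = 0 := by
  refine TotalSpace.mk_injective (F := EB) (pr m) ?_
  change tangentMap IM IB pr ⟨m, infGen IG IM ξ m⟩ = _
  have h1 : MDifferentiable IG IM (fun g : G => g • m) :=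
    ((contMDiff_id.smul (I := IG) (contMDiff_const (c := m))).mdifferentiable
      (n := ∞) (by simp))
  rw [mk_infGen, ← Function.comp_apply (f := tangentMap IM IB pr),
    ← tangentMap_comp (h.contMDiff_proj.mdifferentiable (by simp)) h1]
  have h2 : pr ∘ (fun g : G => g • m) = fun _ => pr m := funext fun g => h.proj_smul g m
  rw [h2, tangentMap, mfderiv_const]
  rfl

/-- The local section of `pr` through a given point `m`, obtained by translating the chosen
one. -/
def secThrough (h : IsPrincipalBundle IG IM IB G pr) (m : M) (x : B) : M :=
  h.coord (pr m) m • h.sec (pr m) x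

theorem secThrough_proj (h : IsPrincipalBundle IG IM IB G pr) (m : M) :
    h.secThrough m (pr m) = m := h.coord_smul_sec (h.mem_base _)

theorem contMDiffAt_secThrough (h : IsPrincipalBundle IG IM IB G pr) (m : M) :
    ContMDiffAt IB IM ∞ (h.secThrough m) (pr m) :=
  (contMDiffAt_const (c := h.coord (pr m) m)).smul (I := IG)
    (h.contMDiffAt_sec (pr m))

theorem mfderiv_surjective (h : IsPrincipalBundle IG IM IB G pr) (m : M)
    (u : TangentSpace IB (pr m)) : ∃ v : TangentSpace IM m, mfderiv IM IB pr m v = u := by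
  refine ⟨(mfderiv IB IM (h.secThrough m) (pr m) : EB →L[ℝ] EM) u, ?_⟩
  have h1 : pr ∘ h.secThrough m =ᶠ[𝓝 (pr m)] id := by
    filter_upwards [h.eventually_proj_sec (pr m)] with x hx
    exact (h.proj_smul _ _).trans hx
  have h2 : HasMFDerivAt IB IB (pr ∘ h.secThrough m) (pr m) _ :=
    HasMFDerivAt.comp (pr m)
      (((h.contMDiff_proj _).mdifferentiableAt (by simp)).hasMFDerivAt)
      ((h.contMDiffAt_secThrough m).mdifferentiableAt (by simp)).hasMFDerivAt
  have h3 := h2.congr_of_eventuallyEq h1.symm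
  have h4 := hasMFDerivAt_unique h3 (hasMFDerivAt_id (pr m))
  have h5 := DFunLike.congr_fun h4 u
  have h6 : (mfderiv IM IB pr (h.secThrough m (pr m)) : EM →L[ℝ] EB) = mfderiv IM IB pr m := by
    rw [h.secThrough_proj]
  refine Eq.trans ?_ h5
  exact (DFunLike.congr_fun h6 _).symm

/-- A vertical vector is the value of an infinitesimal generator: near `m` every point `x` is
`c(x) • σ(pr x)` with `c(m) = 1` and `σ` a local section through `m`, so that a vector killed by
`T pr` is determined by the derivative of `c`. -/
theorem exists_infGen_eq [LieGroup IG ∞ G] (h : IsPrincipalBundle IG IM IB G pr) (m : M)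
    (v : TangentSpace IM m) (hv : mfderiv IM IB pr m v = 0) :
    ∃ ξ : GroupLieAlgebra IG G, infGen IG IM ξ m = v := by
  set g := h.coord (pr m) m
  have ho : pr ⁻¹' (h.triv (pr m)).baseSet ∈ 𝓝 m :=
    ((h.triv (pr m)).open_baseSet.preimage h.contMDiff_proj.continuous).mem_nhds (h.mem_base _)
  let c : M → G := fun x => h.coord (pr m) x * g⁻¹
  have hc : ContMDiffAt IM IG ∞ c m :=
    ((h.contMDiffOn_coord (pr m)).contMDiffAt ho).mul contMDiffAt_const
  have hcm : c m = 1 := mul_inv_cancel g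
  have hσ : ContMDiffAt IM IM ∞ (h.secThrough m ∘ pr) m :=
    (h.contMDiffAt_secThrough m).comp m (h.contMDiff_proj m)
  have hσm : (h.secThrough m ∘ pr) m = m := h.secThrough_proj m
  have hid : (fun p : G × M => p.1 • p.2) ∘ (fun x => (c x, (h.secThrough m ∘ pr) x)) =ᶠ[𝓝 m]
      id := by
    filter_upwards [ho] with x hx
    change (h.coord (pr m) x * g⁻¹) • g • h.sec (pr m) (pr x) = x
    rw [mul_smul, inv_smul_smul, h.coord_smul_sec hx]
  have h1 : HasMFDerivAt IM (IG.prod IM) (fun x => (c x, (h.secThrough m ∘ pr) x)) m _ :=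
    (hc.mdifferentiableAt (by simp)).hasMFDerivAt.prodMk
      (hσ.mdifferentiableAt (by simp)).hasMFDerivAt
  have h2 : HasMFDerivAt IM IM
      ((fun p : G × M => p.1 • p.2) ∘ (fun x => (c x, (h.secThrough m ∘ pr) x))) m _ :=
    HasMFDerivAt.comp m
      (((contMDiff_smul (I := IG) (I' := IM) (n := ∞)) _).mdifferentiableAt
        (by simp)).hasMFDerivAt h1
  have h3 := hasMFDerivAt_unique (h2.congr_of_eventuallyEq hid.symm) (hasMFDerivAt_id m)
  have h4 := DFunLike.congr_fun h3 v
  have h5 : mfderiv IM IM (h.secThrough m ∘ pr) m v = 0 := by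
    rw [mfderiv_comp m ((h.contMDiffAt_secThrough m).mdifferentiableAt (by simp))
      ((h.contMDiff_proj m).mdifferentiableAt (by simp))]
    change mfderiv IB IM (h.secThrough m) (pr m) (mfderiv IM IB pr m v) = 0
    rw [hv, map_zero]
  have h6 : ∀ (g' : G) (m' : M) (ζ : EG) (w : EM), g' = 1 → m' = m → w = 0 →
      (mfderiv (IG.prod IM) IM (fun p : G × M => p.1 • p.2) (g', m') : EG × EM →L[ℝ] EM) (ζ, w) =
        infGen IG IM (G := G) ζ m := by
    rintro _ m' ζ _ rfl rfl rfl
    have h7 := tangentMap_smul_one (IG := IG) (IM := IM) (G := G) ζ m' 0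
    rw [add_zero] at h7
    exact eq_of_heq (TotalSpace.mk.inj h7).2
  exact ⟨(mfderiv IM IG c m : EM →L[ℝ] EG) v, (h6 _ _ _ _ hcm hσm h5).symm.trans h4⟩

end IsPrincipalBundle

namespace PrincipalConnection

variable [LieGroup IG ∞ G] [IsManifold IM ∞ M] {h : IsPrincipalBundle IG IM IB G pr}

/-- Any lift `v` of `u` becomes horizontal after subtracting the infinitesimal generator of `𝔄(v)`;
two horizontal lifts differ by a vertical vector on which `𝔄` vanishes. -/
theorem existsUnique_isHorizontalLift (𝔄 : PrincipalConnection h) (m : M)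
    (u : TangentBundle IB B) (hu : u.proj = pr m) :
    ∃! v : TangentSpace IM m, 𝔄.IsHorizontalLift m u v := by
  obtain ⟨b, u⟩ := u
  obtain rfl : b = pr m := hu
  obtain ⟨v, rfl⟩ := h.mfderiv_surjective m u
  refine ⟨v - infGen IG IM (𝔄.form m v) m, ⟨?_, ?_⟩, ?_⟩
  · refine congrArg (TotalSpace.mk (pr m)) ?_
    change mfderiv IM IB pr m (v - infGen IG IM (𝔄.form m v) m) = _
    rw [map_sub, h.mfderiv_proj_infGen, sub_zero]
  · rw [map_sub, 𝔄.form_infGen, sub_self]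
  · rintro w ⟨hw1, hw2⟩
    have hw : mfderiv IM IB pr m w = mfderiv IM IB pr m v := TotalSpace.mk_injective _ hw1
    obtain ⟨ξ, hξ⟩ := h.exists_infGen_eq m (v - w) (by rw [map_sub, hw, sub_self])
    have h1 := congrArg (𝔄.form m) hξ
    rw [𝔄.form_infGen, map_sub, hw2, sub_zero] at h1
    rw [← h1, hξ, sub_sub_cancel]

theorem horizontalLift_spec (𝔄 : PrincipalConnection h) (m : M)
    (u : TangentBundle IB B) (hu : u.proj = pr m) :
    𝔄.IsHorizontalLift m u (𝔄.horizontalLift m u) :=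
  Classical.epsilon_spec (𝔄.existsUnique_isHorizontalLift m u hu).exists

/-- A tangent vector is determined by its projection and by its value under the connection form. -/
theorem ext_of_form (𝔄 : PrincipalConnection h) {m : M} {v w : TangentSpace IM m}
    (h1 : mfderiv IM IB pr m v = mfderiv IM IB pr m w) (h2 : 𝔄.form m v = 𝔄.form m w) : v = w := by
  obtain ⟨ξ, hξ⟩ := h.exists_infGen_eq m (v - w) (by rw [map_sub, h1, sub_self])
  have h3 := congrArg (𝔄.form m) hξ
  rw [𝔄.form_infGen, map_sub, h2, sub_self] at h3
  rw [← sub_eq_zero, ← hξ, h3]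
  exact map_zero (mfderiv IG IM (fun g : G => g • m) 1 : EG →L[ℝ] EM)

end PrincipalConnection

end HorizontalLifts

/-! ### The dual of a quotient bundle -/

noncomputable section DualBundles

set_option linter.unusedSectionVars false

open Set Topology MulAction Bundle

variable {EG HG EM HM EB HB EB' HB' EN HN : Type*}
  [NormedAddCommGroup EG] [NormedSpace ℝ EG] [TopologicalSpace HG]
  [NormedAddCommGroup EM] [NormedSpace ℝ EM] [TopologicalSpace HM]
  [NormedAddCommGroup EB] [NormedSpace ℝ EB] [TopologicalSpace HB]
  [NormedAddCommGroup EB'] [NormedSpace ℝ EB'] [TopologicalSpace HB']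
  [NormedAddCommGroup EN] [NormedSpace ℝ EN] [TopologicalSpace HN]
  {IG : ModelWithCorners ℝ EG HG} {IM : ModelWithCorners ℝ EM HM}
  {IB : ModelWithCorners ℝ EB HB} {IB' : ModelWithCorners ℝ EB' HB'}
  {IN : ModelWithCorners ℝ EN HN}
  {G : Type*} [TopologicalSpace G] [ChartedSpace HG G] [Group G]
  {M : Type*} [TopologicalSpace M] [ChartedSpace HM M] [MulAction G M]
  [ContMDiffSMul IG IM ∞ G M]
  {B : Type*} [TopologicalSpace B] [ChartedSpace HB B] {pr : M → B}
  {B' : Type*} [TopologicalSpace B'] [ChartedSpace HB' B']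
  {N : Type*} [TopologicalSpace N] [ChartedSpace HN N]
  {F : Type*} [NormedAddCommGroup F] [NormedSpace ℝ F] [FiniteDimensional ℝ F]
  {V : M → Type*} [∀ m, AddCommGroup (V m)] [∀ m, Module ℝ (V m)]
  [∀ m, TopologicalSpace (V m)] [TopologicalSpace (TotalSpace F V)] [FiberBundle F V]
  [VectorBundle ℝ F V] [ContMDiffVectorBundle ∞ F V IM] [LieGroup IG ∞ G] [IsManifold IM ∞ M]
  [IsManifold IB ∞ B]

/-- The fibres of a vector bundle, which carry a topology and a module structure as separate data,
are topological vector spaces, since they are linearly homeomorphic to the model fibre. -/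
theorem isTopologicalAddGroup_fibre (y : B) {F : Type*} [NormedAddCommGroup F] [NormedSpace ℝ F]
    (E : B → Type*) [∀ x, AddCommGroup (E x)] [∀ x, Module ℝ (E x)]
    [∀ x, TopologicalSpace (E x)] [TopologicalSpace (TotalSpace F E)] [FiberBundle F E]
    [VectorBundle ℝ F E] : IsTopologicalAddGroup (E y) ∧ ContinuousConstSMul ℝ (E y) := by
  let e := (trivializationAt F E y).continuousLinearEquivAt ℝ y
    (mem_baseSet_trivializationAt F E y)
  exact ⟨e.toHomeomorph.isInducing.topologicalAddGroup e.toLinearEquiv.toAddMonoidHom,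
    e.toHomeomorph.isInducing.continuousConstSMul id (map_smul e _ _)⟩

namespace IsPrincipalBundle

/-- The identification of `f*(V* / G)` with the dual of `f*(V / G)`, fibre by fibre. -/
def quotDualL (h : IsPrincipalBundle IG IM IB G pr) (A : EquivariantStructure IG IM G F V)
    (f : C^∞⟮IB', B'; IB, B⟯) (y : B') :
    h.PullbackQuot A.dual f y ≃L[ℝ] (h.PullbackQuot A f y →L[ℝ] ℝ) :=
  (h.pullbackClsL A.dual f y (h.rep (f y)) (h.proj_rep (f y))).symm.trans
    ((h.pullbackClsL A f y (h.rep (f y)) (h.proj_rep (f y))).arrowCongr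
      (ContinuousLinearEquiv.refl ℝ ℝ))

/-- The pairing of `[α]` with `[v]` is `α v`, for representatives over any common point `m`. -/
theorem quotDualL_cls (h : IsPrincipalBundle IG IM IB G pr) (A : EquivariantStructure IG IM G F V)
    (f : C^∞⟮IB', B'; IB, B⟯) (y : B') (m : M) (hm : pr m = f y)
    (α : V m →L[ℝ] Bundle.Trivial M ℝ m) (v : V m) :
    h.quotDualL A f y (h.pullbackClsL A.dual f y m hm α) (h.pullbackClsL A f y m hm v) = α v := by
  obtain ⟨g, rfl⟩ := h.exists_smul_eq ((h.proj_rep (f y)).trans hm.symm)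
  obtain ⟨v, rfl⟩ := (A.act g (h.rep (f y))).surjective v
  obtain ⟨α, rfl⟩ := (A.dual.act g (h.rep (f y))).surjective α
  have h1 : h.pullbackClsL A f y _ hm (A.act g (h.rep (f y)) v) =
      h.pullbackClsL A f y _ (h.proj_rep (f y)) v := by
    rw [pullbackClsL_apply, pullbackClsL_apply]
    exact h.cls_act A g _ _ _ v
  have h2 : h.pullbackClsL A.dual f y _ hm (A.dual.act g (h.rep (f y)) α) =
      h.pullbackClsL A.dual f y _ (h.proj_rep (f y)) α := by
    rw [pullbackClsL_apply, pullbackClsL_apply]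
    exact h.cls_act A.dual g _ _ _ α
  rw [h1, h2]
  have h3 : A.dual.act g (h.rep (f y)) α (A.act g (h.rep (f y)) v) = α v := by
    change α ((A.act g (h.rep (f y))).symm (A.act g (h.rep (f y)) v)) = α v
    rw [ContinuousLinearEquiv.symm_apply_apply]
  rw [h3]
  unfold quotDualL
  rw [ContinuousLinearEquiv.trans_apply, ContinuousLinearEquiv.symm_apply_apply,
    ContinuousLinearEquiv.arrowCongr_apply, ContinuousLinearEquiv.symm_apply_apply]
  rfl

/-- The pairing of smooth maps into `f*(V* / G)` and `f*(V / G)` is smooth. -/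
theorem contMDiffAt_quotDualL (h : IsPrincipalBundle IG IM IB G pr)
    (A : EquivariantStructure IG IM G F V) (f : C^∞⟮IB', B'; IB, B⟯) {b : N → B'}
    {α : ∀ y, h.PullbackQuot A.dual f (b y)} {v : ∀ y, h.PullbackQuot A f (b y)} {x : N}
    (hα : ContMDiffAt IN (IB'.prod 𝓘(ℝ, F →L[ℝ] ℝ)) ∞
      (fun y => (⟨b y, α y⟩ : TotalSpace (F →L[ℝ] ℝ) (h.PullbackQuot A.dual f))) x)
    (hv : ContMDiffAt IN (IB'.prod 𝓘(ℝ, F)) ∞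
      (fun y => (⟨b y, v y⟩ : TotalSpace F (h.PullbackQuot A f))) x) :
    ContMDiffAt IN 𝓘(ℝ, ℝ) ∞ (fun y => h.quotDualL A f (b y) (α y) (v y)) x := by
  have hb : ContMDiffAt IN IB' ∞ b x := (contMDiffAt_totalSpace.1 hα).1
  have h1 := (h.contMDiffAt_pullbackRep A.dual f ⟨b x, α x⟩).comp x hα
  have h2 := (h.contMDiffAt_pullbackRep A f ⟨b x, v x⟩).comp x hv
  refine (contMDiffAt_pairing (b := fun y => h.sec (f (b x)) (f (b y)))
    (α := fun y => h.pullbackRep A.dual f (b x) (b y) (α y))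
    (v := fun y => h.pullbackRep A f (b x) (b y) (v y)) h1 h2).congr_of_eventuallyEq ?_
  filter_upwards [hb.continuousAt (h.eventually_proj_sec_pullback f (b x))] with y hm
  refine Eq.trans ?_ (h.quotDualL_cls A f (b y) _ hm _ _)
  rw [pullbackClsL_pullbackRep, pullbackClsL_pullbackRep]

variable
  {F₁ : Type*} [NormedAddCommGroup F₁] [NormedSpace ℝ F₁] [FiniteDimensional ℝ F₁]
  {E₁ : B' → Type*} [∀ x, AddCommGroup (E₁ x)] [∀ x, Module ℝ (E₁ x)]
  [∀ x, TopologicalSpace (E₁ x)] [TopologicalSpace (TotalSpace F₁ E₁)] [FiberBundle F₁ E₁]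
  [VectorBundle ℝ F₁ E₁] [ContMDiffVectorBundle ∞ F₁ E₁ IB']
  {F₂ : Type*} [NormedAddCommGroup F₂] [NormedSpace ℝ F₂] [FiniteDimensional ℝ F₂]
  {E₂ : B' → Type*} [∀ x, AddCommGroup (E₂ x)] [∀ x, Module ℝ (E₂ x)]
  [∀ x, TopologicalSpace (E₂ x)] [TopologicalSpace (TotalSpace F₂ E₂)] [FiberBundle F₂ E₂]
  [VectorBundle ℝ F₂ E₂] [ContMDiffVectorBundle ∞ F₂ E₂ IB']

/-- The fibre maps of the isomorphism dual to `X`. -/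
def dualIsoFibre (h : IsPrincipalBundle IG IM IB G pr) (A : EquivariantStructure IG IM G F V)
    (f : C^∞⟮IB', B'; IB, B⟯)
    (X : SmoothVectorBundleEquiv IB' F (h.PullbackQuot A f) (F₁ × F₂) (E₁ ×ᵇ E₂)) (y : B') :
    h.PullbackQuot A.dual f y ≃L[ℝ]
      (E₁ y →L[ℝ] Bundle.Trivial B' ℝ y) × (E₂ y →L[ℝ] Bundle.Trivial B' ℝ y) :=
  have := isTopologicalAddGroup_fibre (F := F₁) y E₁
  have := this.1
  have := this.2
  have := isTopologicalAddGroup_fibre (F := F₂) y E₂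
  have := this.1
  have := this.2
  (h.quotDualL A f y).trans (((X.equiv y).arrowCongr (ContinuousLinearEquiv.refl ℝ ℝ)).trans
    (ContinuousLinearMap.coprodEquivL ℝ (𝕜 := ℝ) (E := E₁ y) (F := E₂ y) (G := ℝ)).symm)

theorem dualIsoFibre_fst (h : IsPrincipalBundle IG IM IB G pr)
    (A : EquivariantStructure IG IM G F V) (f : C^∞⟮IB', B'; IB, B⟯)
    (X : SmoothVectorBundleEquiv IB' F (h.PullbackQuot A f) (F₁ × F₂) (E₁ ×ᵇ E₂)) (y : B')
    (a : h.PullbackQuot A.dual f y) (u : E₁ y) :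
    (h.dualIsoFibre A f X y a).1 u = h.quotDualL A f y a ((X.equiv y).symm (u, 0)) := rfl

theorem dualIsoFibre_snd (h : IsPrincipalBundle IG IM IB G pr)
    (A : EquivariantStructure IG IM G F V) (f : C^∞⟮IB', B'; IB, B⟯)
    (X : SmoothVectorBundleEquiv IB' F (h.PullbackQuot A f) (F₁ × F₂) (E₁ ×ᵇ E₂)) (y : B')
    (a : h.PullbackQuot A.dual f y) (u : E₂ y) :
    (h.dualIsoFibre A f X y a).2 u = h.quotDualL A f y a ((X.equiv y).symm (0, u)) := rfl

/-- `⟨X'(a), X(z)⟩ = ⟨a, z⟩`. -/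
theorem dualIsoFibre_pairing (h : IsPrincipalBundle IG IM IB G pr)
    (A : EquivariantStructure IG IM G F V) (f : C^∞⟮IB', B'; IB, B⟯)
    (X : SmoothVectorBundleEquiv IB' F (h.PullbackQuot A f) (F₁ × F₂) (E₁ ×ᵇ E₂)) (y : B')
    (a : h.PullbackQuot A.dual f y) (z : h.PullbackQuot A f y) :
    ((h.dualIsoFibre A f X y a).1 (X.equiv y z).1 : ℝ) +
      (h.dualIsoFibre A f X y a).2 (X.equiv y z).2 = h.quotDualL A f y a z := by
  rw [dualIsoFibre_fst, dualIsoFibre_snd]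
  refine (map_add (h.quotDualL A f y a) _ _).symm.trans ?_
  rw [← map_add]
  have h1 : (((X.equiv y z).1, 0) + (0, (X.equiv y z).2) : E₁ y × E₂ y) = X.equiv y z := by
    ext <;> simp
  exact congrArg _ ((congrArg _ h1).trans ((X.equiv y).symm_apply_apply z))

/-- The isomorphism `f*(V* / G) ≃ E₁* ⊕ E₂*` dual to an isomorphism `X : f*(V / G) ≃ E₁ ⊕ E₂`.
Its fibre maps and their inverses are smooth because a family of covectors is smooth as soon as its
values on smooth families of vectors are. -/
def dualIso (h : IsPrincipalBundle IG IM IB G pr) (A : EquivariantStructure IG IM G F V)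
    (f : C^∞⟮IB', B'; IB, B⟯)
    (X : SmoothVectorBundleEquiv IB' F (h.PullbackQuot A f) (F₁ × F₂) (E₁ ×ᵇ E₂)) :
    SmoothVectorBundleEquiv IB' (F →L[ℝ] ℝ) (h.PullbackQuot A.dual f)
      ((F₁ →L[ℝ] ℝ) × (F₂ →L[ℝ] ℝ))
      ((fun y : B' => E₁ y →L[ℝ] Bundle.Trivial B' ℝ y) ×ᵇ
        fun y => E₂ y →L[ℝ] Bundle.Trivial B' ℝ y) where
  equiv := h.dualIsoFibre A f X
  contMDiff_equiv := by
    intro a₀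
    have hb : ContMDiffAt (IB'.prod 𝓘(ℝ, F →L[ℝ] ℝ)) IB' ∞
        (fun a : TotalSpace (F →L[ℝ] ℝ) (h.PullbackQuot A.dual f) => a.1) a₀ :=
      (Bundle.contMDiff_proj _).contMDiffAt
    have key : ∀ u : ∀ y : B', E₁ y × E₂ y,
        ContMDiffAt (IB'.prod 𝓘(ℝ, F →L[ℝ] ℝ)) (IB'.prod 𝓘(ℝ, F₁ × F₂)) ∞
          (fun a : TotalSpace (F →L[ℝ] ℝ) (h.PullbackQuot A.dual f) =>
            (⟨a.1, u a.1⟩ : TotalSpace (F₁ × F₂) (E₁ ×ᵇ E₂))) a₀ →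
        ContMDiffAt (IB'.prod 𝓘(ℝ, F →L[ℝ] ℝ)) 𝓘(ℝ, ℝ) ∞
          (fun a : TotalSpace (F →L[ℝ] ℝ) (h.PullbackQuot A.dual f) =>
            h.quotDualL A f a.1 a.2 ((X.equiv a.1).symm (u a.1))) a₀ := fun u hu =>
      h.contMDiffAt_quotDualL A f (b := fun a : TotalSpace (F →L[ℝ] ℝ)
        (h.PullbackQuot A.dual f) => a.1) contMDiffAt_id ((X.contMDiff_symm _).comp a₀ hu)
    refine contMDiffAt_prodBundle.2 ⟨?_, ?_⟩
    · refine contMDiffAt_dualBundle hb fun u => ?_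
      refine key (fun y => ((trivializationAt F₁ E₁ a₀.1).symmL ℝ y u, 0))
        (contMDiffAt_prodBundle.2 ⟨?_, ?_⟩)
      · exact contMDiffAt_symmL hb _ (mem_baseSet_trivializationAt F₁ E₁ a₀.1) u
      · exact ((contMDiff_zeroSection ℝ E₂).contMDiffAt.comp a₀ hb)
    · refine contMDiffAt_dualBundle hb fun u => ?_
      refine key (fun y => (0, (trivializationAt F₂ E₂ a₀.1).symmL ℝ y u))
        (contMDiffAt_prodBundle.2 ⟨?_, ?_⟩)
      · exact ((contMDiff_zeroSection ℝ E₁).contMDiffAt.comp a₀ hb)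
      · exact contMDiffAt_symmL hb _ (mem_baseSet_trivializationAt F₂ E₂ a₀.1) u
  contMDiff_symm := by
    intro c₀
    have hc := contMDiffAt_prodBundle.1 (contMDiffAt_id (x := c₀) (n := ∞)
      (I := IB'.prod 𝓘(ℝ, (F₁ →L[ℝ] ℝ) × (F₂ →L[ℝ] ℝ))))
    have hb := (contMDiffAt_totalSpace.1 hc.1).1
    have hs := h.contMDiffAt_sec_pullback f hb
    have hrep : ∀ᶠ c in 𝓝 c₀, pr (h.sec (f c₀.1) (f c.1)) = f c.1 :=
      hb.continuousAt (h.eventually_proj_sec_pullback f c₀.1)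
    refine h.contMDiffAt_pullbackQuot_of_rep A.dual f
      (r := fun c => ⟨h.sec (f c₀.1) (f c.1), h.pullbackRep A.dual f c₀.1 c.1
        ((h.dualIsoFibre A f X c.1).symm c.2)⟩) hb ?_ ?_
    · refine contMDiffAt_dualBundle hs fun v => ?_
      -- the class of the frame vector with constant coordinates `v` along the local section
      let z : ∀ y : B', h.PullbackQuot A f y := fun y =>
        open Classical in if hm : pr (h.sec (f c₀.1) (f y)) = f y then
          h.pullbackClsL A f y _ hm ((trivializationAt F V (h.sec (f c₀.1) (f c₀.1))).symmL ℝ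
                (h.sec (f c₀.1) (f y)) v) else 0
      have hz_eq : ∀ (y : B') (hm : pr (h.sec (f c₀.1) (f y)) = f y),
          h.pullbackClsL A f y _ hm ((trivializationAt F V (h.sec (f c₀.1) (f c₀.1))).symmL ℝ
            (h.sec (f c₀.1) (f y)) v) = z y := by
        intro y hm
        dsimp only [z]
        rw [dif_pos hm]
      have hz : ContMDiffAt (IB'.prod 𝓘(ℝ, (F₁ →L[ℝ] ℝ) × (F₂ →L[ℝ] ℝ))) (IB'.prod 𝓘(ℝ, F)) ∞
          (fun c : TotalSpace ((F₁ →L[ℝ] ℝ) × (F₂ →L[ℝ] ℝ))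
            ((fun y : B' => E₁ y →L[ℝ] Bundle.Trivial B' ℝ y) ×ᵇ
              fun y => E₂ y →L[ℝ] Bundle.Trivial B' ℝ y) =>
            (⟨c.1, z c.1⟩ : TotalSpace F (h.PullbackQuot A f))) c₀ := by
        refine h.contMDiffAt_pullbackQuot_of_rep A f hb
          (contMDiffAt_symmL hs _ (mem_baseSet_trivializationAt F V _) v) ?_
        filter_upwards [hrep] with c hm
        exact ⟨hm, hz_eq c.1 hm⟩
      have hX := contMDiffAt_prodBundle.1 ((X.contMDiff_equiv _).comp c₀ hz)
      refine ((contMDiffAt_pairing hc.1 hX.1).add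
        (contMDiffAt_pairing hc.2 hX.2)).congr_of_eventuallyEq ?_
      filter_upwards [hrep] with c hm
      have h1 := h.dualIsoFibre_pairing A f X c.1 ((h.dualIsoFibre A f X c.1).symm c.2) (z c.1)
      rw [ContinuousLinearEquiv.apply_symm_apply] at h1
      refine Eq.trans ?_ h1.symm
      refine (h.quotDualL_cls A f c.1 _ hm _ _).symm.trans ?_
      rw [h.pullbackClsL_pullbackRep A.dual f c₀.1 c.1 hm]
      exact congrArg _ (hz_eq c.1 hm)
    · filter_upwards [hrep] with c hm
      exact ⟨hm, h.pullbackClsL_pullbackRep A.dual f _ _ hm _⟩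

end IsPrincipalBundle
end DualBundles

/-! ### The splitting of `TM / G` by a principal connection -/

noncomputable section TangentSplitting

set_option linter.unusedSectionVars false

open Set Topology MulAction Bundle

variable {EG HG EM HM EB HB EB' HB' EN HN : Type*}
  [NormedAddCommGroup EG] [NormedSpace ℝ EG] [TopologicalSpace HG]
  [NormedAddCommGroup EM] [NormedSpace ℝ EM] [TopologicalSpace HM]
  [NormedAddCommGroup EB] [NormedSpace ℝ EB] [TopologicalSpace HB]
  [NormedAddCommGroup EB'] [NormedSpace ℝ EB'] [TopologicalSpace HB']
  [NormedAddCommGroup EN] [NormedSpace ℝ EN] [TopologicalSpace HN]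
  {IG : ModelWithCorners ℝ EG HG} {IM : ModelWithCorners ℝ EM HM}
  {IB : ModelWithCorners ℝ EB HB} {IB' : ModelWithCorners ℝ EB' HB'}
  {IN : ModelWithCorners ℝ EN HN}
  {G : Type*} [TopologicalSpace G] [ChartedSpace HG G] [Group G]
  {M : Type*} [TopologicalSpace M] [ChartedSpace HM M] [MulAction G M]
  [ContMDiffSMul IG IM ∞ G M]
  {B : Type*} [TopologicalSpace B] [ChartedSpace HB B] {pr : M → B}
  {B' : Type*} [TopologicalSpace B'] [ChartedSpace HB' B']
  {N : Type*} [TopologicalSpace N] [ChartedSpace HN N]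
  [LieGroup IG ∞ G] [IsManifold IM ∞ M] [IsManifold IB ∞ B] [IsManifold IB' ∞ B']

/-- The tangent map of a function that is smooth on an open set only. -/
theorem contMDiffAt_tangentMap {f : M → N} [IsManifold IN ∞ N] {s : Set M} (hs : IsOpen s)
    (hf : ContMDiffOn IM IN ∞ f s) {v : TangentBundle IM M} (hv : v.1 ∈ s) :
    ContMDiffAt IM.tangent IN.tangent ∞ (tangentMap IM IN f) v := by
  have ho : TotalSpace.proj ⁻¹' s ∈ 𝓝 v :=
    (hs.preimage (FiberBundle.continuous_proj EM (TangentSpace IM : M → Type _))).mem_nhds hv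
  have h1 := (hf.contMDiffOn_tangentMapWithin (m := ∞) (by simp) hs.uniqueMDiffOn).contMDiffAt ho
  refine h1.congr_of_eventuallyEq ?_
  filter_upwards [ho] with w hw
  exact (tangentMapWithin_eq_tangentMap (hs.uniqueMDiffOn w.1 hw)
    (((hf w.1 hw).contMDiffAt (hs.mem_nhds hw)).mdifferentiableAt (by simp))).symm

theorem contMDiff_mk_tangentBundle (m : M) :
    ContMDiff 𝓘(ℝ, EM) IM.tangent ∞ (fun v : EM => (⟨m, v⟩ : TangentBundle IM M)) := by
  intro v
  refine contMDiffAt_totalSpace.2 ⟨contMDiffAt_const, ?_⟩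
  have h1 := ContinuousLinearMap.contMDiff (n := ∞) (E := EM) (F := EM)
    ((trivializationAt EM (TangentSpace IM) m).continuousLinearMapAt ℝ m) v
  have h2 : ∀ w : TangentSpace IM m, (trivializationAt EM (TangentSpace IM) m ⟨m, w⟩).2 =
      (trivializationAt EM (TangentSpace IM) m).continuousLinearMapAt ℝ m w := by
    intro w
    rw [Trivialization.continuousLinearMapAt_apply, Trivialization.linearMapAt_apply,
      if_pos (mem_baseSet_trivializationAt EM _ m)]
  exact h1.congr_of_eventuallyEq (Filter.Eventually.of_forall h2)

/-- Adding infinitesimal generators to a smooth family of tangent vectors gives a smooth family,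
because the sum is a derivative of the action map. -/
theorem contMDiffAt_infGen_add {ξ : N → EG} {v : N → TangentBundle IM M} {x : N}
    (hξ : ContMDiffAt IN 𝓘(ℝ, EG) ∞ ξ x) (hv : ContMDiffAt IN IM.tangent ∞ v x) :
    ContMDiffAt IN IM.tangent ∞ (fun y => (⟨(v y).1,
      infGen (G := G) IG IM (ξ y) (v y).1 + (v y).2⟩ : TangentBundle IM M)) x := by
  have h1 : ContMDiff (IG.prod IM).tangent IM.tangent ∞
      (tangentMap (IG.prod IM) IM (fun p : G × M => p.1 • p.2)) :=
    (contMDiff_smul (I := IG) (I' := IM) (n := ∞)).contMDiff_tangentMap (by simp)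
  have h2 : ContMDiffAt IN (IG.prod IM).tangent ∞
      (fun y => (equivTangentBundleProd IG G IM M).symm
        ((⟨1, ξ y⟩ : TangentBundle IG G), v y)) x :=
    (contMDiff_equivTangentBundleProd_symm _).comp x
      (((contMDiff_mk_tangentBundle (IM := IG) (1 : G)).contMDiffAt.comp x hξ).prodMk hv)
  refine ((h1 _).comp x h2).congr_of_eventuallyEq (Filter.Eventually.of_forall fun y => ?_)
  exact (tangentMap_smul_one (IG := IG) (G := G) (ξ y) (v y).1 (v y).2).symm

theorem IsPrincipalBundle.tangentMap_proj_sec (h : IsPrincipalBundle IG IM IB G pr) {b : B}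
    (x : TangentBundle IB B) (hx : x.1 ∈ (h.triv b).baseSet) :
    tangentMap IM IB pr (tangentMap IB IM (h.sec b) x) = x := by
  have ho := (h.triv b).open_baseSet.mem_nhds hx
  have h1 : pr ∘ h.sec b =ᶠ[𝓝 x.1] id := by
    filter_upwards [ho] with y hy
    exact h.proj_sec hy
  rw [← tangentMap_comp_at x (h.contMDiff_proj.mdifferentiable (by simp) _)
    (((h.contMDiffOn_sec b).contMDiffAt ho).mdifferentiableAt (by simp))]
  have h2 := h1.mfderiv_eq (I := IB) (I' := IB)
  refine TotalSpace.ext (h.proj_sec hx) (heq_of_eq ?_)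
  change (mfderiv IB IB (pr ∘ h.sec b) x.1 : EB →L[ℝ] EB) x.2 = x.2
  exact (DFunLike.congr_fun h2 x.2).trans (by rw [mfderiv_id]; rfl)

namespace PrincipalConnection

variable {h : IsPrincipalBundle IG IM IB G pr}

/-- `v ↦ (T(Φ ∘ pr) v, 𝔄(v))` for a tangent vector `v` at `m`, where `y = Φ (pr m)`. (The
derivative lies in `TangentSpace IB' (Φ (pr m))`, which is the model space `EB'` in the same chart
as `TangentSpace IB' y`.) -/
def splitMap (𝔄 : PrincipalConnection h) (Φ : C^∞⟮IB, B; IB', B'⟯) (m : M) (y : B') :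
    TangentSpace IM m →L[ℝ] TangentSpace IB' y × GroupLieAlgebra IG G :=
  ContinuousLinearMap.prod (M₂ := TangentSpace IB' y)
    (mfderiv IM IB' (Φ ∘ pr) m : EM →L[ℝ] EB') (𝔄.form m)

theorem splitMap_snd (𝔄 : PrincipalConnection h) (Φ : C^∞⟮IB, B; IB', B'⟯) (m : M) (y : B')
    (v : TangentSpace IM m) : (𝔄.splitMap Φ m y v).2 = 𝔄.form m v := rfl

theorem mk_splitMap_fst (𝔄 : PrincipalConnection h) (Φ : C^∞⟮IB, B; IB', B'⟯) {m : M} {y : B'}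
    (hy : Φ (pr m) = y) (v : TangentSpace IM m) :
    (⟨y, (𝔄.splitMap Φ m y v).1⟩ : TangentBundle IB' B') =
      tangentMap IM IB' (Φ ∘ pr) ⟨m, v⟩ := by
  subst hy
  rfl

theorem tangentMap_comp_proj (h : IsPrincipalBundle IG IM IB G pr) (Φ : C^∞⟮IB, B; IB', B'⟯)
    (w : TangentBundle IM M) :
    tangentMap IM IB' (Φ ∘ pr) w = tangentMap IB IB' Φ (tangentMap IM IB pr w) := by
  rw [tangentMap_comp (Φ.contMDiff.mdifferentiable (by simp))
    (h.contMDiff_proj.mdifferentiable (by simp))]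
  rfl

theorem tangentMap_inverse {Φ : C^∞⟮IB, B; IB', B'⟯} {Ψ : C^∞⟮IB', B'; IB, B⟯}
    (h1 : ∀ y, Φ (Ψ y) = y) (w : TangentBundle IB' B') :
    tangentMap IB IB' Φ (tangentMap IB' IB Ψ w) = w := by
  have h2 : tangentMap IB' IB' (Φ ∘ Ψ) w = tangentMap IB IB' Φ (tangentMap IB' IB Ψ w) := by
    rw [tangentMap_comp (Φ.contMDiff.mdifferentiable (by simp))
      (Ψ.contMDiff.mdifferentiable (by simp))]
    rfl
  have h3 : Φ ∘ Ψ = id := funext h1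
  rw [← h2, h3, tangentMap_id]
  rfl

theorem splitMap_of_proj (𝔄 : PrincipalConnection h) {Φ : C^∞⟮IB, B; IB', B'⟯}
    {Ψ : C^∞⟮IB', B'; IB, B⟯} (h1 : ∀ y, Φ (Ψ y) = y) {m : M} {y : B'} (hm : pr m = Ψ y)
    (u : TangentSpace IB' y) (v : TangentSpace IM m)
    (hv : tangentMap IM IB pr ⟨m, v⟩ = tangentMap IB' IB Ψ ⟨y, u⟩) (ξ : GroupLieAlgebra IG G)
    (hξ : 𝔄.form m v = ξ) :
    𝔄.splitMap Φ m y v = (u, ξ) := by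
  refine Prod.ext ?_ hξ
  refine TotalSpace.mk_injective (F := EB') y ?_
  exact ((𝔄.mk_splitMap_fst Φ (by rw [hm, h1]) v).trans
    (tangentMap_comp_proj h Φ _)).trans ((congrArg _ hv).trans (tangentMap_inverse h1 _))

theorem tangentMap_add_infGen (h : IsPrincipalBundle IG IM IB G pr) (m : M) (v : TangentSpace IM m)
    (ξ : GroupLieAlgebra IG G) :
    tangentMap IM IB pr ⟨m, v + infGen IG IM ξ m⟩ = tangentMap IM IB pr ⟨m, v⟩ := by
  refine congrArg (TotalSpace.mk (pr m)) ?_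
  change mfderiv IM IB pr m (v + infGen IG IM ξ m) = mfderiv IM IB pr m v
  rw [map_add, h.mfderiv_proj_infGen, add_zero]

/-- `splitMap` is inverted by adding the horizontal lift of the first component to the
infinitesimal generator of the second. -/
theorem splitMap_horizontalLift_add (𝔄 : PrincipalConnection h) {Φ : C^∞⟮IB, B; IB', B'⟯}
    {Ψ : C^∞⟮IB', B'; IB, B⟯} (h1 : ∀ y, Φ (Ψ y) = y) {m : M} {y : B'} (hm : pr m = Ψ y)
    (u : TangentSpace IB' y) (ξ : GroupLieAlgebra IG G) :
    𝔄.splitMap Φ m y (𝔄.horizontalLift m (tangentMap IB' IB Ψ ⟨y, u⟩) + infGen IG IM ξ m) =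
      (u, ξ) := by
  obtain ⟨h2, h3⟩ := 𝔄.horizontalLift_spec m (tangentMap IB' IB Ψ ⟨y, u⟩) hm.symm
  refine 𝔄.splitMap_of_proj h1 hm u _ ?_ ξ ?_
  · rw [tangentMap_add_infGen h, h2]
  · rw [map_add, h3, 𝔄.form_infGen, zero_add]

theorem splitMap_bijective (𝔄 : PrincipalConnection h) {Φ : C^∞⟮IB, B; IB', B'⟯}
    {Ψ : C^∞⟮IB', B'; IB, B⟯} (h1 : ∀ y, Φ (Ψ y) = y) (h2 : ∀ b, Ψ (Φ b) = b) {m : M} {y : B'}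
    (hm : pr m = Ψ y) : Function.Bijective (𝔄.splitMap Φ m y) := by
  have hy : Φ (pr m) = y := by rw [hm, h1]
  constructor
  · intro v w hvw
    refine 𝔄.ext_of_form (m := m) ?_ (congrArg Prod.snd hvw)
    refine TotalSpace.mk_injective (F := EB) (pr m) ?_
    have h3 : tangentMap IM IB' (Φ ∘ pr) ⟨m, v⟩ = tangentMap IM IB' (Φ ∘ pr) ⟨m, w⟩ := by
      rw [← 𝔄.mk_splitMap_fst Φ hy, ← 𝔄.mk_splitMap_fst Φ hy, hvw]
    rw [tangentMap_comp_proj h, tangentMap_comp_proj h] at h3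
    have h4 := congrArg (tangentMap IB' IB Ψ) h3
    rwa [tangentMap_inverse h2, tangentMap_inverse h2] at h4
  · rintro ⟨u, ξ⟩
    exact ⟨_, 𝔄.splitMap_horizontalLift_add h1 hm u ξ⟩

variable [FiniteDimensional ℝ EG] [FiniteDimensional ℝ EM]

/-- `splitMap` as a linear homeomorphism. -/
def splitL (𝔄 : PrincipalConnection h) {Φ : C^∞⟮IB, B; IB', B'⟯}
    {Ψ : C^∞⟮IB', B'; IB, B⟯} (h1 : ∀ y, Φ (Ψ y) = y) (h2 : ∀ b, Ψ (Φ b) = b) {m : M} {y : B'}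
    (hm : pr m = Ψ y) :
    TangentSpace IM m ≃L[ℝ] TangentSpace IB' y × GroupLieAlgebra IG G :=
  have : FiniteDimensional ℝ (TangentSpace IM m) := inferInstanceAs (FiniteDimensional ℝ EM)
  have : T2Space (TangentSpace IM m) := inferInstanceAs (T2Space EM)
  have : T2Space (TangentSpace IB' y × GroupLieAlgebra IG G) :=
    inferInstanceAs (T2Space (EB' × EG))
  (LinearEquiv.ofBijective
    (𝔄.splitMap Φ m y : TangentSpace IM m →ₗ[ℝ] TangentSpace IB' y × GroupLieAlgebra IG G)
    (𝔄.splitMap_bijective h1 h2 hm)).toContinuousLinearEquiv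

end PrincipalConnection

namespace IsPrincipalBundle

variable [FiniteDimensional ℝ EG] [FiniteDimensional ℝ EM]

/-- `tangentCls` as a linear homeomorphism. -/
def tangentClsL (h : IsPrincipalBundle IG IM IB G pr) (Ψ : C^∞⟮IB', B'; IB, B⟯) (y : B') (m : M)
    (hm : pr m = Ψ y) : TangentSpace IM m ≃L[ℝ] h.PullbackQuot (tangentAction IG IM G M) Ψ y :=
  h.pullbackClsL (tangentAction IG IM G M) Ψ y m hm

/-- `adjointCls` as a linear homeomorphism. -/
def adjointClsL (h : IsPrincipalBundle IG IM IB G pr) (Ψ : C^∞⟮IB', B'; IB, B⟯) (y : B') (m : M)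
    (hm : pr m = Ψ y) : GroupLieAlgebra IG G ≃L[ℝ] h.PullbackQuot (adjointAction IG IM M) Ψ y :=
  h.pullbackClsL (adjointAction IG IM M) Ψ y m hm

theorem tangentClsL_apply (h : IsPrincipalBundle IG IM IB G pr) (Ψ : C^∞⟮IB', B'; IB, B⟯) (y : B')
    (m : M) (hm : pr m = Ψ y) (v : TangentSpace IM m) :
    h.tangentClsL Ψ y m hm v = h.tangentCls Ψ y m hm v := h.clsL_apply _ m hm v

theorem adjointClsL_apply (h : IsPrincipalBundle IG IM IB G pr) (Ψ : C^∞⟮IB', B'; IB, B⟯) (y : B')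
    (m : M) (hm : pr m = Ψ y) (ξ : GroupLieAlgebra IG G) :
    h.adjointClsL Ψ y m hm ξ = h.adjointCls Ψ y m hm ξ :=
  h.clsL_apply (adjointAction IG IM M) m hm ξ

theorem tangentCls_smul (h : IsPrincipalBundle IG IM IB G pr) (Ψ : C^∞⟮IB', B'; IB, B⟯) (y : B')
    (g : G) (m : M) (hm : pr m = Ψ y) (hm' : pr (g • m) = Ψ y) (v : TangentSpace IM m) :
    h.tangentCls Ψ y (g • m) hm' ((tangentAction IG IM G M).act g m v) =
      h.tangentCls Ψ y m hm v := h.cls_act (tangentAction IG IM G M) g m hm hm' v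

theorem adjointCls_smul (h : IsPrincipalBundle IG IM IB G pr) (Ψ : C^∞⟮IB', B'; IB, B⟯) (y : B')
    (g : G) (m : M) (hm : pr m = Ψ y) (hm' : pr (g • m) = Ψ y) (ξ : GroupLieAlgebra IG G) :
    h.adjointCls Ψ y (g • m) hm' (Ad IG g ξ) = h.adjointCls Ψ y m hm ξ :=
  h.cls_act (adjointAction IG IM M) g m hm hm' ξ

/-- The representative over `s(Ψ y)` of an element of the adjoint bundle, where `s` is the chosen
local section near `Ψ y₀`. -/
def adjointRep (h : IsPrincipalBundle IG IM IB G pr) (Ψ : C^∞⟮IB', B'; IB, B⟯) (y₀ y : B')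
    (z : h.PullbackQuot (adjointAction IG IM M) Ψ y) : GroupLieAlgebra IG G :=
  h.pullbackRep (adjointAction IG IM M) Ψ y₀ y z

theorem adjointCls_adjointRep (h : IsPrincipalBundle IG IM IB G pr) (Ψ : C^∞⟮IB', B'; IB, B⟯)
    (y₀ y : B') (hm : pr (h.sec (Ψ y₀) (Ψ y)) = Ψ y)
    (z : h.PullbackQuot (adjointAction IG IM M) Ψ y) :
    h.adjointCls Ψ y _ hm (h.adjointRep Ψ y₀ y z) = z := by
  rw [← h.adjointClsL_apply]
  exact h.pullbackClsL_pullbackRep (adjointAction IG IM M) Ψ y₀ y hm z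

end IsPrincipalBundle

namespace PrincipalConnection

variable {h : IsPrincipalBundle IG IM IB G pr} [FiniteDimensional ℝ EG] [FiniteDimensional ℝ EM]

/-- The fibre maps `[v] ↦ (T(Φ ∘ pr) v, [m, 𝔄(v)])` of the isomorphism
`Ψ*(TM / G) ≃ TB' ⊕ Ψ*𝔤̃`, computed with the chosen point `m` over `Ψ y`. -/
def tangentIsoFibre (𝔄 : PrincipalConnection h) {Φ : C^∞⟮IB, B; IB', B'⟯}
    {Ψ : C^∞⟮IB', B'; IB, B⟯} (h1 : ∀ y, Φ (Ψ y) = y) (h2 : ∀ b, Ψ (Φ b) = b) (y : B') :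
    h.PullbackQuot (tangentAction IG IM G M) Ψ y ≃L[ℝ]
      TangentSpace IB' y × h.PullbackQuot (adjointAction IG IM M) Ψ y :=
  (h.tangentClsL Ψ y (h.rep (Ψ y)) (h.proj_rep _)).symm.trans
    ((𝔄.splitL h1 h2 (h.proj_rep (Ψ y))).trans
      ((ContinuousLinearEquiv.refl ℝ (TangentSpace IB' y)).prodCongr
        (h.adjointClsL Ψ y (h.rep (Ψ y)) (h.proj_rep _))))

/-- The fibre maps are given by the same formula at every point `m` over `Ψ y`, because `Φ ∘ pr` is
invariant and `𝔄` is equivariant. -/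
theorem tangentIsoFibre_cls (𝔄 : PrincipalConnection h) {Φ : C^∞⟮IB, B; IB', B'⟯}
    {Ψ : C^∞⟮IB', B'; IB, B⟯} (h1 : ∀ y, Φ (Ψ y) = y) (h2 : ∀ b, Ψ (Φ b) = b) (y : B') (m : M)
    (hm : pr m = Ψ y) (v : TangentSpace IM m) :
    𝔄.tangentIsoFibre h1 h2 y (h.tangentCls Ψ y m hm v) =
      ((𝔄.splitMap Φ m y v).1, h.adjointCls Ψ y m hm (𝔄.form m v)) := by
  obtain ⟨g, rfl⟩ := h.exists_smul_eq ((h.proj_rep (Ψ y)).trans hm.symm)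
  obtain ⟨v, rfl⟩ := ((tangentAction IG IM G M).act g (h.rep (Ψ y))).surjective v
  have h4 : 𝔄.form (g • h.rep (Ψ y)) ((tangentAction IG IM G M).act g (h.rep (Ψ y)) v) =
      Ad IG g (𝔄.form (h.rep (Ψ y)) v) := 𝔄.form_smul g _ v
  have h6 : (𝔄.splitMap Φ (g • h.rep (Ψ y)) y
      ((tangentAction IG IM G M).act g (h.rep (Ψ y)) v)).1 =
      (𝔄.splitMap Φ (h.rep (Ψ y)) y v).1 := by
    refine TotalSpace.mk_injective (F := EB') (E := (TangentSpace IB' : B' → Type _)) y ?_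
    refine (𝔄.mk_splitMap_fst Φ (by rw [hm, h1]) _).trans
      (Eq.trans ?_ (𝔄.mk_splitMap_fst Φ (by rw [h.proj_rep, h1]) v).symm)
    have h7 : MDifferentiable IM IM (fun x : M => g • x) :=
      (ContMDiffSMul.contMDiff_const_smul (I := IG) (n := ∞) g).mdifferentiable (by simp)
    have h8 : MDifferentiable IM IB' (Φ ∘ pr) :=
      (Φ.contMDiff.comp h.contMDiff_proj).mdifferentiable (by simp)
    change tangentMap IM IB' (Φ ∘ pr) (tangentMap IM IM (fun x : M => g • x) ⟨_, v⟩) = _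
    rw [← Function.comp_apply (f := tangentMap IM IB' (Φ ∘ pr)), ← tangentMap_comp h8 h7]
    have h9 : (Φ ∘ pr) ∘ (fun x : M => g • x) = Φ ∘ pr :=
      funext fun x => congrArg Φ (h.proj_smul g x)
    rw [h9]
  rw [h.tangentCls_smul Ψ y g _ (h.proj_rep (Ψ y)) hm, h4,
    h.adjointCls_smul Ψ y g _ (h.proj_rep (Ψ y)) hm, h6]
  unfold tangentIsoFibre
  rw [ContinuousLinearEquiv.trans_apply, ← h.tangentClsL_apply,
    ContinuousLinearEquiv.symm_apply_apply, ← h.adjointClsL_apply]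
  rfl

theorem tangentIsoFibre_symm (𝔄 : PrincipalConnection h) {Φ : C^∞⟮IB, B; IB', B'⟯}
    {Ψ : C^∞⟮IB', B'; IB, B⟯} (h1 : ∀ y, Φ (Ψ y) = y) (h2 : ∀ b, Ψ (Φ b) = b) (y : B') (m : M)
    (hm : pr m = Ψ y) (u : TangentSpace IB' y) (v : TangentSpace IM m) (ξ : GroupLieAlgebra IG G)
    (hv : 𝔄.splitMap Φ m y v = (u, ξ)) :
    (𝔄.tangentIsoFibre h1 h2 y).symm (u, h.adjointCls Ψ y m hm ξ) =
      h.tangentCls Ψ y m hm v := by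
  rw [ContinuousLinearEquiv.symm_apply_eq, 𝔄.tangentIsoFibre_cls h1 h2 y m hm,
    ← 𝔄.splitMap_snd Φ m y, hv]

/-- The inverse of the fibre map through an arbitrary lift `v` of `T Ψ(u)`, which need not be
horizontal: its vertical part is corrected to the prescribed value `ξ`. -/
theorem tangentIsoFibre_symm_infGen_add (𝔄 : PrincipalConnection h) {Φ : C^∞⟮IB, B; IB', B'⟯}
    {Ψ : C^∞⟮IB', B'; IB, B⟯} (h1 : ∀ y, Φ (Ψ y) = y) (h2 : ∀ b, Ψ (Φ b) = b) (y : B') (m : M)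
    (hm : pr m = Ψ y) (u : TangentSpace IB' y) (v : TangentSpace IM m)
    (hv : tangentMap IM IB pr ⟨m, v⟩ = tangentMap IB' IB Ψ ⟨y, u⟩) (ξ : GroupLieAlgebra IG G) :
    (𝔄.tangentIsoFibre h1 h2 y).symm (u, h.adjointCls Ψ y m hm ξ) =
      h.tangentCls Ψ y m hm (infGen IG IM (ξ - 𝔄.form m v) m + v) := by
  refine 𝔄.tangentIsoFibre_symm h1 h2 y m hm u _ ξ (𝔄.splitMap_of_proj h1 hm u _ ?_ ξ ?_)
  · rw [add_comm, tangentMap_add_infGen h, hv]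
  · rw [map_add, 𝔄.form_infGen, sub_add_cancel]

/-- The isomorphism `Ψ*(TM / G) ≃ TB' ⊕ Ψ*𝔤̃` of smooth vector bundles given by a principal
connection on `M → B` and a diffeomorphism `Φ : B ≃ B'` with inverse `Ψ`. In both directions
smoothness is read off on representatives along a local section; for the inverse, the lift of a
vector tangent to the section is used, as it is visibly smooth. -/
def tangentIso (𝔄 : PrincipalConnection h) {Φ : C^∞⟮IB, B; IB', B'⟯}
    {Ψ : C^∞⟮IB', B'; IB, B⟯} (h1 : ∀ y, Φ (Ψ y) = y) (h2 : ∀ b, Ψ (Φ b) = b) :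
    h.TangentIso Ψ where
  equiv := 𝔄.tangentIsoFibre h1 h2
  contMDiff_equiv := by
    intro z₀
    have hr := h.contMDiffAt_pullbackRep (tangentAction IG IM G M) Ψ z₀
    have hb : ContMDiffAt (IB'.prod 𝓘(ℝ, EM)) IB' ∞
        (fun z : TotalSpace EM (h.PullbackQuot (tangentAction IG IM G M) Ψ) => z.1) z₀ :=
      (Bundle.contMDiff_proj _).contMDiffAt
    have key : ∀ᶠ z in 𝓝 z₀, ∃ hm : pr (h.sec (Ψ z₀.1) (Ψ z.1)) = Ψ z.1,
        𝔄.tangentIsoFibre h1 h2 z.1 z.2 =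
          ((𝔄.splitMap Φ _ z.1 (h.pullbackRep (tangentAction IG IM G M) Ψ z₀.1 z.1 z.2)).1,
            h.adjointCls Ψ z.1 _ hm
              (𝔄.form _ (h.pullbackRep (tangentAction IG IM G M) Ψ z₀.1 z.1 z.2))) := by
      filter_upwards [hb.continuousAt (h.eventually_proj_sec_pullback Ψ z₀.1)] with z hm
      refine ⟨hm, ?_⟩
      rw [← 𝔄.tangentIsoFibre_cls h1 h2 z.1 _ hm, ← h.tangentClsL_apply]
      exact congrArg _
        (h.pullbackClsL_pullbackRep (tangentAction IG IM G M) Ψ z₀.1 z.1 hm z.2).symm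
    refine contMDiffAt_prodBundle.2 ⟨?_, ?_⟩
    · refine ((((Φ.contMDiff.comp h.contMDiff_proj).contMDiff_tangentMap
        (m := ∞) (by simp)) _).comp z₀ hr).congr_of_eventuallyEq ?_
      filter_upwards [key] with z hz
      obtain ⟨hm, hz⟩ := hz
      refine Eq.trans ?_ (𝔄.mk_splitMap_fst Φ (y := z.1) (by rw [hm, h1]) _)
      exact congrArg (fun w : TangentSpace IB' z.1 × h.PullbackQuot (adjointAction IG IM M) Ψ z.1 =>
        (⟨z.1, w.1⟩ : TangentBundle IB' B')) hz
    · refine h.contMDiffAt_pullbackQuot_of_rep (adjointAction IG IM M) Ψ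
        (r := fun z => ⟨h.sec (Ψ z₀.1) (Ψ z.1),
          𝔄.form _ (h.pullbackRep (tangentAction IG IM G M) Ψ z₀.1 z.1 z.2)⟩) hb ?_ ?_
      · refine contMDiffAt_totalSpace.2 ⟨(contMDiffAt_totalSpace.1 hr).1, ?_⟩
        exact 𝔄.contMDiff_form.contMDiffAt.comp z₀ hr
      · filter_upwards [key] with z hz
        obtain ⟨hm, hz⟩ := hz
        refine ⟨hm, ?_⟩
        refine (h.adjointClsL_apply Ψ z.1 _ hm _).trans ?_
        exact (congrArg Prod.snd hz).symm
  contMDiff_symm := by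
    intro w₀
    have hw := contMDiffAt_prodBundle.1 (contMDiffAt_id (x := w₀) (n := ∞)
      (I := IB'.prod 𝓘(ℝ, EB' × EG)))
    have hb := (contMDiffAt_totalSpace.1 hw.1).1
    have hξ : ContMDiffAt (M' := EG) (IB'.prod 𝓘(ℝ, EB' × EG)) 𝓘(ℝ, EG) ∞
        (fun w : TotalSpace (EB' × EG) ((TangentSpace IB' : B' → Type _) ×ᵇ
          h.PullbackQuot (adjointAction IG IM M) Ψ) =>
          (h.adjointRep Ψ w₀.1 w.1 w.2.2 : EG)) w₀ :=
      (contMDiffAt_totalSpace.1 ((h.contMDiffAt_pullbackRep (adjointAction IG IM M) Ψ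
        ⟨w₀.1, w₀.2.2⟩).comp w₀ hw.2)).2
    -- a lift of the first component, tangent to the chosen local section
    let v : TotalSpace (EB' × EG) ((TangentSpace IB' : B' → Type _) ×ᵇ
        h.PullbackQuot (adjointAction IG IM M) Ψ) → TangentBundle IM M := fun w =>
      tangentMap IB IM (h.sec (Ψ w₀.1)) (tangentMap IB' IB Ψ ⟨w.1, w.2.1⟩)
    have hv : ContMDiffAt (IB'.prod 𝓘(ℝ, EB' × EG)) IM.tangent ∞ v w₀ :=
      (contMDiffAt_tangentMap (h.triv (Ψ w₀.1)).open_baseSet (h.contMDiffOn_sec (Ψ w₀.1))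
        (v := tangentMap IB' IB Ψ ⟨w₀.1, w₀.2.1⟩) (h.mem_base _)).comp w₀
          (((Ψ.contMDiff.contMDiff_tangentMap (m := ∞) (by simp)) _).comp w₀ hw.1)
    have hform : ContMDiffAt (M' := EG) (IB'.prod 𝓘(ℝ, EB' × EG)) 𝓘(ℝ, EG) ∞
        (fun w => (𝔄.form (v w).1 (v w).2 : EG)) w₀ :=
      𝔄.contMDiff_form.contMDiffAt.comp w₀ hv
    refine h.contMDiffAt_pullbackQuot_of_rep (tangentAction IG IM G M) Ψ hb
      (contMDiffAt_infGen_add (IG := IG) (G := G) (hξ.sub hform) hv) ?_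
    have hbase : ∀ᶠ w in 𝓝 w₀, Ψ w.1 ∈ (h.triv (Ψ w₀.1)).baseSet :=
      (Ψ.contMDiff.continuous.continuousAt.comp hb.continuousAt)
        ((h.triv (Ψ w₀.1)).open_baseSet.mem_nhds (h.mem_base _))
    filter_upwards [hbase] with w hx
    have hm : pr (h.sec (Ψ w₀.1) (Ψ w.1)) = Ψ w.1 := h.proj_sec hx
    refine ⟨hm, ?_⟩
    refine (h.tangentClsL_apply Ψ w.1 _ hm _).trans ?_
    refine (𝔄.tangentIsoFibre_symm_infGen_add h1 h2 w.1 _ hm w.2.1 (v w).2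
      (h.tangentMap_proj_sec (b := Ψ w₀.1) (tangentMap IB' IB Ψ ⟨w.1, w.2.1⟩) hx)
      (h.adjointRep Ψ w₀.1 w.1 w.2.2)).symm.trans ?_
    rw [h.adjointCls_adjointRep]

end PrincipalConnection
end TangentSplitting

/-! ### The diffeomorphism `Φ` -/

noncomputable section Descent

set_option linter.unusedSectionVars false

open Set Topology MulAction Bundle

namespace IsPrincipalBundle

variable {EG HG EM HM EB HB EM' HM' EB' HB' EN HN : Type*}
  [NormedAddCommGroup EG] [NormedSpace ℝ EG] [TopologicalSpace HG]
  [NormedAddCommGroup EM] [NormedSpace ℝ EM] [TopologicalSpace HM]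
  [NormedAddCommGroup EB] [NormedSpace ℝ EB] [TopologicalSpace HB]
  [NormedAddCommGroup EM'] [NormedSpace ℝ EM'] [TopologicalSpace HM']
  [NormedAddCommGroup EB'] [NormedSpace ℝ EB'] [TopologicalSpace HB']
  [NormedAddCommGroup EN] [NormedSpace ℝ EN] [TopologicalSpace HN]
  {IG : ModelWithCorners ℝ EG HG} {IM : ModelWithCorners ℝ EM HM}
  {IB : ModelWithCorners ℝ EB HB} {IM' : ModelWithCorners ℝ EM' HM'}
  {IB' : ModelWithCorners ℝ EB' HB'} {IN : ModelWithCorners ℝ EN HN}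
  {G : Type*} [TopologicalSpace G] [ChartedSpace HG G] [Group G]
  {M : Type*} [TopologicalSpace M] [ChartedSpace HM M] [MulAction G M]
  [ContMDiffSMul IG IM ∞ G M]
  {B : Type*} [TopologicalSpace B] [ChartedSpace HB B] {pr : M → B}
  {M' : Type*} [TopologicalSpace M'] [ChartedSpace HM' M'] [MulAction G M']
  [ContMDiffSMul IG IM' ∞ G M']
  {B' : Type*} [TopologicalSpace B'] [ChartedSpace HB' B'] {pr' : M' → B'}
  {N : Type*} [TopologicalSpace N] [ChartedSpace HN N]

/-- The projection of a principal bundle has smooth local sections, so that smoothness descends to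
the base. -/
theorem contMDiff_of_comp_proj (h : IsPrincipalBundle IG IM IB G pr) {f : B → N}
    (hf : ContMDiff IM IN ∞ (f ∘ pr)) : ContMDiff IB IN ∞ f := by
  intro b
  refine ((hf _).comp b (h.contMDiffAt_sec b)).congr_of_eventuallyEq ?_
  filter_upwards [h.eventually_proj_sec b] with x hx
  exact (congrArg f hx).symm

theorem contMDiff_of_comp_prodMap_proj (h : IsPrincipalBundle IG IM IB G pr)
    (h' : IsPrincipalBundle IG IM' IB' G pr') {f : B × B' → N}
    (hf : ContMDiff (IM.prod IM') IN ∞ (f ∘ Prod.map pr pr')) :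
    ContMDiff (IB.prod IB') IN ∞ f := by
  rintro ⟨b, b'⟩
  have h1 : ContMDiffAt (IB.prod IB') (IM.prod IM') ∞ (Prod.map (h.sec b) (h'.sec b')) (b, b') :=
    (h.contMDiffAt_sec b).prodMap (h'.contMDiffAt_sec b')
  refine ((hf _).comp (b, b') h1).congr_of_eventuallyEq ?_
  filter_upwards [(h.eventually_proj_sec b).prod_nhds (h'.eventually_proj_sec b')] with x hx
  exact (congrArg f (Prod.ext hx.1 hx.2)).symm

end IsPrincipalBundle

namespace AffineDiscreteConnection

variable {EG HG EQ HQ EB HB : Type*}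
  [NormedAddCommGroup EG] [NormedSpace ℝ EG] [TopologicalSpace HG]
  [NormedAddCommGroup EQ] [NormedSpace ℝ EQ] [TopologicalSpace HQ]
  [NormedAddCommGroup EB] [NormedSpace ℝ EB] [TopologicalSpace HB]
  {IG : ModelWithCorners ℝ EG HG} {IQ : ModelWithCorners ℝ EQ HQ}
  {IB : ModelWithCorners ℝ EB HB}
  {G : Type*} [TopologicalSpace G] [ChartedSpace HG G] [Group G]
  {Q : Type*} [TopologicalSpace Q] [ChartedSpace HQ Q] [MulAction G Q]
  [ContMDiffSMul IG IQ ∞ G Q] [ChartedSpace HB (orbitRel.Quotient G Q)]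

/-- The inverse of `Φ`: `([q₀, w], [q₁]) ↦ [q₀, (w 𝒜(q₀, q₁)⁻¹) • q₁]`. The group element is the
unique `g` with `𝒜(q₀, g • q₁) = w`. -/
def Psi (𝒜 : AffineDiscreteConnection IG IQ G Q)
    (hQ : IsPrincipalBundle IG IQ IB G (Quotient.mk _ : Q → orbitRel.Quotient G Q))
    (y : hQ.ReducedSpace) : hQ.PairQuot :=
  Quotient.lift₂ (s₁ := orbitRel G (Q × ConjSpace G)) (s₂ := orbitRel G Q)
    (fun (p : Q × G) (q₁ : Q) => hQ.pairMk (p.1, (p.2 * (𝒜.toFun p.1 q₁)⁻¹) • q₁)) (by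
      have key : ∀ (q₀ : Q) (w : G) (q₁ : Q) (g k : G),
          hQ.pairMk (g • q₀, (g * w * g⁻¹ * (𝒜.toFun (g • q₀) (k • q₁))⁻¹) • k • q₁) =
            hQ.pairMk (q₀, (w * (𝒜.toFun q₀ q₁)⁻¹) • q₁) := by
        intro q₀ w q₁ g k
        refine Eq.trans ?_ (hQ.assocMk_smul (IN := IQ) g (q₀, (w * (𝒜.toFun q₀ q₁)⁻¹) • q₁))
        refine congrArg (hQ.assocMk IQ) (Prod.ext rfl ?_)
        change (g * w * g⁻¹ * (𝒜.toFun (g • q₀) (k • q₁))⁻¹) • k • q₁ =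
          g • (w * (𝒜.toFun q₀ q₁)⁻¹) • q₁
        rw [𝒜.toFun_smul, smul_smul, smul_smul]
        congr 1
        group
      rintro _ _ ⟨q₀, w⟩ q₁ ⟨g, rfl⟩ ⟨k, rfl⟩
      exact key q₀ w q₁ g k) y.1 y.2

theorem Psi_mk (𝒜 : AffineDiscreteConnection IG IQ G Q)
    (hQ : IsPrincipalBundle IG IQ IB G (Quotient.mk _ : Q → orbitRel.Quotient G Q))
    (q₀ q₁ : Q) (w : G) : 𝒜.Psi hQ (hQ.conjMk (q₀, w), Quotient.mk _ q₁) =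
      hQ.pairMk (q₀, (w * (𝒜.toFun q₀ q₁)⁻¹) • q₁) := rfl

theorem toFun_smul_right (𝒜 : AffineDiscreteConnection IG IQ G Q) (g : G) (q₀ q₁ : Q) :
    𝒜.toFun q₀ (g • q₁) = g * 𝒜.toFun q₀ q₁ := by
  simpa using 𝒜.toFun_smul 1 g q₀ q₁

theorem Psi_Phi (𝒜 : AffineDiscreteConnection IG IQ G Q)
    (hQ : IsPrincipalBundle IG IQ IB G (Quotient.mk _ : Q → orbitRel.Quotient G Q))
    (x : hQ.PairQuot) : 𝒜.Psi hQ (𝒜.Phi hQ x) = x := by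
  obtain ⟨⟨q₀, q₁⟩, rfl⟩ := hQ.assocMk_surjective x
  refine (𝒜.Psi_mk hQ q₀ q₁ (𝒜.toFun q₀ q₁)).trans ?_
  rw [mul_inv_cancel, one_smul]

theorem Phi_Psi (𝒜 : AffineDiscreteConnection IG IQ G Q)
    (hQ : IsPrincipalBundle IG IQ IB G (Quotient.mk _ : Q → orbitRel.Quotient G Q))
    (y : hQ.ReducedSpace) : 𝒜.Phi hQ (𝒜.Psi hQ y) = y := by
  have key : ∀ (q₀ : Q) (w : G) (q₁ : Q),
      𝒜.Phi hQ (hQ.pairMk (q₀, (w * (𝒜.toFun q₀ q₁)⁻¹) • q₁)) =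
        (hQ.conjMk (q₀, w), Quotient.mk _ q₁) := by
    intro q₀ w q₁
    refine (𝒜.Upsilon_apply hQ q₀ ((w * (𝒜.toFun q₀ q₁)⁻¹) • q₁)).trans ?_
    rw [hQ.proj_smul, toFun_smul_right, inv_mul_cancel_right]
  obtain ⟨x, q⟩ := y
  obtain ⟨⟨q₀, w⟩, rfl⟩ := hQ.assocMk_surjective x
  obtain ⟨q₁, rfl⟩ := hQ.surjective q
  exact key q₀ w q₁

variable [LieGroup IG ∞ G] [IsManifold IQ ∞ Q] [IsManifold IB ∞ (orbitRel.Quotient G Q)]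

theorem contMDiff_Phi (𝒜 : AffineDiscreteConnection IG IQ G Q)
    (hQ : IsPrincipalBundle IG IQ IB G (Quotient.mk _ : Q → orbitRel.Quotient G Q)) :
    ContMDiff (IB.prod IQ) ((IB.prod IG).prod IB) ∞ (𝒜.Phi hQ) := by
  refine (hQ.assoc (IN := IQ) (N := Q)).contMDiff_of_comp_proj ?_
  have h1 : ContMDiff (IQ.prod IQ) (IQ.prod IG) ∞
      (fun p : Q × Q => ((p.1, 𝒜.toFun p.1 p.2) : Q × ConjSpace G)) :=
    contMDiff_fst.prodMk 𝒜.contMDiff_toFun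
  exact ((hQ.contMDiff_assocMk (IN := IG) (N := ConjSpace G)).comp h1).prodMk
    (hQ.contMDiff_proj.comp contMDiff_snd)

theorem contMDiff_Psi (𝒜 : AffineDiscreteConnection IG IQ G Q)
    (hQ : IsPrincipalBundle IG IQ IB G (Quotient.mk _ : Q → orbitRel.Quotient G Q)) :
    ContMDiff ((IB.prod IG).prod IB) (IB.prod IQ) ∞ (𝒜.Psi hQ) := by
  refine (hQ.assoc (IN := IG) (N := ConjSpace G)).contMDiff_of_comp_prodMap_proj hQ ?_
  have h1 : ContMDiff ((IQ.prod IG).prod IQ) IG ∞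
      (fun p : (Q × G) × Q => p.1.2 * (𝒜.toFun p.1.1 p.2)⁻¹) :=
    (contMDiff_snd.comp contMDiff_fst).mul (𝒜.contMDiff_toFun.comp
      ((contMDiff_fst.comp contMDiff_fst).prodMk contMDiff_snd)).inv
  have h2 : ContMDiff ((IQ.prod IG).prod IQ) (IQ.prod IQ) ∞
      (fun p : (Q × G) × Q => (p.1.1, (p.1.2 * (𝒜.toFun p.1.1 p.2)⁻¹) • p.2)) :=
    (contMDiff_fst.comp contMDiff_fst).prodMk (h1.smul contMDiff_snd)
  exact (hQ.contMDiff_assocMk (IN := IQ) (N := Q)).comp h2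

end AffineDiscreteConnection

end Descent

/-! ### The splitting for an affine discrete connection -/

theorem mainTheorem5
    {EG HG EQ HQ EB HB : Type*}
    [NormedAddCommGroup EG] [NormedSpace ℝ EG] [FiniteDimensional ℝ EG] [TopologicalSpace HG]
    [NormedAddCommGroup EQ] [NormedSpace ℝ EQ] [FiniteDimensional ℝ EQ] [TopologicalSpace HQ]
    [NormedAddCommGroup EB] [NormedSpace ℝ EB] [FiniteDimensional ℝ EB] [TopologicalSpace HB]
    (IG : ModelWithCorners ℝ EG HG) [IG.Boundaryless]
    (IQ : ModelWithCorners ℝ EQ HQ) [IQ.Boundaryless]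
    (IB : ModelWithCorners ℝ EB HB) [IB.Boundaryless]
    (G : Type*) [TopologicalSpace G] [ChartedSpace HG G] [Group G] [LieGroup IG ∞ G]
    (Q : Type*) [TopologicalSpace Q] [ChartedSpace HQ Q] [IsManifold IQ ∞ Q]
    [MulAction G Q] [ContMDiffSMul IG IQ ∞ G Q]
    [ChartedSpace HB (MulAction.orbitRel.Quotient G Q)]
    [IsManifold IB ∞ (MulAction.orbitRel.Quotient G Q)]
    (hQ : IsPrincipalBundle IG IQ IB G (Quotient.mk _ : Q → MulAction.orbitRel.Quotient G Q))
    (𝒜 : AffineDiscreteConnection IG IQ G Q)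
    (𝔄 : PrincipalConnection (hQ.assoc (IN := IQ) (N := Q))) :
    ∃ (Φ : Diffeomorph (IB.prod IQ) ((IB.prod IG).prod IB) hQ.PairQuot hQ.ReducedSpace ∞)
      (Ψ : C^∞⟮(IB.prod IG).prod IB, hQ.ReducedSpace; IB.prod IQ, hQ.PairQuot⟯),
      (∀ x, Φ x = 𝒜.Phi hQ x) ∧ (∀ y, Ψ y = Φ.symm y) ∧
      (∀ (p : Q × Q) (u : TangentBundle (IB.prod IQ) hQ.PairQuot), u.proj = hQ.pairMk p →
        ∃! v : TangentSpace (IQ.prod IQ) p, 𝔄.IsHorizontalLift p u v) ∧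
      ∃ (𝒳 : hQ.assoc.TangentIso Ψ) (𝒳' : hQ.assoc.CotangentIso Ψ),
        ∀ (y : hQ.ReducedSpace) (p : Q × Q) (hp : hQ.pairMk p = Ψ y),
          (∀ v : TangentSpace (IQ.prod IQ) p,
            (⟨y, (𝒳.equiv y (hQ.assoc.tangentCls Ψ y p hp v)).1⟩ :
                TangentBundle ((IB.prod IG).prod IB) hQ.ReducedSpace) =
              tangentMap (IQ.prod IQ) ((IB.prod IG).prod IB) (𝒜.Upsilon hQ) ⟨p, v⟩ ∧
            (𝒳.equiv y (hQ.assoc.tangentCls Ψ y p hp v)).2 =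
              hQ.assoc.adjointCls Ψ y p hp (𝔄.form p v)) ∧
          (∀ (u : TangentSpace ((IB.prod IG).prod IB) y) (ξ : GroupLieAlgebra IG G),
            (𝒳.equiv y).symm (u, hQ.assoc.adjointCls Ψ y p hp ξ) =
              hQ.assoc.tangentCls Ψ y p hp
                (𝔄.horizontalLift p
                    (tangentMap ((IB.prod IG).prod IB) (IB.prod IQ) Ψ ⟨y, u⟩) +
                  infGen IG (IQ.prod IQ) ξ p)) ∧
          ∀ (α : TangentSpace (IQ.prod IQ) p →L[ℝ] ℝ) (v : TangentSpace (IQ.prod IQ) p),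
            ((𝒳'.equiv y (hQ.assoc.cotangentCls Ψ y p hp α)).1
                (𝒳.equiv y (hQ.assoc.tangentCls Ψ y p hp v)).1 : ℝ) +
              (𝒳'.equiv y (hQ.assoc.cotangentCls Ψ y p hp α)).2
                (𝒳.equiv y (hQ.assoc.tangentCls Ψ y p hp v)).2 = α v := by
  let Φ : Diffeomorph (IB.prod IQ) ((IB.prod IG).prod IB) hQ.PairQuot hQ.ReducedSpace ∞ :=
    { toFun := 𝒜.Phi hQ
      invFun := 𝒜.Psi hQ
      left_inv := 𝒜.Psi_Phi hQ
      right_inv := 𝒜.Phi_Psi hQ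
      contMDiff_toFun := 𝒜.contMDiff_Phi hQ
      contMDiff_invFun := 𝒜.contMDiff_Psi hQ }
  let Φ' : C^∞⟮IB.prod IQ, hQ.PairQuot; (IB.prod IG).prod IB, hQ.ReducedSpace⟯ :=
    ⟨𝒜.Phi hQ, 𝒜.contMDiff_Phi hQ⟩
  let Ψ : C^∞⟮(IB.prod IG).prod IB, hQ.ReducedSpace; IB.prod IQ, hQ.PairQuot⟯ :=
    ⟨𝒜.Psi hQ, 𝒜.contMDiff_Psi hQ⟩
  have h1 : ∀ y, Φ' (Ψ y) = y := 𝒜.Phi_Psi hQ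
  have h2 : ∀ x, Ψ (Φ' x) = x := 𝒜.Psi_Phi hQ
  refine ⟨Φ, Ψ, fun _ => rfl, fun _ => rfl,
    fun p u hu => 𝔄.existsUnique_isHorizontalLift p u hu, 𝔄.tangentIso h1 h2,
    hQ.assoc.dualIso (tangentAction IG (IQ.prod IQ) G (Q × Q)) Ψ (𝔄.tangentIso h1 h2), ?_⟩
  intro y p hp
  have hX : ∀ v, (𝔄.tangentIso h1 h2).equiv y (hQ.assoc.tangentCls Ψ y p hp v) =
      ((𝔄.splitMap Φ' p y v).1, hQ.assoc.adjointCls Ψ y p hp (𝔄.form p v)) :=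
    𝔄.tangentIsoFibre_cls h1 h2 y p hp
  refine ⟨fun v => ⟨?_, congrArg Prod.snd (hX v)⟩, fun u ξ => ?_, fun α v => ?_⟩
  · rw [hX]
    exact 𝔄.mk_splitMap_fst Φ' ((congrArg Φ' hp).trans (h1 y)) v
  · exact 𝔄.tangentIsoFibre_symm h1 h2 y p hp u _ ξ (𝔄.splitMap_horizontalLift_add h1 hp u ξ)
  · refine (hQ.assoc.dualIsoFibre_pairing (tangentAction IG (IQ.prod IQ) G (Q × Q)) Ψ
      (𝔄.tangentIso h1 h2) y _ _).trans ?_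
    refine Eq.trans ?_
      (hQ.assoc.quotDualL_cls (tangentAction IG (IQ.prod IQ) G (Q × Q)) Ψ y p hp α v)
    rw [IsPrincipalBundle.pullbackClsL_apply, IsPrincipalBundle.pullbackClsL_apply]
    rfl
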